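/- Consider the symmetric Tardos fingerprinting scheme with $n$ users, code length $\ell$, bias distribution $F$ (a probability distribution on $[0,1]$) and threshold $Z\in\mathbb R$. Biases $p_1,\dots,p_\ell$ are drawn independently from $F$; given the biases, the bits $X_{j,i}$ ($1\le j\le n$, $1\le i\le\ell$) are independent with $X_{j,i}\sim\mathrm{Bernoulli}(p_i)$. A nonempty coalition $C$ of at most $c$ users sees the rows $(X_{j,\cdot})_{j\in C}$ (and not the biases) and outputs, by an arbitrary randomized strategy, a word $y\in\{0,1\}^\ell$ satisfying the marking assumption: for each $i$ there is $j\in C$ with $y_i=X_{j,i}$. User $j$ is accused if $\sum_{i=1}^{\ell} g(X_{j,i},y_i,p_i)>Z$, where $$g(1,1,p)=\sqrt{\tfrac{1-p}{p}},\quad g(1,0,p)=-\sqrt{\tfrac{1-p}{p}},\quad g(0,1,p)=-\sqrt{\tfrac{p}{1-p}},\quad g(0,0,p)=\sqrt{\tfrac{p}{1-p}}.$$ The scheme is secure against $c$ colluders with error probabilities $\varepsilon_1,\varepsilon_2$ if, for every such coalition and strategy, the probability that some user outside $C$ is accused is at most $\varepsilon_1$, and the probability that no member of $C$ is accused is at most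 $\varepsilon_2$. Let $\ell^*(n,c,\varepsilon_1,\varepsilon_2)$ be the least $\ell$ for which some $F$ and $Z$ make the scheme secure. Corollary. In the symmetric Tardos scheme the code length $\ell=\left(\frac{\pi^2}{2}+o(1)\right)c^2\ln(n/\varepsilon_1)$ is asymptotically optimal. That is: fix $\varepsilon_2>0$ and $b_1>0$ with $b_1+\varepsilon_2<1$. Then $$\ell^*(n,c,\varepsilon_1,\varepsilon_2)=\left(\frac{\pi^2}{2}+o(1)\right)c^2\ln(n/\varepsilon_1)$$ as $c\to\infty$, uniformly over $n\ge c$ and $0<\varepsilon_1\le b_1$ with $\ln c=o(\ln(n/\varepsilon_1))$, and the upper bound holds uniformly over all $n\ge c$ and $0<\varepsilon_1\le b_1$. Precisely: for every $\eta>0$ there is $K$ such that for all $c\ge K$, all $n\ge c$ and all $0<\varepsilon_1\le b_1$, the minimum $\ell^*$ exists and satisfies $\ell^*\le\left(\frac{\pi^2}{2}+\eta\right)c^2\ln(n/\varepsilon_1)$, and if moreover $\ln(n/\varepsilon_1)\ge K\ln c$, then also $\ell^*\ge\left(\frac{\pi^2}{2}-\eta\right)c^2\ln(n/\varepsilon_1)$.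 -/

import Mathlib

open scoped ENNReal

namespace SymTardos

/-- The symbol-symmetric score of a user holding the symbol `x` in a segment with bias `p` in which
the pirates output `y` (`true` stands for `1`, `false` for `0`). -/
noncomputable def score (x y : Bool) (p : ℝ) : ℝ :=
  match x, y with
  | true, true => √((1 - p) / p)
  | true, false => -√((1 - p) / p)
  | false, true => -√(p / (1 - p))
  | false, false => √(p / (1 - p))

/-- The probability that a Bernoulli(`p`) bit equals `b`. -/
noncomputable def bitProb (p : unitInterval) (b : Bool) : ℝ≥0∞ :=
  if b then ENNReal.ofReal p else ENNReal.ofReal (1 - p)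

/-- The probability of the code matrix `X` given the biases `p`: all entries are independent, and
`X j i` is Bernoulli(`p i`). -/
noncomputable def codeProb {n l : ℕ} (p : Fin l → unitInterval) (X : Fin n → Fin l → Bool) : ℝ≥0∞ :=
  ∏ j, ∏ i, bitProb (p i) (X j i)

/-- A (randomized) pirate strategy of the coalition `C`: it sees the code words of the members of
`C`, and nothing else, and produces a random forged word of length `l`. -/
abbrev Strategy {n : ℕ} (C : Finset (Fin n)) (l : ℕ) : Type :=
  (C → Fin l → Bool) → PMF (Fin l → Bool)

/-- The marking assumption: in each segment the pirates output one of their received symbols. -/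
def Strategy.Marking {n l : ℕ} {C : Finset (Fin n)} (ρ : Strategy C l) : Prop :=
  ∀ x : C → Fin l → Bool, ∀ y ∈ (ρ x).support, ∀ i, ∃ j, y i = x j i

/-- User `j` is accused when the sum of the scores exceeds the threshold `Z`. -/
def Accused {n l : ℕ} (Z : ℝ) (p : Fin l → unitInterval) (X : Fin n → Fin l → Bool)
    (y : Fin l → Bool) (j : Fin n) : Prop :=
  Z < ∑ i, score (X j i) (y i) (p i)

open Classical in
/-- The probability of the event `E` in the following experiment: the biases `p i` are drawn
independently from `F`, then the code matrix `X` is drawn given `p`, and then the forged word `y` is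
drawn by the strategy `ρ` from the rows of `X` that belong to the coalition. -/
noncomputable def prob {n l : ℕ} (F : MeasureTheory.ProbabilityMeasure unitInterval)
    {C : Finset (Fin n)} (ρ : Strategy C l)
    (E : (Fin l → unitInterval) → (Fin n → Fin l → Bool) → (Fin l → Bool) → Prop) : ℝ≥0∞ :=
  ∫⁻ p, ∑ X : Fin n → Fin l → Bool, ∑ y : Fin l → Bool,
      codeProb p X * ρ (fun j => X j) y * (if E p X y then 1 else 0)
    ∂(MeasureTheory.Measure.pi fun _ : Fin l => (F : MeasureTheory.Measure unitInterval))

/-- The symmetric Tardos scheme with `n` users, code length `l`, bias distribution `F` and threshold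
`Z` resists up to `c` colluders with error probabilities `ε₁`, `ε₂`: whatever the coalition and its
strategy, some innocent user is accused with probability at most `ε₁`, and no pirate is accused with
probability at most `ε₂`. -/
def Secure (n c l : ℕ) (F : MeasureTheory.ProbabilityMeasure unitInterval) (Z ε₁ ε₂ : ℝ) : Prop :=
  ∀ C : Finset (Fin n), C.Nonempty → C.card ≤ c → ∀ ρ : Strategy C l, ρ.Marking →
    prob F ρ (fun p X y => ∃ j, j ∉ C ∧ Accused Z p X y j) ≤ ENNReal.ofReal ε₁ ∧
    prob F ρ (fun p X y => ∀ j ∈ C, ¬ Accused Z p X y j) ≤ ENNReal.ofReal ε₂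

/-- The code lengths at which some choice of the bias distribution and of the threshold makes the
symmetric Tardos scheme secure. -/
def secureLengths (n c : ℕ) (ε₁ ε₂ : ℝ) : Set ℕ :=
  {l | ∃ (F : MeasureTheory.ProbabilityMeasure unitInterval) (Z : ℝ), Secure n c l F Z ε₁ ε₂}

end SymTardos

/-!
The proof has two halves: a scheme that attains the constant `π ^ 2 / 2`, and a pirate strategy
against which no bias distribution and no threshold do better. Once both are known, the least secure
length exists because the set of secure lengths is nonempty. Throughout, `L = log (n / ε₁)`.

**Upper bound** (`exists_secureLengths_le`). The biases follow the arcsine law, `p = sin² φ` with `φ`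
uniform on an interval, truncated at distance of order `1 / √c` from the end points so that the score
is bounded by a multiple of `√c`. The score of an innocent user has
mean `0` and variance `1` in each segment whatever the forgery, so that Chernoff's bound and a union
bound over the `n` users show that a threshold `Z` slightly above `√(2 l L)` is safe for them. In the
variable `φ` the score is half the logarithmic derivative of the probability of a symbol. Hence the
expected total score of the pirates in a column integrates to a boundary term: it vanishes up to the
truncation for every column containing both symbols, whatever the pirates output there, and the two
constant columns, where the marking assumption fixes the output, contribute `2 / π` in total. So the
pirates together score about `(2 / π) l`, and if `c Z` is below this one of them is accused; with
`l = (π ^ 2 / 2 + η) c ^ 2 L` there is room between the two conditions. The exponential moment of the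
total score is maximized column by column, which settles all strategies at once, including those that
correlate the segments.

**Lower bound** (`exists_le_of_mem_secureLengths`). A coalition of `m` pirates, `m` slightly less than
`c`, outputs `1` with probability `f (k / m)` in a segment where it holds `k` ones, for a smooth
profile `f` close to `(2 / π) arcsin √x` (`exists_profile`). Given the output, the symbol of each
pirate has density `1 + μ g` with respect to that of an innocent user, where `g` is the score
(`bern_mul_bern_outGiven_eq_shift`, `pexp_strategy`). The mean of `μ` is
`2 √(p (1 - p)) E f' / m`, at most about `(2 / π) / m` at every bias `p`, because this profile
equalizes the information over all biases. A change of measure then lets an innocent user reach any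
threshold that a pirate reaches with probability at least `s / m`: on the segments of moderate bias
by the constant tilt `θ` slightly above `(2 / π) / m`, which costs a factor `exp (-l θ ^ 2 / 2)`
(`rowAcc_ge_of_tilt`), and on the others by the pirate's own law, where the exponent `∑ μ ^ 2` is
negligible because `f` is constant near `0` and `1`. Codes that are short, or have few segments of
moderate bias, are dealt with by the pirate's own law alone (`rowAcc_ge_of_shift`). If `l` is below
`(π ^ 2 / 2 - η) c ^ 2 L`, this gives each innocent user an accusation probability of at
least `exp (-(1 - η') L)` for a typical forgery (`exists_prob_rowAcc_lt_le`), much more than `ε₁ / n`.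
Terms polynomial in `c` come from the union bound over the pirates and from the
fluctuations; they are absorbed since `L` dominates `log c`. As some pirate must be accused with
probability at least `1 - ε₂ > b₁ ≥ ε₁`, and a positive proportion of the users is innocent, some
innocent user is accused with probability above `ε₁` (`Secure.mul_le`, `mul_exp_le_one`).
-/

namespace SymTardos

/-! ### Finite product expectations -/

/-- The expectation of `F` when the coordinates of `x : ι → R` are independent and `x i` has weight
function `w i`. No normalization of the weights is built in. -/
noncomputable def pexp {ι R : Type*} [Fintype ι] [DecidableEq ι] [Fintype R] (w : ι → R → ℝ)
    (F : (ι → R) → ℝ) : ℝ :=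
  ∑ x, (∏ i, w i (x i)) * F x

section pexp

variable {ι R : Type*} [Fintype ι] [DecidableEq ι] [Fintype R] {w : ι → R → ℝ}

theorem pexp_prod (w h : ι → R → ℝ) :
    pexp w (fun x => ∏ i, h i (x i)) = ∏ i, ∑ b, w i b * h i b := by
  rw [pexp, Fintype.prod_sum]
  simp_rw [← Finset.prod_mul_distrib]

theorem pexp_const (hw : ∀ i, ∑ b, w i b = 1) (a : ℝ) : pexp w (fun _ => a) = a := by
  have := pexp_prod w (fun _ _ => 1)
  simp only [Finset.prod_const_one, mul_one, hw] at this
  rw [pexp, ← Finset.sum_mul]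
  simp only [pexp, mul_one] at this
  rw [this, one_mul]

theorem pexp_add (F G : (ι → R) → ℝ) : pexp w (fun x => F x + G x) = pexp w F + pexp w G := by
  simp [pexp, mul_add, Finset.sum_add_distrib]

theorem pexp_sub (F G : (ι → R) → ℝ) : pexp w (fun x => F x - G x) = pexp w F - pexp w G := by
  simp [pexp, mul_sub, Finset.sum_sub_distrib]

theorem pexp_mul_left (a : ℝ) (F : (ι → R) → ℝ) :
    pexp w (fun x => a * F x) = a * pexp w F := by
  simp only [pexp, Finset.mul_sum]
  exact Finset.sum_congr rfl fun x _ => by ring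

theorem pexp_sum {κ : Type*} (s : Finset κ) (F : κ → (ι → R) → ℝ) :
    pexp w (fun x => ∑ k ∈ s, F k x) = ∑ k ∈ s, pexp w (F k) := by
  simp only [pexp, Finset.mul_sum]
  exact Finset.sum_comm

theorem pexp_mono (hw : ∀ i b, 0 ≤ w i b) {F G : (ι → R) → ℝ} (h : ∀ x, F x ≤ G x) :
    pexp w F ≤ pexp w G :=
  Finset.sum_le_sum fun x _ =>
    mul_le_mul_of_nonneg_left (h x) (Finset.prod_nonneg fun i _ => hw i _)

theorem pexp_nonneg (hw : ∀ i b, 0 ≤ w i b) {F : (ι → R) → ℝ} (h : ∀ x, 0 ≤ F x) :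
    0 ≤ pexp w F :=
  Finset.sum_nonneg fun x _ => mul_nonneg (Finset.prod_nonneg fun i _ => hw i _) (h x)

/-- Changing the weights amounts to multiplying the integrand by the likelihood ratio. -/
theorem pexp_weight_mul (w h : ι → R → ℝ) (F : (ι → R) → ℝ) :
    pexp (fun i b => w i b * h i b) F = pexp w (fun x => (∏ i, h i (x i)) * F x) := by
  simp only [pexp, Finset.prod_mul_distrib, mul_assoc]

/-- Independence of the coordinates in `P` from those outside `P`. -/
theorem pexp_split (w : ι → R → ℝ) (P : ι → Prop) [DecidablePred P]
    (F : ({i // P i} → R) → ℝ) (G : ({i // ¬ P i} → R) → ℝ) :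
    pexp w (fun x => F (fun i => x i) * G (fun i => x i)) =
      pexp (fun i : {i // P i} => w i) F * pexp (fun i : {i // ¬ P i} => w i) G := by
  simp only [pexp]
  rw [Finset.sum_mul_sum, ← Fintype.sum_prod_type']
  refine Fintype.sum_equiv (Equiv.piEquivPiSubtypeProd P fun _ => R) _ _ fun x => ?_
  rw [← Fintype.prod_subtype_mul_prod_subtype P]
  simp only [Equiv.piEquivPiSubtypeProd]
  simp only [Equiv.coe_fn_mk]
  ring

theorem pexp_restrict (hw : ∀ i, ∑ b, w i b = 1) (P : ι → Prop) [DecidablePred P]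
    (G : ({i // ¬ P i} → R) → ℝ) :
    pexp w (fun x => G fun i => x i) = pexp (fun i : {i // ¬ P i} => w i) G := by
  have h := pexp_split w P (fun _ => 1) G
  rw [pexp_const fun i : {i // P i} => hw i] at h
  simpa only [one_mul] using h

theorem pexp_single (hw : ∀ i, ∑ b, w i b = 1) (j : ι) (h : R → ℝ) :
    pexp w (fun x => h (x j)) = ∑ b, w j b * h b := by
  classical
  have := pexp_prod w (fun i b => if i = j then h b else 1)
  rw [Finset.prod_eq_single j] at this
  · simpa using this
  · intro i _ hi
    simp [hi, hw]
  · simp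

theorem pexp_pair (hw : ∀ i, ∑ b, w i b = 1) {j k : ι} (hjk : j ≠ k) (h g : R → ℝ) :
    pexp w (fun x => h (x j) * g (x k)) = (∑ b, w j b * h b) * ∑ b, w k b * g b := by
  classical
  have := pexp_prod w (fun i b => (if i = j then h b else 1) * if i = k then g b else 1)
  rw [Finset.prod_eq_mul j k hjk] at this
  · simp only [Finset.prod_mul_distrib, Finset.prod_ite_eq', Finset.mem_univ, if_true, hjk,
      hjk.symm, if_false, mul_one, one_mul] at this
    simpa using this
  · intro i _ hi
    simp [hi, hw]
  · simp
  · simp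

/-- The variance of a sum of independent centred terms is the sum of the variances. -/
theorem pexp_sq_sum (hw : ∀ i, ∑ b, w i b = 1) (h : ι → R → ℝ) (hh : ∀ i, ∑ b, w i b * h i b = 0)
    (s : Finset ι) :
    pexp w (fun x => (∑ i ∈ s, h i (x i)) ^ 2) = ∑ i ∈ s, ∑ b, w i b * h i b ^ 2 := by
  have : ∀ x : ι → R, (∑ i ∈ s, h i (x i)) ^ 2 = ∑ i ∈ s, ∑ j ∈ s, h i (x i) * h j (x j) := by
    intro x; rw [sq, Finset.sum_mul_sum]
  simp_rw [this, pexp_sum]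
  refine Finset.sum_congr rfl fun i hi => ?_
  rw [Finset.sum_eq_single i]
  · have := pexp_single hw i (fun b => h i b ^ 2)
    simpa [sq] using this
  · intro j _ hj
    rw [pexp_pair hw (Ne.symm hj), hh, zero_mul]
  · exact fun h => (h hi).elim

/-- Markov's inequality. -/
theorem pexp_markov (hw : ∀ i b, 0 ≤ w i b) {F : (ι → R) → ℝ} (hF : ∀ x, 0 ≤ F x) {V s : ℝ}
    (hV : 0 < V) (h : pexp w F ≤ s * V) (P : (ι → R) → Prop) [DecidablePred P]
    (hP : ∀ x, P x → V ≤ F x) : pexp w (fun x => if P x then 1 else 0) ≤ s := by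
  have h1 : pexp w (fun x => V * if P x then 1 else 0) ≤ pexp w F := by
    refine pexp_mono hw fun x => ?_
    split_ifs with hx
    · simpa using hP x hx
    · simpa using hF x
  rw [pexp_mul_left] at h1
  nlinarith

theorem exp_le_one_add_add_sq {u : ℝ} (hu : |u| ≤ 1) : Real.exp u ≤ 1 + u + u ^ 2 := by
  have := Real.abs_exp_sub_one_sub_id_le hu
  have := (abs_le.1 this).2
  linarith

/-- Chernoff's bound for the sum over `s` of independent terms bounded by `B`. -/
theorem pexp_chernoff (hw0 : ∀ i b, 0 ≤ w i b) (hw : ∀ i, ∑ b, w i b = 1) (h : ι → R → ℝ)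
    (s : Finset ι) {B lam x M : ℝ} (hlam : 0 < lam) (hlB : lam * B ≤ 1)
    (hh : ∀ i ∈ s, ∀ b, |h i b| ≤ B)
    (hM : ∑ i ∈ s, ∑ b, w i b * h i b + s.card * lam * B ^ 2 + x / lam ≤ M)
    (P : (ι → R) → Prop) [DecidablePred P] (hP : ∀ y, P y → M ≤ ∑ i ∈ s, h i (y i)) :
    pexp w (fun y => if P y then 1 else 0) ≤ Real.exp (-x) := by
  have h1 : pexp w (fun y => if P y then 1 else 0) ≤
      pexp w (fun y => Real.exp (-lam * M) *
        ∏ i, if i ∈ s then Real.exp (lam * h i (y i)) else 1) := by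
    refine pexp_mono hw0 fun y => ?_
    rw [Finset.prod_ite_mem, Finset.univ_inter, ← Real.exp_sum, ← Real.exp_add, ← Finset.mul_sum]
    split_ifs with hy
    · rw [Real.one_le_exp_iff]
      nlinarith [hP y hy]
    · positivity
  have h2 : ∏ i, ∑ b, w i b * (if i ∈ s then Real.exp (lam * h i b) else 1) ≤
      Real.exp (∑ i ∈ s, (lam * ∑ b, w i b * h i b + lam ^ 2 * B ^ 2)) := by
    rw [Real.exp_sum, ← Finset.univ_inter s, ← Finset.prod_ite_mem, Finset.univ_inter]
    refine Finset.prod_le_prod (fun i _ => Finset.sum_nonneg fun b _ => mul_nonneg (hw0 i b) ?_)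
      fun i _ => ?_
    · split_ifs <;> positivity
    · split_ifs with hi
      · have h3 : ∀ b, Real.exp (lam * h i b) ≤ 1 + lam * h i b + lam ^ 2 * B ^ 2 := by
          intro b
          have hb := hh i hi b
          have : |lam * h i b| ≤ 1 := by
            rw [abs_mul, abs_of_pos hlam]
            exact (mul_le_mul_of_nonneg_left hb hlam.le).trans hlB
          have h4 := exp_le_one_add_add_sq this
          have h5 : h i b ^ 2 ≤ B ^ 2 := by
            rw [← sq_abs]; exact pow_le_pow_left₀ (abs_nonneg _) hb 2
          nlinarith [mul_le_mul_of_nonneg_left h5 (sq_nonneg lam)]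
        have h6 : ∑ b, w i b * Real.exp (lam * h i b) ≤
            ∑ b, w i b * (1 + lam * h i b + lam ^ 2 * B ^ 2) :=
          Finset.sum_le_sum fun b _ => mul_le_mul_of_nonneg_left (h3 b) (hw0 i b)
        have h7 : ∑ b, w i b * (1 + lam * h i b + lam ^ 2 * B ^ 2) =
            1 + (lam * ∑ b, w i b * h i b + lam ^ 2 * B ^ 2) := by
          have : ∀ b, w i b * (1 + lam * h i b + lam ^ 2 * B ^ 2) =
              w i b + lam * (w i b * h i b) + w i b * (lam ^ 2 * B ^ 2) := fun b => by ring
          simp_rw [this, Finset.sum_add_distrib, ← Finset.mul_sum, ← Finset.sum_mul, hw]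
          ring
        rw [h7] at h6
        refine h6.trans ?_
        have := Real.add_one_le_exp (lam * ∑ b, w i b * h i b + lam ^ 2 * B ^ 2)
        linarith
      · simp [hw]
  rw [pexp_mul_left,
    pexp_prod w (fun i b => if i ∈ s then Real.exp (lam * h i b) else 1)] at h1
  refine h1.trans ((mul_le_mul_of_nonneg_left h2 (Real.exp_nonneg _)).trans ?_)
  rw [← Real.exp_add, Real.exp_le_exp, Finset.sum_add_distrib, ← Finset.mul_sum]
  simp only [Finset.sum_const, nsmul_eq_mul]
  have := mul_le_mul_of_nonneg_left hM hlam.le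
  have h8 : lam * (x / lam) = x := by field_simp
  nlinarith

/-- Change of measure. If the tilt by `h` gives the event `P` probability at least `a`, and the
`(1 + κ)`-th moments of the tilt are at most `exp (κ v i)`, then `P` is not much rarer than
`exp (-∑ v i)` under the original weights. -/
theorem pexp_tilt (hw0 : ∀ i b, 0 ≤ w i b) (h : ι → R → ℝ) (hh : ∀ i b, 0 ≤ h i b) {κ a : ℝ}
    (hκ : 0 < κ) (ha : 0 < a) (v : ι → ℝ)
    (hv : ∀ i, ∑ b, w i b * h i b ^ (1 + κ) ≤ Real.exp (κ * v i))
    (P : (ι → R) → Prop) [DecidablePred P]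
    (hP : a ≤ pexp (fun i b => w i b * h i b) (fun x => if P x then 1 else 0)) :
    (a / 2) ^ (1 + 1 / κ) * Real.exp (-∑ i, v i) ≤ pexp w (fun x => if P x then 1 else 0) := by
  -- the likelihood ratio is truncated at `T`; the moment bound controls what is cut off
  set T : ℝ := (2 / a) ^ (1 / κ) * Real.exp (∑ i, v i) with hT
  have hT0 : 0 < T := by positivity
  have hTκ : T ^ κ = 2 / a * Real.exp (κ * ∑ i, v i) := by
    rw [hT, Real.mul_rpow (by positivity) (by positivity), ← Real.rpow_mul (by positivity),
      one_div_mul_cancel hκ.ne', Real.rpow_one, ← Real.exp_mul, mul_comm κ]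
  rw [pexp_weight_mul] at hP
  have h1 : pexp w (fun x => (∏ i, h i (x i)) * if P x then 1 else 0) ≤
      pexp w (fun x => T * (if P x then 1 else 0) + (T ^ κ)⁻¹ * ∏ i, h i (x i) ^ (1 + κ)) := by
    refine pexp_mono hw0 fun x => ?_
    have hp : 0 ≤ ∏ i, h i (x i) := Finset.prod_nonneg fun i _ => hh i _
    rw [Real.finsetProd_rpow _ _ (fun i _ => hh i _)]
    set W := ∏ i, h i (x i)
    have hp2 : 0 ≤ (T ^ κ)⁻¹ * W ^ (1 + κ) := by positivity
    split_ifs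
    · rcases le_total W T with hWT | hWT
      · linarith
      · have h2 : W ≤ (T ^ κ)⁻¹ * W ^ (1 + κ) := by
          have hW : 0 < W := hT0.trans_le hWT
          rw [Real.rpow_add hW, Real.rpow_one, inv_mul_eq_div, le_div_iff₀ (by positivity)]
          exact mul_le_mul_of_nonneg_left (Real.rpow_le_rpow hT0.le hWT hκ.le) hp
        linarith
    · linarith
  rw [pexp_add, pexp_mul_left, pexp_mul_left, pexp_prod w (fun i b => h i b ^ (1 + κ))] at h1
  have h3 : ∏ i, ∑ b, w i b * h i b ^ (1 + κ) ≤ Real.exp (κ * ∑ i, v i) := by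
    rw [Finset.mul_sum, Real.exp_sum]
    exact Finset.prod_le_prod (fun i _ => Finset.sum_nonneg fun b _ =>
      mul_nonneg (hw0 i b) (Real.rpow_nonneg (hh i b) _)) fun i _ => hv i
  have h4 : (T ^ κ)⁻¹ * ∏ i, ∑ b, w i b * h i b ^ (1 + κ) ≤ a / 2 := by
    rw [hTκ, inv_mul_le_iff₀ (by positivity)]
    refine h3.trans (le_of_eq ?_)
    field_simp
  have h5 : a / 2 ≤ T * pexp w (fun x => if P x then 1 else 0) := by linarith
  have h6 : a / 2 / T ≤ pexp w (fun x => if P x then 1 else 0) := by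
    rw [div_le_iff₀ hT0]; linarith
  refine le_trans (le_of_eq ?_) h6
  rw [hT, Real.exp_neg, Real.rpow_add (by positivity), Real.rpow_one,
    show (2 / a) = (a / 2)⁻¹ by field_simp, Real.inv_rpow (by positivity)]
  field_simp

end pexp

/-! ### The experiment with the biases held fixed -/

/-- The real number whose image in `ℝ≥0∞` is `bitProb`. -/
noncomputable def bern (p : ℝ) (b : Bool) : ℝ := if b then p else 1 - p

theorem bern_nonneg {p : ℝ} (h0 : 0 ≤ p) (h1 : p ≤ 1) (b : Bool) : 0 ≤ bern p b := by
  cases b <;> simp [bern, h0, h1]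

theorem bern_nonneg' (p : unitInterval) (b : Bool) : 0 ≤ bern p b :=
  bern_nonneg p.2.1 p.2.2 b

theorem bern_sum (p : ℝ) : ∑ b, bern p b = 1 := by
  simp [bern]

theorem bitProb_eq (p : unitInterval) (b : Bool) : bitProb p b = ENNReal.ofReal (bern p b) := by
  cases b <;> simp [bern, bitProb]

/-- The probability of the row `x` given the biases. -/
noncomputable def rowProb {l : ℕ} (p : Fin l → unitInterval) (x : Fin l → Bool) : ℝ :=
  ∏ i, bern (p i) (x i)

section

variable {n l : ℕ} {C : Finset (Fin n)} (p : Fin l → unitInterval) (ρ : Strategy C l)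

theorem rowProb_nonneg (x : Fin l → Bool) : 0 ≤ rowProb p x :=
  Finset.prod_nonneg fun i _ => bern_nonneg' (p i) _

theorem rowProb_sum : ∑ x, rowProb p x = 1 := by
  have := pexp_const (w := fun i b => bern (p i) b) (fun i => bern_sum _) 1
  simpa [pexp, rowProb] using this

theorem codeProb_eq (X : Fin n → Fin l → Bool) :
    codeProb p X = ENNReal.ofReal (∏ j, rowProb p (X j)) := by
  rw [ENNReal.ofReal_prod_of_nonneg fun j _ => rowProb_nonneg p _]
  refine Finset.prod_congr rfl fun j _ => ?_
  rw [rowProb, ENNReal.ofReal_prod_of_nonneg fun i _ => bern_nonneg' (p i) _]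
  exact Finset.prod_congr rfl fun i _ => bitProb_eq _ _

/-- The expectation of `G x y` given the biases, where `x` are the rows of the coalition and `y` is
the forged word. -/
noncomputable def coalExp (G : (C → Fin l → Bool) → (Fin l → Bool) → ℝ) : ℝ :=
  ∑ y, pexp (fun _ : C => rowProb p) fun x => (ρ x y).toReal * G x y

theorem coalExp_mono {G H : (C → Fin l → Bool) → (Fin l → Bool) → ℝ} (h : ∀ x y, G x y ≤ H x y) :
    coalExp p ρ G ≤ coalExp p ρ H :=
  Finset.sum_le_sum fun y _ => pexp_mono (fun _ => rowProb_nonneg p) fun x =>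
    mul_le_mul_of_nonneg_left (h x y) ENNReal.toReal_nonneg

theorem strategy_sum (x : C → Fin l → Bool) : ∑ y, (ρ x y).toReal = 1 := by
  rw [← ENNReal.toReal_sum fun y _ => (ρ x).apply_ne_top y, ← tsum_fintype (L := .unconditional _),
    (ρ x).tsum_coe, ENNReal.toReal_one]

theorem coalExp_const (a : ℝ) : coalExp p ρ (fun _ _ => a) = a := by
  have := pexp_sum (w := fun _ : C => rowProb p) Finset.univ
    fun (y : Fin l → Bool) (x : C → Fin l → Bool) => (ρ x y).toReal * a
  rw [coalExp, ← this]
  simp_rw [← Finset.sum_mul, strategy_sum, one_mul]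
  exact pexp_const (w := fun _ : C => rowProb p) (fun _ => rowProb_sum p) _

/-- The probability, given the biases and the forged word `y`, that a given innocent user is
accused. -/
noncomputable def rowAcc (Z : ℝ) (y : Fin l → Bool) : ℝ :=
  open Classical in
  pexp (fun i b => bern (p i) b) fun z => if Z < ∑ i, score (z i) (y i) (p i) then 1 else 0

open Classical in
/-- The probability, given the biases, of an event depending on the code and the forged word. -/
noncomputable def condProb (E : (Fin n → Fin l → Bool) → (Fin l → Bool) → Prop) : ℝ :=
  ∑ y, pexp (fun _ : Fin n => rowProb p) fun X =>
    (ρ (fun j => X j) y).toReal * if E X y then 1 else 0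

theorem prob_eq_lintegral (F : MeasureTheory.ProbabilityMeasure unitInterval)
    (E : (Fin l → unitInterval) → (Fin n → Fin l → Bool) → (Fin l → Bool) → Prop) :
    prob F ρ E = ∫⁻ p, ENNReal.ofReal (condProb p ρ (E p))
      ∂(MeasureTheory.Measure.pi fun _ : Fin l => (F : MeasureTheory.Measure unitInterval)) := by
  classical
  refine MeasureTheory.lintegral_congr fun p => ?_
  have h0 : ∀ X : Fin n → Fin l → Bool, 0 ≤ ∏ j, rowProb p (X j) := fun X =>
    Finset.prod_nonneg fun j _ => rowProb_nonneg p _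
  have h1 : ∀ (X : Fin n → Fin l → Bool) (y : Fin l → Bool),
      0 ≤ (ρ (fun j => X j) y).toReal * if E p X y then (1 : ℝ) else 0 := fun X y => by positivity
  rw [condProb, ENNReal.ofReal_sum_of_nonneg fun y _ =>
    pexp_nonneg (fun _ => rowProb_nonneg p) fun X => h1 X y, Finset.sum_comm]
  refine Finset.sum_congr rfl fun y _ => ?_
  rw [pexp, ENNReal.ofReal_sum_of_nonneg fun X _ => mul_nonneg (h0 X) (h1 X y)]
  refine Finset.sum_congr rfl fun X _ => ?_
  rw [ENNReal.ofReal_mul (h0 X), ENNReal.ofReal_mul ENNReal.toReal_nonneg,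
    ENNReal.ofReal_toReal ((ρ _).apply_ne_top y), codeProb_eq, mul_assoc]
  split_ifs <;> simp

/-- Given the biases and the forged word, the innocent users are accused independently of each
other and of the coalition. -/
theorem condProb_innocent (Z : ℝ) :
    condProb p ρ (fun X y => ∃ j, j ∉ C ∧ Accused Z p X y j) =
      coalExp p ρ fun _ y => 1 - (1 - rowAcc p Z y) ^ (n - C.card) := by
  classical
  refine Finset.sum_congr rfl fun y _ => ?_
  have h1 : ∀ X : Fin n → Fin l → Bool,
      (ρ (fun j => X j) y).toReal * (if ∃ j, j ∉ C ∧ Accused Z p X y j then (1 : ℝ) else 0) =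
      (ρ (fun j => X j) y).toReal * 1 - (ρ (fun j => X j) y).toReal *
        ∏ j : {j // j ∉ C}, (1 - if Z < ∑ i, score (X j i) (y i) (p i) then 1 else 0) := by
    intro X
    rw [← mul_sub]
    congr 1
    split_ifs with h
    · obtain ⟨j, hj, hacc⟩ := h
      have : (Z < ∑ i, score (X j i) (y i) (p i)) := hacc
      rw [Finset.prod_eq_zero (Finset.mem_univ (⟨j, hj⟩ : {j // j ∉ C})) (by simp [this])]
      simp
    · rw [Finset.prod_eq_one, sub_self]
      rintro ⟨j, hj⟩ -
      have : ¬ (Z < ∑ i, score (X j i) (y i) (p i)) := fun hacc => h ⟨j, hj, hacc⟩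
      simp [this]
  have h1' := funext h1
  have h2 := pexp_split (fun _ : Fin n => rowProb p) (· ∈ C) (fun x => (ρ x y).toReal) (fun _ => 1)
  have h3 := pexp_split (fun _ : Fin n => rowProb p) (· ∈ C) (fun x => (ρ x y).toReal)
    (fun x => ∏ j, (1 - if Z < ∑ i, score (x j i) (y i) (p i) then 1 else 0))
  refine (congrArg (pexp fun _ : Fin n => rowProb p) ((funext fun X => ?_).trans h1')).trans ?_
  · congr!
  rw [pexp_sub, h2, h3, pexp_const fun _ => rowProb_sum p, ← mul_sub]
  have h5 := pexp_prod (fun _ : {j // j ∉ C} => rowProb p)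
    (fun _ x => 1 - if Z < ∑ i, score (x i) (y i) (p i) then (1 : ℝ) else 0)
  rw [h5]
  have h4 : ∑ x, rowProb p x * (1 - if Z < ∑ i, score (x i) (y i) (p i) then (1 : ℝ) else 0) =
      1 - rowAcc p Z y := by
    simp only [mul_sub, mul_one, Finset.sum_sub_distrib, rowProb_sum]
    rfl
  have h6 : Fintype.card {j // j ∉ C} = n - C.card := by
    rw [Fintype.card_of_subtype Cᶜ fun j => Finset.mem_compl, Finset.card_compl, Fintype.card_fin]
  rw [h4, Finset.prod_const, Finset.card_univ, h6, mul_comm]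
  have h7 := pexp_mul_left (w := fun _ : C => rowProb p) (1 - (1 - rowAcc p Z y) ^ (n - C.card))
    (fun x => (ρ x y).toReal)
  simp only [mul_comm _ (ENNReal.toReal _)] at h7
  rw [h7]
  congr!

open Classical in
/-- Whether a pirate is accused depends on the rows of the coalition only. -/
theorem condProb_pirates (Z : ℝ) :
    condProb p ρ (fun X y => ∀ j ∈ C, ¬ Accused Z p X y j) =
      coalExp p ρ fun x y =>
        if ∀ j : C, ¬ Z < ∑ i, score (x j i) (y i) (p i) then 1 else 0 := by
  refine Finset.sum_congr rfl fun y _ => ?_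
  have h3 := pexp_split (fun _ : Fin n => rowProb p) (· ∈ C)
    (fun x => (ρ x y).toReal *
      if ∀ j : C, ¬ Z < ∑ i, score (x j i) (y i) (p i) then 1 else 0) (fun _ => 1)
  rw [pexp_const fun _ => rowProb_sum p] at h3
  simp only [mul_one] at h3
  refine Eq.trans (congrArg (pexp fun _ : Fin n => rowProb p) (funext fun X => ?_))
    (h3.trans ?_)
  · congr 1
    simp [Accused]
  · congr!

end

/-! ### Elementary properties of the score -/

theorem score_false_right (x : Bool) (p : ℝ) : score x false p = -score x true p := by
  cases x <;> simp [score]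

/-- At the end points the score vanishes, because of the convention for division by zero. -/
theorem score_eq_zero {p : ℝ} (hp : p * (1 - p) = 0) (x y : Bool) : score x y p = 0 := by
  rcases mul_eq_zero.1 hp with h | h
  · subst h; cases x <;> cases y <;> simp [score]
  · have : p = 1 := by linarith
    subst this; cases x <;> cases y <;> simp [score]

theorem bern_mul_score_true {p : ℝ} (h0 : 0 ≤ p) :
    bern p true * score true true p = √(p * (1 - p)) := by
  rcases h0.eq_or_lt with h | h
  · simp [← h, bern]
  · have h2 : p ^ 2 * ((1 - p) / p) = p * (1 - p) := by field_simp
    rw [← h2, Real.sqrt_mul (sq_nonneg p), Real.sqrt_sq h0]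
    simp [bern, score]

theorem bern_mul_score_false {p : ℝ} (h1 : p ≤ 1) :
    bern p false * score false true p = -√(p * (1 - p)) := by
  rcases h1.eq_or_lt with h | h
  · simp [h, bern]
  · have h3 : 1 - p ≠ 0 := by linarith
    have h2 : (1 - p) ^ 2 * (p / (1 - p)) = p * (1 - p) := by field_simp
    rw [← h2, Real.sqrt_mul (sq_nonneg _), Real.sqrt_sq (by linarith)]
    simp [bern, score]

theorem score_mean (p : unitInterval) (y : Bool) : ∑ b, bern p b * score b y p = 0 := by
  have h1 := bern_mul_score_true p.2.1
  have h2 := bern_mul_score_false p.2.2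
  rw [Fintype.sum_bool]
  cases y
  · rw [score_false_right, score_false_right]; linarith
  · linarith

theorem score_sq (x y : Bool) (p : ℝ) : score x y p ^ 2 = score x true p ^ 2 := by
  cases y
  · rw [score_false_right, neg_sq]
  · rfl

theorem score_second_moment {p : ℝ} (h0 : 0 < p) (h1 : p < 1) (y : Bool) :
    ∑ b, bern p b * score b y p ^ 2 = 1 := by
  have h3 : 0 < 1 - p := by linarith
  simp only [Fintype.sum_bool, score_sq _ y]
  simp only [score, bern, neg_sq]
  rw [Real.sq_sqrt (by positivity), Real.sq_sqrt (by positivity)]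
  simp only [if_true, Bool.false_eq_true, if_false]
  field_simp
  ring

theorem mul_one_sub_pos_iff (p : unitInterval) :
    0 < (p : ℝ) * (1 - p) ↔ 0 < (p : ℝ) ∧ (p : ℝ) < 1 := by
  have h0 := p.2.1
  have h1 := p.2.2
  constructor
  · intro h
    refine ⟨h0.lt_of_ne ?_, h1.lt_of_ne ?_⟩ <;> intro h'
    · rw [← h'] at h; simp at h
    · rw [h'] at h; simp at h
  · rintro ⟨h2, h3⟩
    exact mul_pos h2 (by linarith)

theorem mul_one_sub_nonneg (p : unitInterval) : 0 ≤ (p : ℝ) * (1 - p) :=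
  mul_nonneg p.2.1 (by linarith [p.2.2])

theorem score_second_moment_le (p : unitInterval) (y : Bool) :
    ∑ b, bern p b * score b y p ^ 2 ≤ 1 := by
  rcases (mul_one_sub_nonneg p).eq_or_lt with h | h
  · simp [score_eq_zero h.symm]
  · obtain ⟨h0, h1⟩ := (mul_one_sub_pos_iff p).1 h
    exact (score_second_moment h0 h1 y).le

theorem abs_score_le {B : ℝ} (hB : 0 < B) (p : unitInterval) (hp : (B ^ 2)⁻¹ ≤ (p : ℝ) * (1 - p))
    (x y : Bool) : |score x y p| ≤ B := by
  obtain ⟨h0, h1⟩ := (mul_one_sub_pos_iff p).1 (lt_of_lt_of_le (by positivity) hp)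
  have h3 : 0 < 1 - (p : ℝ) := by linarith
  have h4 : 1 ≤ (p : ℝ) * (1 - p) * B ^ 2 := by
    rwa [inv_le_iff_one_le_mul₀ (by positivity)] at hp
  have h5 : √((1 - p : ℝ) / p) ≤ B := by
    rw [Real.sqrt_le_left hB.le, div_le_iff₀ h0]
    nlinarith [mul_nonneg h0.le (sq_nonneg B), mul_nonneg h3.le (sq_nonneg B)]
  have h6 : √((p : ℝ) / (1 - p)) ≤ B := by
    rw [Real.sqrt_le_left hB.le, div_le_iff₀ h3]
    nlinarith [mul_nonneg h0.le (sq_nonneg B), mul_nonneg h3.le (sq_nonneg B)]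
  cases x <;> cases y <;> simp only [score, abs_neg, abs_of_nonneg (Real.sqrt_nonneg _)] <;>
    assumption

theorem measurable_score (x y : Bool) : Measurable (score x y) := by
  have h1 : Measurable fun p : ℝ => √((1 - p) / p) := by fun_prop
  have h2 : Measurable fun p : ℝ => √(p / (1 - p)) := by fun_prop
  cases x <;> cases y
  exacts [h2, h2.neg, h1.neg, h1]

theorem measurable_bern (b : Bool) : Measurable fun p => bern p b := by
  have h1 : Measurable fun p : ℝ => 1 - p := by fun_prop
  cases b
  exacts [h1, measurable_id]

theorem exp_le_quadratic {u : ℝ} (hu : |u| ≤ 1) :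
    Real.exp u ≤ 1 + u + u ^ 2 / 2 * (1 + |u|) := by
  have h := Real.exp_bound hu (n := 3) (by norm_num)
  have h2 := (abs_le.1 h).2
  simp only [Finset.sum_range_succ, Finset.sum_range_zero, Nat.factorial] at h2
  norm_num at h2
  have h3 : |u| ^ 3 = u ^ 2 * |u| := by rw [pow_succ, sq_abs]
  rw [h3] at h2
  nlinarith [mul_nonneg (sq_nonneg u) (abs_nonneg u)]

/-! ### Soundness: innocent users are rarely accused -/

section

variable {l : ℕ} (p : Fin l → unitInterval)

theorem rowAcc_nonneg (Z : ℝ) (y : Fin l → Bool) : 0 ≤ rowAcc p Z y :=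
  pexp_nonneg (fun i b => bern_nonneg' (p i) b) fun x => by split_ifs <;> norm_num

theorem rowAcc_le_one (Z : ℝ) (y : Fin l → Bool) : rowAcc p Z y ≤ 1 := by
  classical
  have h := pexp_mono (w := fun i b => bern (p i) b) (fun i b => bern_nonneg' (p i) b)
    (F := fun z => if Z < ∑ i, score (z i) (y i) (p i) then 1 else 0) (G := fun _ => 1)
    fun x => by split_ifs <;> norm_num
  rw [pexp_const fun i => bern_sum _] at h
  rw [rowAcc]
  convert h

/-- As long as the biases stay away from `0` and `1`, the score of an innocent user has a tail that
is almost that of a Gaussian of variance `l`. -/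
theorem rowAcc_le {α B Z : ℝ} (hα : 0 < α) (hB : 0 < B) (hαB : α * B ≤ 1)
    (hp : ∀ i, (B ^ 2)⁻¹ ≤ (p i : ℝ) * (1 - p i)) (y : Fin l → Bool) :
    rowAcc p Z y ≤ Real.exp (-(α * Z) + l * (α ^ 2 / 2 * (1 + α * B))) := by
  classical
  have h1 : rowAcc p Z y ≤ pexp (fun i b => bern (p i) b) fun z =>
      Real.exp (-(α * Z)) * ∏ i, Real.exp (α * score (z i) (y i) (p i)) := by
    refine pexp_mono (fun i b => bern_nonneg' (p i) b) fun z => ?_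
    rw [← Real.exp_sum, ← Real.exp_add, ← Finset.mul_sum]
    split_ifs with h
    · rw [Real.one_le_exp_iff]
      nlinarith
    · positivity
  rw [pexp_mul_left, pexp_prod _ (fun i b => Real.exp (α * score b (y i) (p i)))] at h1
  have h2 : ∏ i, ∑ b, bern (p i) b * Real.exp (α * score b (y i) (p i)) ≤
      ∏ _i : Fin l, Real.exp (α ^ 2 / 2 * (1 + α * B)) := by
    refine Finset.prod_le_prod (fun i _ => Finset.sum_nonneg fun b _ =>
      mul_nonneg (bern_nonneg' _ _) (Real.exp_nonneg _)) fun i _ => ?_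
    obtain ⟨h0, h1⟩ := (mul_one_sub_pos_iff (p i)).1 (lt_of_lt_of_le (by positivity) (hp i))
    have h3 : ∀ b, Real.exp (α * score b (y i) (p i)) ≤
        1 + α * score b (y i) (p i) + α ^ 2 / 2 * (1 + α * B) * score b (y i) (p i) ^ 2 := by
      intro b
      have h4 := abs_score_le hB (p i) (hp i) b (y i)
      have h5 : |α * score b (y i) (p i)| ≤ α * B := by
        rw [abs_mul, abs_of_pos hα]
        exact mul_le_mul_of_nonneg_left h4 hα.le
      refine (exp_le_quadratic (h5.trans hαB)).trans ?_
      nlinarith [mul_le_mul_of_nonneg_left h5 (sq_nonneg (α * score b (y i) (p i)))]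
    have h6 : ∑ b, bern (p i) b * Real.exp (α * score b (y i) (p i)) ≤ ∑ b, bern (p i) b *
        (1 + α * score b (y i) (p i) + α ^ 2 / 2 * (1 + α * B) * score b (y i) (p i) ^ 2) :=
      Finset.sum_le_sum fun b _ => mul_le_mul_of_nonneg_left (h3 b) (bern_nonneg' _ _)
    have h7 : ∀ b, bern (p i) b *
        (1 + α * score b (y i) (p i) + α ^ 2 / 2 * (1 + α * B) * score b (y i) (p i) ^ 2) =
        bern (p i) b + α * (bern (p i) b * score b (y i) (p i)) +
        α ^ 2 / 2 * (1 + α * B) * (bern (p i) b * score b (y i) (p i) ^ 2) := fun b => by ring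
    simp_rw [h7, Finset.sum_add_distrib, ← Finset.mul_sum, bern_sum, score_mean,
      score_second_moment h0 h1] at h6
    refine h6.trans ?_
    have := Real.add_one_le_exp (α ^ 2 / 2 * (1 + α * B))
    linarith
  rw [Finset.prod_const, Finset.card_univ, Fintype.card_fin, ← Real.exp_nat_mul] at h2
  rw [Real.exp_add]
  exact h1.trans (mul_le_mul_of_nonneg_left h2 (Real.exp_nonneg _))

theorem condProb_innocent_le {n : ℕ} {C : Finset (Fin n)} (ρ : Strategy C l) {Z b : ℝ}
    (hb : ∀ y, rowAcc p Z y ≤ b) :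
    condProb p ρ (fun X y => ∃ j, j ∉ C ∧ Accused Z p X y j) ≤ n * b := by
  rw [condProb_innocent, ← coalExp_const p ρ (n * b)]
  refine coalExp_mono p ρ fun _ y => ?_
  have h0 := rowAcc_nonneg p Z y
  have h1 := rowAcc_le_one p Z y
  have h2 := one_add_mul_le_pow (a := -rowAcc p Z y) (by linarith) (n - C.card)
  have h3 : ((n - C.card : ℕ) : ℝ) ≤ n := by exact_mod_cast Nat.sub_le _ _
  have h4 : ((n - C.card : ℕ) : ℝ) * rowAcc p Z y ≤ n * b :=
    mul_le_mul h3 (hb y) h0 (Nat.cast_nonneg _)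
  rw [← sub_eq_add_neg] at h2
  linarith

end

/-! ### The truncated arcsine law -/

/-- The bias `sin² φ`. -/
noncomputable def sinSq (φ : ℝ) : unitInterval :=
  ⟨Real.sin φ ^ 2, sq_nonneg _, Real.sin_sq_le_one φ⟩

theorem measurable_sinSq : Measurable sinSq :=
  Measurable.subtype_mk (by fun_prop)

/-- The law of `sin² φ` for `φ` uniform on an interval. -/
noncomputable def arcsineLaw (a b : ℝ) (hab : a < b) :
    MeasureTheory.ProbabilityMeasure unitInterval :=
  ⟨(ProbabilityTheory.cond MeasureTheory.volume (Set.Ioc a b)).map sinSq, by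
    have : MeasureTheory.IsProbabilityMeasure
        (ProbabilityTheory.cond MeasureTheory.volume (Set.Ioc a b)) :=
      ProbabilityTheory.cond_isProbabilityMeasure_of_finite (by simpa using hab) (by simp)
    exact MeasureTheory.Measure.isProbabilityMeasure_map measurable_sinSq.aemeasurable⟩

theorem integral_arcsineLaw {a b : ℝ} (hab : a < b) {f : unitInterval → ℝ} (hf : Measurable f) :
    ∫ p, f p ∂(arcsineLaw a b hab : MeasureTheory.Measure unitInterval) =
      (b - a)⁻¹ * ∫ φ in a..b, f (sinSq φ) := by
  rw [arcsineLaw, MeasureTheory.ProbabilityMeasure.coe_mk,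
    MeasureTheory.integral_map measurable_sinSq.aemeasurable hf.aestronglyMeasurable,
    ProbabilityTheory.cond, MeasureTheory.integral_smul_measure,
    intervalIntegral.integral_of_le hab.le]
  simp [hab.le]

theorem ae_arcsineLaw {a b : ℝ} (hab : a < b) {P : unitInterval → Prop}
    (hP : MeasurableSet {p | P p}) (h : ∀ φ ∈ Set.Ioc a b, P (sinSq φ)) :
    ∀ᵐ p ∂(arcsineLaw a b hab : MeasureTheory.Measure unitInterval), P p := by
  rw [arcsineLaw, MeasureTheory.ProbabilityMeasure.coe_mk,
    MeasureTheory.ae_map_iff measurable_sinSq.aemeasurable hP, ProbabilityTheory.cond]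
  refine MeasureTheory.Measure.ae_smul_measure ?_ _
  exact (MeasureTheory.ae_restrict_iff' measurableSet_Ioc).2 (.of_forall h)

theorem ae_pi_of_ae {l : ℕ} (F : MeasureTheory.ProbabilityMeasure unitInterval)
    {P : unitInterval → Prop} (h : ∀ᵐ p ∂(F : MeasureTheory.Measure unitInterval), P p) :
    ∀ᵐ p ∂(MeasureTheory.Measure.pi fun _ : Fin l => (F : MeasureTheory.Measure unitInterval)),
      ∀ i, P (p i) :=
  Filter.eventually_all.2 fun i =>
    (MeasureTheory.Measure.tendsto_eval_ae_ae (ι := Fin l)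
      (μ := fun _ => (F : MeasureTheory.Measure unitInterval)) (i := i)).eventually h

theorem prob_innocent_le {n l : ℕ} {C : Finset (Fin n)} (ρ : Strategy C l)
    {F : MeasureTheory.ProbabilityMeasure unitInterval} {α B Z : ℝ} (hα : 0 < α) (hB : 0 < B)
    (hαB : α * B ≤ 1)
    (hF : ∀ᵐ p : unitInterval ∂(F : MeasureTheory.Measure unitInterval),
      (B ^ 2)⁻¹ ≤ (p : ℝ) * (1 - p)) :
    prob F ρ (fun p X y => ∃ j, j ∉ C ∧ Accused Z p X y j) ≤
      ENNReal.ofReal (n * Real.exp (-(α * Z) + l * (α ^ 2 / 2 * (1 + α * B)))) := by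
  rw [prob_eq_lintegral]
  refine (MeasureTheory.lintegral_mono_ae (g := fun _ => ENNReal.ofReal
    (n * Real.exp (-(α * Z) + l * (α ^ 2 / 2 * (1 + α * B))))) ?_).trans (by simp)
  have hF' := ae_pi_of_ae (l := l) F (P := fun p => (B ^ 2)⁻¹ ≤ (p : ℝ) * (1 - p)) hF
  filter_upwards [hF'] with p hp
  exact ENNReal.ofReal_le_ofReal (condProb_innocent_le p ρ fun y => rowAcc_le p hα hB hαB hp y)

/-! ### Completeness: the total score of the pirates is large -/

section column

variable {ι : Type*} [Fintype ι]

/-- The contribution of one segment to `E exp (-β S)`, where `S` is the total score of the pirates: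
`v` is the column of symbols they receive, `y` their output, `p` the bias. -/
noncomputable def colFun (β : ℝ) (v : ι → Bool) (y : Bool) (p : ℝ) : ℝ :=
  (∏ j, bern p (v j)) * Real.exp (-β * ∑ j, score (v j) y p)

theorem measurable_colFun (β : ℝ) (v : ι → Bool) (y : Bool) : Measurable (colFun β v y) :=
  (Finset.measurable_prod _ fun j _ => measurable_bern (v j)).mul
    (Real.measurable_exp.comp
      ((Finset.measurable_sum _ fun j _ => measurable_score (v j) y).const_mul (-β)))

theorem colFun_nonneg (β : ℝ) (v : ι → Bool) (y : Bool) (p : unitInterval) :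
    0 ≤ colFun β v y p :=
  mul_nonneg (Finset.prod_nonneg fun _ _ => bern_nonneg' p _) (Real.exp_nonneg _)

theorem bern_le_one (p : unitInterval) (b : Bool) : bern p b ≤ 1 := by
  have h0 := p.2.1
  have h1 := p.2.2
  cases b <;> simp [bern, h0, h1]

theorem integrable_colFun {β B : ℝ} (hβ : 0 ≤ β) (hB : 0 < B) (v : ι → Bool) (y : Bool)
    {F : MeasureTheory.ProbabilityMeasure unitInterval}
    (hF : ∀ᵐ p : unitInterval ∂(F : MeasureTheory.Measure unitInterval),
      (B ^ 2)⁻¹ ≤ (p : ℝ) * (1 - p)) :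
    MeasureTheory.Integrable (fun p : unitInterval => colFun β v y p)
      (F : MeasureTheory.Measure unitInterval) := by
  refine MeasureTheory.Integrable.of_bound
    ((measurable_colFun β v y).comp measurable_subtype_coe).aestronglyMeasurable
    (Real.exp (β * (Fintype.card ι * B))) ?_
  filter_upwards [hF] with p hp
  rw [Real.norm_of_nonneg (colFun_nonneg β v y p), colFun, ← one_mul (Real.exp (β * _))]
  refine mul_le_mul (Finset.prod_le_one (fun _ _ => bern_nonneg' p _) fun _ _ => bern_le_one p _)
    (Real.exp_le_exp.2 ?_) (Real.exp_nonneg _) zero_le_one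
  have h1 : |∑ j, score (v j) y p| ≤ Fintype.card ι * B := by
    refine (Finset.abs_sum_le_sum_abs _ _).trans ?_
    refine (Finset.sum_le_sum fun j _ => abs_score_le hB p hp (v j) y).trans (le_of_eq ?_)
    simp
  have h2 := (abs_le.1 h1).1
  nlinarith

variable [DecidableEq ι]

theorem prod_bern_sum (p : ℝ) : ∑ v : ι → Bool, ∏ j, bern p (v j) = 1 := by
  have := pexp_const (ι := ι) (w := fun _ b => bern p b) (fun _ => bern_sum _) 1
  simpa [pexp] using this

/-- The total score of a column has variance equal to the number of users. -/
theorem prod_bern_score_sq {p : ℝ} (h0 : 0 < p) (h1 : p < 1) :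
    ∑ v : ι → Bool, (∏ j, bern p (v j)) * (∑ j, score (v j) true p) ^ 2 = Fintype.card ι := by
  have h := pexp_sq_sum (ι := ι) (w := fun _ b => bern p b) (fun _ => bern_sum _)
    (fun _ b => score b true p) (fun _ => score_mean ⟨p, h0.le, h1.le⟩ true) Finset.univ
  simp only [score_second_moment h0 h1] at h
  simpa [pexp] using h

/-- The sign with which the forged symbol `y` enters the score. -/
def outSign (y : Bool) : ℝ := if y then 1 else -1

theorem score_eq_outSign_mul (x y : Bool) (p : ℝ) : score x y p = outSign y * score x true p := by
  cases y
  · rw [score_false_right]; simp [outSign]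
  · simp [outSign]

theorem sin_pos_cos_pos {φ : ℝ} (h0 : 0 < φ) (h1 : φ < Real.pi / 2) :
    0 < Real.sin φ ∧ 0 < Real.cos φ :=
  ⟨Real.sin_pos_of_pos_of_lt_pi h0 (by linarith [Real.pi_pos]),
    Real.cos_pos_of_mem_Ioo ⟨by linarith, h1⟩⟩

/-- In the angular variable the score of a symbol is half the logarithmic derivative of the
probability of that symbol. -/
theorem hasDerivAt_bern_sin_sq {φ : ℝ} (h0 : 0 < φ) (h1 : φ < Real.pi / 2) (b : Bool) :
    HasDerivAt (fun φ => bern (Real.sin φ ^ 2) b)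
      (2 * (bern (Real.sin φ ^ 2) b * score b true (Real.sin φ ^ 2))) φ := by
  obtain ⟨hs, hc⟩ := sin_pos_cos_pos h0 h1
  have h2 : √(Real.sin φ ^ 2 * (1 - Real.sin φ ^ 2)) = Real.sin φ * Real.cos φ := by
    rw [← Real.cos_sq', ← mul_pow, Real.sqrt_sq (by positivity)]
  have h3 := (Real.hasDerivAt_sin φ).pow 2
  cases b
  · rw [bern_mul_score_false (Real.sin_sq_le_one φ), h2]
    have := h3.const_sub 1
    refine this.congr_deriv ?_
    push_cast; ring
  · rw [bern_mul_score_true (sq_nonneg _), h2]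
    refine h3.congr_deriv ?_
    push_cast; ring

/-- In the angular variable the total score of a column is half the logarithmic derivative of its
probability. -/
theorem hasDerivAt_prod_bern_sin_sq {φ : ℝ} (h0 : 0 < φ) (h1 : φ < Real.pi / 2) (v : ι → Bool) :
    HasDerivAt (fun φ => ∏ j, bern (Real.sin φ ^ 2) (v j))
      (2 * ((∏ j, bern (Real.sin φ ^ 2) (v j)) * ∑ j, score (v j) true (Real.sin φ ^ 2))) φ := by
  have h := HasDerivAt.fun_finsetProd (u := Finset.univ) fun j _ =>
    hasDerivAt_bern_sin_sq h0 h1 (v j)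
  refine h.congr_deriv ?_
  rw [Finset.mul_sum, Finset.mul_sum]
  refine Finset.sum_congr rfl fun j _ => ?_
  rw [smul_eq_mul, ← Finset.prod_erase_mul _ _ (Finset.mem_univ j)]
  ring

theorem continuousOn_score_sin_sq {a b : ℝ} (ha : 0 < a) (hb : b < Real.pi / 2) (x : Bool) :
    ContinuousOn (fun φ => score x true (Real.sin φ ^ 2)) (Set.Icc a b) := by
  have hs : ∀ φ ∈ Set.Icc a b, Real.sin φ ^ 2 ≠ 0 := fun φ hφ =>
    (pow_pos (sin_pos_cos_pos (ha.trans_le hφ.1) (hφ.2.trans_lt hb)).1 2).ne'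
  have hc : ∀ φ ∈ Set.Icc a b, 1 - Real.sin φ ^ 2 ≠ 0 := fun φ hφ => by
    rw [← Real.cos_sq']
    exact (pow_pos (sin_pos_cos_pos (ha.trans_le hφ.1) (hφ.2.trans_lt hb)).2 2).ne'
  have h1 : ContinuousOn (fun φ => Real.sin φ ^ 2) (Set.Icc a b) := by fun_prop
  cases x
  · exact ((h1.div (continuousOn_const.sub h1) hc).sqrt).neg
  · exact ((continuousOn_const.sub h1).div h1 hs).sqrt

end column

section column

variable {ι : Type*} [Fintype ι]

/-- The probability of the column `v` at the bias `sin² φ`. -/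
noncomputable def colProb (v : ι → Bool) (φ : ℝ) : ℝ := ∏ j, bern (Real.sin φ ^ 2) (v j)

/-- The total score of the column `v` at the bias `sin² φ` when the output is `true`. -/
noncomputable def colScore (v : ι → Bool) (φ : ℝ) : ℝ := ∑ j, score (v j) true (Real.sin φ ^ 2)

theorem colProb_nonneg (v : ι → Bool) (φ : ℝ) : 0 ≤ colProb v φ :=
  Finset.prod_nonneg fun _ _ => bern_nonneg' (sinSq φ) _

theorem continuous_colProb (v : ι → Bool) : Continuous (colProb v) := by
  refine continuous_finsetProd _ fun j _ => ?_
  cases v j <;> simp only [bern, if_true, Bool.false_eq_true, if_false] <;> fun_prop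

theorem continuousOn_colScore {a b : ℝ} (ha : 0 < a) (hb : b < Real.pi / 2) (v : ι → Bool) :
    ContinuousOn (colScore v) (Set.Icc a b) :=
  continuousOn_finsetSum _ fun j _ => continuousOn_score_sin_sq ha hb (v j)

variable [DecidableEq ι]

/-- Under the arcsine law the expected total score of a column is a boundary term. -/
theorem integral_colProb_mul_colScore {a b : ℝ} (ha : 0 < a) (hab : a < b) (hb : b < Real.pi / 2)
    (v : ι → Bool) :
    ∫ φ in a..b, colProb v φ * colScore v φ = (colProb v b - colProb v a) / 2 := by
  have hcont : ContinuousOn (fun φ => 2 * (colProb v φ * colScore v φ)) (Set.Icc a b) :=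
    continuousOn_const.mul ((continuous_colProb v).continuousOn.mul (continuousOn_colScore ha hb v))
  have h := intervalIntegral.integral_eq_sub_of_hasDerivAt (a := a) (b := b)
    (f := colProb v) (f' := fun φ => 2 * (colProb v φ * colScore v φ))
    (fun φ hφ => by
      rw [Set.uIcc_of_le hab.le] at hφ
      exact hasDerivAt_prod_bern_sin_sq (ha.trans_le hφ.1) (hφ.2.trans_lt hb) v)
    (hcont.intervalIntegrable_of_Icc hab.le)
  rw [intervalIntegral.integral_const_mul] at h
  linarith

/-- The largest value that `E colFun` can take at the column `v` under the marking assumption is at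
most this, up to the choice of the truncation points `a`, `b`. The last term is the worst case of
the expected total score. -/
noncomputable def colBound (β a b : ℝ) (v : ι → Bool) : ℝ :=
  (b - a)⁻¹ * (∫ φ in a..b, colProb v φ) +
    β ^ 2 * ((b - a)⁻¹ * ∫ φ in a..b, colProb v φ * colScore v φ ^ 2) -
    β * ((b - a)⁻¹ * ((if v = fun _ => true then colProb v b - colProb v a
      else if v = fun _ => false then colProb v a - colProb v b
      else -(colProb v a + colProb v b)) / 2))

theorem integral_colFun_le {a b β B : ℝ} (ha : 0 < a) (hab : a < b) (hb : b < Real.pi / 2)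
    (hβ : 0 ≤ β) (hB : 0 < B) (hβB : β * (Fintype.card ι * B) ≤ 1)
    (hs : ∀ φ ∈ Set.Icc a b, (B ^ 2)⁻¹ ≤ (sinSq φ : ℝ) * (1 - sinSq φ))
    {v : ι → Bool} {y : Bool} (hy : ∃ j, y = v j) :
    ∫ p : unitInterval, colFun β v y p ∂(arcsineLaw a b hab : MeasureTheory.Measure unitInterval) ≤
      colBound β a b v := by
  have hL : 0 < (b - a)⁻¹ := inv_pos.2 (sub_pos.2 hab)
  have hcP : ContinuousOn (colProb v) (Set.Icc a b) := (continuous_colProb v).continuousOn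
  have hcS := continuousOn_colScore ha hb v
  have hcol : ∀ φ, colFun β v y (sinSq φ) =
      colProb v φ * Real.exp (-β * (outSign y * colScore v φ)) := by
    intro φ
    simp only [colFun, score_eq_outSign_mul _ y, ← Finset.mul_sum]
    rfl
  have hsign : outSign y ^ 2 = 1 := by cases y <;> simp [outSign]
  have i1 : IntervalIntegrable (colProb v) MeasureTheory.volume a b :=
    hcP.intervalIntegrable_of_Icc hab.le
  have i2 : IntervalIntegrable (fun φ => colProb v φ * colScore v φ ^ 2)
      MeasureTheory.volume a b := (hcP.mul (hcS.pow 2)).intervalIntegrable_of_Icc hab.le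
  have i3 : IntervalIntegrable (fun φ => colProb v φ * colScore v φ)
      MeasureTheory.volume a b := (hcP.mul hcS).intervalIntegrable_of_Icc hab.le
  have h1 : ∫ φ in a..b, colFun β v y (sinSq φ) ≤ ∫ φ in a..b, (colProb v φ +
      β ^ 2 * (colProb v φ * colScore v φ ^ 2) -
      β * outSign y * (colProb v φ * colScore v φ)) := by
    refine intervalIntegral.integral_mono_on hab.le ?_
      ((i1.add (i2.const_mul _)).sub (i3.const_mul _)) fun φ hφ => ?_
    · simp_rw [hcol]
      exact (hcP.mul (Real.continuous_exp.comp_continuousOn (continuousOn_const.mul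
        (continuousOn_const.mul hcS)))).intervalIntegrable_of_Icc hab.le
    · rw [hcol]
      have h2 : |colScore v φ| ≤ Fintype.card ι * B := by
        refine (Finset.abs_sum_le_sum_abs _ _).trans ?_
        refine (Finset.sum_le_sum fun j _ =>
          abs_score_le hB (sinSq φ) (hs φ hφ) (v j) true).trans (le_of_eq ?_)
        simp
      have h3 : |-β * (outSign y * colScore v φ)| ≤ 1 := by
        have : |outSign y| = 1 := by cases y <;> simp [outSign]
        rw [abs_mul, abs_mul, this, one_mul, abs_neg, abs_of_nonneg hβ]
        exact (mul_le_mul_of_nonneg_left h2 hβ).trans hβB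
      have h4 := mul_le_mul_of_nonneg_left (exp_le_one_add_add_sq h3) (colProb_nonneg v φ)
      refine h4.trans (le_of_eq ?_)
      have : (-β * (outSign y * colScore v φ)) ^ 2 = β ^ 2 * colScore v φ ^ 2 := by
        rw [mul_pow, mul_pow, hsign]; ring
      rw [this]; ring
  rw [intervalIntegral.integral_sub (i1.add (i2.const_mul _)) (i3.const_mul _),
    intervalIntegral.integral_add i1 (i2.const_mul _), intervalIntegral.integral_const_mul,
    intervalIntegral.integral_const_mul, integral_colProb_mul_colScore ha hab hb] at h1
  rw [integral_arcsineLaw hab (f := fun p : unitInterval => colFun β v y p)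
    ((measurable_colFun β v y).comp measurable_subtype_coe)]
  refine (mul_le_mul_of_nonneg_left h1 hL.le).trans ?_
  have h5 : (if v = fun _ => true then colProb v b - colProb v a
      else if v = fun _ => false then colProb v a - colProb v b
      else -(colProb v a + colProb v b)) ≤ outSign y * (colProb v b - colProb v a) := by
    obtain ⟨j, hj⟩ := hy
    split_ifs with h6 h7
    · subst h6; simp [hj, outSign]
    · subst h7; simp [hj, outSign]
    · have := colProb_nonneg v a
      have := colProb_nonneg v b
      cases y
      · simp [outSign]; linarith
      · simp [outSign]; linarith
  have h6 := mul_le_mul_of_nonneg_left h5 (mul_nonneg hβ hL.le)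
  rw [colBound]
  linarith

/-- The two constant columns contribute `2 / π` to the expected total score; all the other columns
together only contribute a truncation error. -/
theorem sum_colBound_le [Nonempty ι] {φ₀ β : ℝ} (h0 : 0 < φ₀) (h1 : φ₀ < Real.pi / 4) (hβ : 0 ≤ β)
    (h2 : Fintype.card ι * Real.sin φ₀ ^ 2 ≤ 1 / 2) :
    ∑ v : ι → Bool, colBound β φ₀ (Real.pi / 2 - φ₀) v ≤
      1 + β ^ 2 * Fintype.card ι -
        β * (2 / Real.pi * (1 - 2 * (Fintype.card ι * Real.sin φ₀ ^ 2))) := by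
  set b := Real.pi / 2 - φ₀ with hbdef
  have hab : φ₀ < b := by rw [hbdef]; linarith
  have hb : b < Real.pi / 2 := by rw [hbdef]; linarith
  have hL : 0 < b - φ₀ := sub_pos.2 hab
  have hcP : ∀ v : ι → Bool, ContinuousOn (colProb v) (Set.Icc φ₀ b) := fun v =>
    (continuous_colProb v).continuousOn
  have hcS := fun v : ι → Bool => continuousOn_colScore h0 hb v
  have hsum : ∀ φ, ∑ v : ι → Bool, colProb v φ = 1 := fun φ => prod_bern_sum _
  have e1 : ∑ v : ι → Bool, ∫ φ in φ₀..b, colProb v φ = b - φ₀ := by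
    rw [← intervalIntegral.integral_finsetSum fun v _ =>
      (hcP v).intervalIntegrable_of_Icc hab.le]
    simp_rw [hsum]
    simp
  have e2 : ∑ v : ι → Bool, ∫ φ in φ₀..b, colProb v φ * colScore v φ ^ 2 =
      (b - φ₀) * Fintype.card ι := by
    rw [← intervalIntegral.integral_finsetSum
      (f := fun (v : ι → Bool) φ => colProb v φ * colScore v φ ^ 2) fun v _ =>
      ((hcP v).mul ((hcS v).pow 2)).intervalIntegrable_of_Icc hab.le]
    have : ∫ φ in φ₀..b, ∑ v : ι → Bool, colProb v φ * colScore v φ ^ 2 =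
        ∫ _φ in φ₀..b, (Fintype.card ι : ℝ) := by
      refine intervalIntegral.integral_congr fun φ hφ => ?_
      rw [Set.uIcc_of_le hab.le] at hφ
      obtain ⟨hs, hc⟩ := sin_pos_cos_pos (h0.trans_le hφ.1) (hφ.2.trans_lt hb)
      refine prod_bern_score_sq (by positivity) ?_
      nlinarith [Real.sin_sq_add_cos_sq φ]
    rw [this]
    simp
  have e3 : 2 - 4 * (Fintype.card ι * Real.sin φ₀ ^ 2) ≤ ∑ v : ι → Bool,
      (if v = fun _ => true then colProb v b - colProb v φ₀
      else if v = fun _ => false then colProb v φ₀ - colProb v b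
      else -(colProb v φ₀ + colProb v b)) := by
    have hne : (fun _ : ι => false) ≠ fun _ => true := fun h => by
      simpa using congrFun h (Classical.arbitrary ι)
    have hterm : ∀ v : ι → Bool, (if v = fun _ => true then colProb v b - colProb v φ₀
        else if v = fun _ => false then colProb v φ₀ - colProb v b
        else -(colProb v φ₀ + colProb v b)) = -(colProb v φ₀ + colProb v b) +
          (if v = fun _ => true then 2 * colProb v b else 0) +
          (if v = fun _ => false then 2 * colProb v φ₀ else 0) := by
      intro v
      by_cases h3 : v = fun _ => true
      · have : v ≠ fun _ => false := h3 ▸ hne.symm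
        rw [if_pos h3, if_pos h3, if_neg this]; ring
      · by_cases h4 : v = fun _ => false
        · rw [if_neg h3, if_pos h4, if_neg h3, if_pos h4]; ring
        · simp [h3, h4]
    simp_rw [hterm, Finset.sum_add_distrib, Finset.sum_neg_distrib, Finset.sum_add_distrib, hsum]
    simp only [Finset.sum_ite_eq', Finset.mem_univ, if_true]
    have h5 : Real.sin b = Real.cos φ₀ := by rw [hbdef, Real.sin_pi_div_two_sub]
    have h6 : colProb (fun _ : ι => true) b = (1 - Real.sin φ₀ ^ 2) ^ Fintype.card ι := by
      simp [colProb, bern, h5, Real.cos_sq']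
    have h7 : colProb (fun _ : ι => false) φ₀ = (1 - Real.sin φ₀ ^ 2) ^ Fintype.card ι := by
      simp [colProb, bern]
    have h8 := one_add_mul_le_pow (a := -Real.sin φ₀ ^ 2)
      (by linarith [Real.sin_sq_le_one φ₀]) (Fintype.card ι)
    rw [h6, h7]
    rw [← sub_eq_add_neg] at h8
    linarith
  simp only [colBound, Finset.sum_sub_distrib, Finset.sum_add_distrib, ← Finset.mul_sum,
    ← Finset.sum_div, e1, e2]
  have h9 : (b - φ₀)⁻¹ * ((b - φ₀) * (Fintype.card ι : ℝ)) = Fintype.card ι := by field_simp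
  rw [h9, inv_mul_cancel₀ hL.ne']
  have h10 : 2 / Real.pi ≤ (b - φ₀)⁻¹ := by
    rw [← inv_div]
    exact inv_anti₀ hL (by rw [hbdef]; linarith)
  have h11 : 2 / Real.pi * (1 - 2 * (Fintype.card ι * Real.sin φ₀ ^ 2)) ≤
      (b - φ₀)⁻¹ * ((∑ v : ι → Bool,
      (if v = fun _ => true then colProb v b - colProb v φ₀
      else if v = fun _ => false then colProb v φ₀ - colProb v b
      else -(colProb v φ₀ + colProb v b))) / 2) :=
    mul_le_mul h10 (by linarith) (by linarith) (inv_pos.2 hL).le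
  linarith [mul_le_mul_of_nonneg_left h11 hβ]

end column

/-- A sum over matrices of a product over columns factors. -/
theorem sum_prod_columns {ι κ R : Type*} [Fintype ι] [DecidableEq ι] [Fintype κ] [DecidableEq κ]
    [Fintype R] (h : κ → (ι → R) → ℝ) :
    ∑ x : ι → κ → R, ∏ i, h i (fun j => x j i) = ∏ i, ∑ v, h i v := by
  rw [Fintype.prod_sum]
  exact Fintype.sum_equiv (Equiv.piComm fun _ _ => R) _ _ fun x => rfl

/-- If no pirate is accused, the total score of the coalition is at most `|C| Z`. The exponential
moment of the total score is a product over the segments once the columns and the forged word are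
fixed, so that the worst output can be assumed in each column separately. -/
theorem prob_no_pirate_le {n l : ℕ} {C : Finset (Fin n)} (ρ : Strategy C l)
    (hρ : ρ.Marking) {F : MeasureTheory.ProbabilityMeasure unitInterval} {β Z : ℝ} (hβ : 0 ≤ β)
    (hint : ∀ (v : C → Bool) y, MeasureTheory.Integrable (fun p : unitInterval => colFun β v y p)
      (F : MeasureTheory.Measure unitInterval))
    (J : (C → Bool) → ℝ) (hJ : ∀ (v : C → Bool) y, (∃ j, y = v j) →
      ∫ p : unitInterval, colFun β v y p ∂(F : MeasureTheory.Measure unitInterval) ≤ J v) :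
    prob F ρ (fun p X y => ∀ j ∈ C, ¬ Accused Z p X y j) ≤
      ENNReal.ofReal (Real.exp (β * (C.card * Z)) * (∑ v, J v) ^ l) := by
  classical
  set H : (C → Fin l → Bool) → (Fin l → Bool) → (Fin l → unitInterval) → ℝ := fun x y p =>
    (ρ x y).toReal * Real.exp (β * (C.card * Z)) *
      ∏ i, colFun β (fun j => x j i) (y i) (p i) with hH
  have hint' : ∀ x y, MeasureTheory.Integrable (H x y)
      (MeasureTheory.Measure.pi fun _ : Fin l => (F : MeasureTheory.Measure unitInterval)) :=
    fun x y => (MeasureTheory.Integrable.fintype_prod (f := fun i (p : unitInterval) =>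
      colFun β (fun j => x j i) (y i) p) fun i => hint _ _).const_mul _
  have hH0 : ∀ x y p, 0 ≤ H x y p := fun x y p =>
    mul_nonneg (by positivity) (Finset.prod_nonneg fun i _ => colFun_nonneg _ _ _ _)
  -- Markov's inequality for `exp (-β S)`, with the biases fixed
  have h1 : ∀ p : Fin l → unitInterval,
      condProb p ρ (fun X y => ∀ j ∈ C, ¬ Accused Z p X y j) ≤ ∑ y, ∑ x, H x y p := by
    intro p
    rw [condProb_pirates, coalExp]
    refine Finset.sum_le_sum fun y _ => Finset.sum_le_sum fun x _ => ?_
    have h2 : ∏ i, colFun β (fun j => x j i) (y i) (p i) =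
        (∏ j, rowProb p (x j)) * Real.exp (-β * ∑ j, ∑ i, score (x j i) (y i) (p i)) := by
      simp only [colFun, Finset.prod_mul_distrib, rowProb]
      rw [Finset.prod_comm, ← Real.exp_sum, ← Finset.mul_sum,
        Finset.sum_comm (s := (Finset.univ : Finset C))]
    have h3 : (if ∀ j : C, ¬ Z < ∑ i, score (x j i) (y i) (p i) then (1 : ℝ) else 0) ≤
        Real.exp (β * (C.card * Z)) *
          Real.exp (-β * ∑ j : C, ∑ i, score (x j i) (y i) (p i)) := by
      rw [← Real.exp_add]
      split_ifs with h
      · rw [Real.one_le_exp_iff]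
        have : ∑ j : C, ∑ i, score (x j i) (y i) (p i) ≤ C.card * Z := by
          refine (Finset.sum_le_sum fun j _ => not_lt.1 (h j)).trans (le_of_eq ?_)
          simp
        nlinarith
      · positivity
    have h4 : 0 ≤ (∏ j, rowProb p (x j)) * (ρ x y).toReal :=
      mul_nonneg (Finset.prod_nonneg fun _ _ => rowProb_nonneg p _) ENNReal.toReal_nonneg
    simp only [hH, h2]
    refine le_trans (le_of_eq ?_) ((mul_le_mul_of_nonneg_left h3 h4).trans (le_of_eq ?_))
    · rw [mul_assoc]
    · ring
  have hsum : ∑ y, ∑ x, ∫ p, H x y p ∂(MeasureTheory.Measure.pi fun _ : Fin l =>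
      (F : MeasureTheory.Measure unitInterval)) ≤
      Real.exp (β * (C.card * Z)) * (∑ v, J v) ^ l := by
    have h5 : ∀ x y, ∫ p, H x y p ∂(MeasureTheory.Measure.pi fun _ : Fin l =>
        (F : MeasureTheory.Measure unitInterval)) ≤ (ρ x y).toReal *
          (Real.exp (β * (C.card * Z)) * ∏ i, J fun j => x j i) := by
      intro x y
      rw [MeasureTheory.integral_const_mul, MeasureTheory.integral_fintype_prod_eq_prod
        fun (i : Fin l) (p : unitInterval) => colFun β (fun j => x j i) (y i) p, mul_assoc]
      by_cases hxy : y ∈ (ρ x).support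
      · refine mul_le_mul_of_nonneg_left (mul_le_mul_of_nonneg_left ?_ (Real.exp_nonneg _))
          ENNReal.toReal_nonneg
        exact Finset.prod_le_prod (fun i _ => MeasureTheory.integral_nonneg fun p =>
          colFun_nonneg _ _ _ _) fun i _ => hJ _ _ (hρ x y hxy i)
      · rw [PMF.mem_support_iff, not_not] at hxy
        simp [hxy]
    refine (Finset.sum_le_sum fun y _ => Finset.sum_le_sum fun x _ => h5 x y).trans (le_of_eq ?_)
    rw [Finset.sum_comm]
    simp_rw [← Finset.sum_mul, strategy_sum, one_mul, ← Finset.mul_sum]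
    rw [sum_prod_columns (fun (_ : Fin l) (v : C → Bool) => J v)]
    simp
  have hint'' : MeasureTheory.Integrable (fun p => ∑ y, ∑ x, H x y p)
      (MeasureTheory.Measure.pi fun _ : Fin l => (F : MeasureTheory.Measure unitInterval)) :=
    MeasureTheory.integrable_finsetSum _ fun y _ =>
      MeasureTheory.integrable_finsetSum _ fun x _ => hint' x y
  rw [prob_eq_lintegral]
  refine (MeasureTheory.lintegral_mono fun p => ENNReal.ofReal_le_ofReal (h1 p)).trans ?_
  rw [← MeasureTheory.ofReal_integral_eq_lintegral_ofReal hint''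
    (.of_forall fun p => Finset.sum_nonneg fun y _ => Finset.sum_nonneg fun x _ => hH0 x y p)]
  refine ENNReal.ofReal_le_ofReal (le_of_eq_of_le ?_ hsum)
  rw [MeasureTheory.integral_finsetSum _ fun y _ =>
    MeasureTheory.integrable_finsetSum _ fun x _ => hint' x y]
  exact Finset.sum_congr rfl fun y _ => MeasureTheory.integral_finsetSum _ fun x _ => hint' x y

/-- The scheme with the truncated arcsine law is secure as soon as these two numerical conditions
hold. The first one is soundness, the second one completeness. -/
theorem secure_arcsineLaw {n c l : ℕ} {φ₀ z ε₁ ε₂ : ℝ} (h0 : 0 < φ₀) (h1 : φ₀ < Real.pi / 4)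
    (hc : 0 < c) (hz : 0 < z) (h2 : (c : ℝ) * Real.sin φ₀ ^ 2 ≤ 1 / 2)
    (hαB : z / c * (Real.sin φ₀ * Real.cos φ₀)⁻¹ ≤ 1)
    (hsound : n * Real.exp (-(l * (z / c) ^ 2 / 2 *
      (1 - z / c * (Real.sin φ₀ * Real.cos φ₀)⁻¹))) ≤ ε₁)
    (hcomp : Real.exp (-(l * (Real.sin φ₀ * Real.cos φ₀ / c) *
      (2 / Real.pi * (1 - 2 * (c * Real.sin φ₀ ^ 2)) - z - Real.sin φ₀ * Real.cos φ₀))) ≤ ε₂) :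
    ∃ F, Secure n c l F (l * (z / c)) ε₁ ε₂ := by
  have hπ := Real.pi_pos
  have hab : φ₀ < Real.pi / 2 - φ₀ := by linarith
  have hb : Real.pi / 2 - φ₀ < Real.pi / 2 := by linarith
  refine ⟨arcsineLaw φ₀ (Real.pi / 2 - φ₀) hab, fun C hC hCc ρ hρ => ?_⟩
  have hc' : (0 : ℝ) < c := Nat.cast_pos.2 hc
  obtain ⟨hs, hco⟩ := sin_pos_cos_pos h0 (hab.trans hb)
  set D := Real.sin φ₀ * Real.cos φ₀ with hD
  have hD0 : 0 < D := mul_pos hs hco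
  have hB : 0 < D⁻¹ := inv_pos.2 hD0
  -- on the support of the law, `p (1 - p) = sin² φ cos² φ` is smallest at the end points
  have hsupp : ∀ φ ∈ Set.Icc φ₀ (Real.pi / 2 - φ₀),
      ((D⁻¹) ^ 2)⁻¹ ≤ (sinSq φ : ℝ) * (1 - sinSq φ) := by
    intro φ hφ
    have h3 : (sinSq φ : ℝ) * (1 - sinSq φ) = (Real.sin φ * Real.cos φ) ^ 2 := by
      rw [show (sinSq φ : ℝ) = Real.sin φ ^ 2 from rfl, ← Real.cos_sq', mul_pow]
    rw [h3, inv_pow, inv_inv]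
    refine pow_le_pow_left₀ hD0.le ?_ 2
    have h4 : Real.sin (2 * φ₀) ≤ Real.sin (2 * φ) := by
      rcases le_total (2 * φ) (Real.pi / 2) with h | h
      · exact Real.sin_le_sin_of_le_of_le_pi_div_two (by linarith) h (by linarith [hφ.1])
      · rw [← Real.sin_pi_sub (2 * φ)]
        exact Real.sin_le_sin_of_le_of_le_pi_div_two (by linarith) (by linarith)
          (by linarith [hφ.2])
    rw [Real.sin_two_mul, Real.sin_two_mul] at h4
    linarith
  have hF := ae_arcsineLaw hab (P := fun p : unitInterval => ((D⁻¹) ^ 2)⁻¹ ≤ (p : ℝ) * (1 - p))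
    (measurableSet_le measurable_const (by fun_prop))
    fun φ hφ => hsupp φ ⟨hφ.1.le, hφ.2⟩
  have hα : 0 < z / c := div_pos hz hc'
  constructor
  · refine (prob_innocent_le ρ hα hB hαB hF).trans (ENNReal.ofReal_le_ofReal ?_)
    refine le_trans (le_of_eq ?_) hsound
    congr 2
    ring
  · have hcard : (C.card : ℝ) ≤ c := Nat.cast_le.2 hCc
    have hcard1 : (1 : ℝ) ≤ C.card := by exact_mod_cast hC.card_pos
    set β := D / c with hβdef
    have hβ : 0 < β := div_pos hD0 hc'
    have hβB : β * (Fintype.card C * D⁻¹) ≤ 1 := by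
      rw [Fintype.card_coe, hβdef]
      have : D / c * (C.card * D⁻¹) = C.card / c := by field_simp
      rw [this]
      exact div_le_one_of_le₀ hcard hc'.le
    have : Nonempty C := hC.coe_sort
    refine (prob_no_pirate_le ρ hρ hβ.le (fun v y => integrable_colFun hβ.le hB v y hF)
      (colBound β φ₀ (Real.pi / 2 - φ₀)) fun v y hy =>
      integral_colFun_le h0 hab hb hβ.le hB hβB hsupp hy).trans (ENNReal.ofReal_le_ofReal ?_)
    refine le_trans ?_ hcomp
    have hsq : 0 ≤ Real.sin φ₀ ^ 2 := sq_nonneg _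
    have h3 := sum_colBound_le (ι := C) h0 h1 hβ.le (by
      rw [Fintype.card_coe]; nlinarith)
    rw [Fintype.card_coe] at h3
    have h4 : ∑ v : C → Bool, colBound β φ₀ (Real.pi / 2 - φ₀) v ≤
        Real.exp (β * (D - 2 / Real.pi * (1 - 2 * (c * Real.sin φ₀ ^ 2)))) := by
      refine h3.trans (le_trans ?_ (Real.add_one_le_exp _))
      have h5 : β * C.card ≤ D := by
        have : D = β * c := by rw [hβdef]; field_simp
        rw [this]
        exact mul_le_mul_of_nonneg_left hcard hβ.le
      have h6 : 2 / Real.pi * (1 - 2 * (c * Real.sin φ₀ ^ 2)) ≤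
          2 / Real.pi * (1 - 2 * (C.card * Real.sin φ₀ ^ 2)) :=
        mul_le_mul_of_nonneg_left (by nlinarith) (by positivity)
      nlinarith [mul_le_mul_of_nonneg_left h5 hβ.le, mul_le_mul_of_nonneg_left h6 hβ.le]
    have h7 : 0 ≤ ∑ v : C → Bool, colBound β φ₀ (Real.pi / 2 - φ₀) v := by
      refine Finset.sum_nonneg fun v _ => ?_
      exact (MeasureTheory.integral_nonneg fun p =>
        colFun_nonneg β v (v (Classical.arbitrary C)) p).trans
        (integral_colFun_le h0 hab hb hβ.le hB hβB hsupp ⟨Classical.arbitrary C, rfl⟩)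
    refine (mul_le_mul_of_nonneg_left (pow_le_pow_left₀ h7 h4 l) (Real.exp_nonneg _)).trans ?_
    rw [← Real.exp_nat_mul, ← Real.exp_add, Real.exp_le_exp]
    have h8 : β * (C.card * (l * (z / c))) ≤ l * β * z := by
      have : C.card / (c : ℝ) ≤ 1 := div_le_one_of_le₀ hcard hc'.le
      calc β * (C.card * (l * (z / c))) = l * β * z * (C.card / c) := by ring
        _ ≤ l * β * z := mul_le_of_le_one_right (by positivity) this
    linarith

/-- The truncated arcsine law with a suitable threshold achieves the asymptotic code length. -/
theorem exists_secureLengths_le {ε₂ b₁ η : ℝ} (hε₂ : 0 < ε₂) (hb₁ : b₁ < 1) (hη : 0 < η) :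
    ∃ K : ℝ, ∀ (c n : ℕ) (ε₁ : ℝ), K ≤ c → c ≤ n → 0 < ε₁ → ε₁ ≤ b₁ →
      ∃ l ∈ secureLengths n c ε₁ ε₂,
        (l : ℝ) ≤ (Real.pi ^ 2 / 2 + η) * (c : ℝ) ^ 2 * Real.log (n / ε₁) := by
  have hπ := Real.pi_pos
  have hπ3 := Real.pi_gt_three
  have hπ4 := Real.pi_le_four
  obtain ⟨ε, hε0, hε4, hε⟩ : ∃ ε : ℝ, 0 < ε ∧ ε < 1 / 8 ∧
      1 < (Real.pi ^ 2 / 2 + η / 2) * ((2 / Real.pi - 2 * ε) ^ 2 / 2 * (1 - ε)) := by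
    have hcont : Filter.Tendsto (fun ε : ℝ => (Real.pi ^ 2 / 2 + η / 2) *
        ((2 / Real.pi - 2 * ε) ^ 2 / 2 * (1 - ε))) (nhdsWithin 0 (Set.Ioi 0))
        (nhds ((Real.pi ^ 2 / 2 + η / 2) * ((2 / Real.pi - 2 * 0) ^ 2 / 2 * (1 - 0)))) :=
      tendsto_nhdsWithin_of_tendsto_nhds (Continuous.tendsto (by fun_prop) 0)
    have h1 : 1 < (Real.pi ^ 2 / 2 + η / 2) * ((2 / Real.pi - 2 * 0) ^ 2 / 2 * (1 - 0)) := by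
      have : (Real.pi ^ 2 / 2 + η / 2) * ((2 / Real.pi - 2 * 0) ^ 2 / 2 * (1 - 0)) =
          1 + η / Real.pi ^ 2 := by field_simp; ring
      rw [this]
      have : 0 < η / Real.pi ^ 2 := by positivity
      linarith
    have h2 := hcont.eventually (lt_mem_nhds h1)
    have h3 : ∀ᶠ ε : ℝ in nhdsWithin 0 (Set.Ioi 0), ε < 1 / 8 :=
      nhdsWithin_le_nhds (Iio_mem_nhds (by norm_num))
    obtain ⟨ε, ⟨ha, hb⟩, hc⟩ := ((h2.and h3).and self_mem_nhdsWithin).exists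
    exact ⟨ε, hc, hb, ha⟩
  have hπsq : 9 ≤ Real.pi ^ 2 := by nlinarith
  have hεsq : ε ^ 2 ≤ ε / 8 := by nlinarith
  have hsqrt : Filter.Tendsto (fun x : ℝ => √x) Filter.atTop Filter.atTop :=
    Real.tendsto_sqrt_atTop
  obtain ⟨K, hK⟩ : ∃ K : ℝ, ∀ x ≥ K, (3 ≤ x ∧ 2 / η ≤ x) ∧ Real.pi / (2 * ε ^ 2) ≤ √x ∧
      Real.log (1 / ε₂) * Real.pi / ε ^ 2 ≤ √x :=
    Filter.eventually_atTop.1 (((Filter.eventually_ge_atTop 3).and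
      (Filter.eventually_ge_atTop _)).and ((hsqrt.eventually_ge_atTop _).and
        (hsqrt.eventually_ge_atTop _)))
  refine ⟨K, fun c n ε₁ hKc hcn hε₁ hε₁b => ?_⟩
  obtain ⟨⟨hc3, hcη⟩, hc1, hc2⟩ := hK c hKc
  set s := √(c : ℝ) with hs
  have hcs : (c : ℝ) = s ^ 2 := (Real.sq_sqrt (by linarith)).symm
  have hs1 : 1 < s := by rw [hs, Real.lt_sqrt (by norm_num)]; linarith
  clear_value s
  have hcn' : (c : ℝ) ≤ n := Nat.cast_le.2 hcn
  set L := Real.log (n / ε₁) with hL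
  have hnε : (c : ℝ) ≤ n / ε₁ := by
    rw [le_div_iff₀ hε₁]
    exact (mul_le_of_le_one_right (by linarith) (by linarith)).trans hcn'
  have hL1 : 1 ≤ L := by
    rw [hL, Real.le_log_iff_exp_le (by linarith)]
    linarith [Real.exp_one_lt_d9]
  set A := (Real.pi ^ 2 / 2 + η) * (c : ℝ) ^ 2 * L with hA
  have hA0 : 0 ≤ A := by positivity
  refine ⟨⌊A⌋₊, ?_, Nat.floor_le hA0⟩
  set l := ⌊A⌋₊ with hl
  have hlA : A - 1 ≤ l := (Nat.sub_one_lt_floor A).le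
  have hl2 : (Real.pi ^ 2 / 2 + η / 2) * (c : ℝ) ^ 2 * L ≤ l := by
    have h1 : 1 ≤ η / 2 * (c : ℝ) ^ 2 * L := by
      have h2 : 1 ≤ η / 2 * c := by
        rw [div_le_iff₀ hη] at hcη; linarith
      have h3 : 1 ≤ c * L := one_le_mul_of_one_le_of_one_le (by linarith) hL1
      calc (1 : ℝ) = 1 * 1 := by norm_num
        _ ≤ (η / 2 * c) * (c * L) := mul_le_mul h2 h3 zero_le_one (by linarith)
        _ = _ := by ring
    rw [hA] at hlA
    linarith
  have hlc : (c : ℝ) ^ 2 ≤ l := by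
    refine le_trans ?_ hl2
    have : 1 * (c : ℝ) ^ 2 * 1 ≤ (Real.pi ^ 2 / 2 + η / 2) * (c : ℝ) ^ 2 * L := by
      gcongr
      linarith
    linarith
  -- the parameters of the scheme
  set φ := ε / s with hφ
  have hφ0 : 0 < φ := div_pos hε0 (by linarith)
  have hφε : φ < ε := div_lt_self hε0 hs1
  set D := Real.sin φ * Real.cos φ with hD
  have hsin : Real.sin φ ≤ φ := Real.sin_le hφ0.le
  have hsin0 : 0 < Real.sin φ := Real.sin_pos_of_pos_of_lt_pi hφ0 (by linarith)
  have hcsin : (c : ℝ) * Real.sin φ ^ 2 ≤ ε ^ 2 := by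
    calc (c : ℝ) * Real.sin φ ^ 2 ≤ c * φ ^ 2 := by gcongr
      _ = ε ^ 2 := by rw [hcs, hφ]; field_simp
  have hDφ : D ≤ φ := by
    exact (mul_le_of_le_one_right hsin0.le (Real.cos_le_one φ)).trans hsin
  have hDlow : 2 / Real.pi * φ ≤ D := by
    have h1 := Real.mul_le_sin (x := 2 * φ) (by linarith) (by linarith)
    rw [Real.sin_two_mul] at h1
    rw [hD]; linarith
  have hD0 : 0 < D := lt_of_lt_of_le (by positivity) hDlow
  set z := 2 / Real.pi - 2 * ε with hz
  have h2π : 1 / 2 ≤ 2 / Real.pi := by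
    rw [div_le_div_iff₀ (by norm_num) hπ]; linarith
  have h2π' : 2 / Real.pi ≤ 1 := by rw [div_le_one hπ]; linarith
  have hz0 : 0 < z := by linarith
  have hzD : z / c * D⁻¹ ≤ ε := by
    have h1 : D⁻¹ ≤ (2 / Real.pi * φ)⁻¹ := inv_anti₀ (by positivity) hDlow
    calc z / c * D⁻¹ ≤ 1 / c * (2 / Real.pi * φ)⁻¹ := by
          gcongr; linarith
      _ = Real.pi / (2 * ε) / s := by rw [hcs, hφ]; field_simp
      _ ≤ ε := by
        rw [div_le_iff₀ (by linarith)]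
        rw [div_le_iff₀ (by positivity)] at hc1 ⊢
        linarith
  suffices h : ∃ F, Secure n c l F (l * (z / c)) ε₁ ε₂ by
    obtain ⟨F, hF⟩ := h
    exact ⟨F, _, hF⟩
  refine secure_arcsineLaw (n := n) (c := c) (l := l) (φ₀ := φ) (z := z) (ε₁ := ε₁)
    (ε₂ := ε₂) hφ0 (by linarith) (by exact_mod_cast (by linarith : (0 : ℝ) < c)) hz0
    (hcsin.trans (by linarith)) (hzD.trans (by linarith)) ?_ ?_
  · have h1 : L ≤ l * (z / c) ^ 2 / 2 * (1 - z / c * D⁻¹) := by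
      have h2 : L ≤ l * (z / c) ^ 2 / 2 * (1 - ε) := by
        have h3 : l * (z / c) ^ 2 / 2 * (1 - ε) = l / (c : ℝ) ^ 2 * (z ^ 2 / 2 * (1 - ε)) := by
          field_simp
        rw [h3]
        have h4 : (Real.pi ^ 2 / 2 + η / 2) * L ≤ l / (c : ℝ) ^ 2 := by
          rw [le_div_iff₀ (by positivity)]; linarith
        have h5 : 0 ≤ z ^ 2 / 2 * (1 - ε) := mul_nonneg (by positivity) (by linarith)
        calc L = 1 * L := (one_mul L).symm
          _ ≤ (Real.pi ^ 2 / 2 + η / 2) * (z ^ 2 / 2 * (1 - ε)) * L := by gcongr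
          _ = (Real.pi ^ 2 / 2 + η / 2) * L * (z ^ 2 / 2 * (1 - ε)) := by ring
          _ ≤ _ := mul_le_mul_of_nonneg_right h4 h5
      refine h2.trans (mul_le_mul_of_nonneg_left (by linarith) (by positivity))
    have h6 : Real.exp (-(l * (z / c) ^ 2 / 2 * (1 - z / c * D⁻¹))) ≤ Real.exp (-L) :=
      Real.exp_le_exp.2 (neg_le_neg h1)
    have hn : (0 : ℝ) < n := by linarith
    rw [Real.exp_neg L, hL, Real.exp_log (by positivity), inv_div] at h6
    calc n * Real.exp (-(l * (z / c) ^ 2 / 2 * (1 - z / c * D⁻¹))) ≤ n * (ε₁ / n) := by gcongr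
      _ = ε₁ := by field_simp
  · have h1 : Real.log (1 / ε₂) ≤ l * (D / c) * (ε / 2) := by
      calc Real.log (1 / ε₂) ≤ s * ε ^ 2 / Real.pi := by
            rw [div_le_iff₀ (by positivity)] at hc2
            rwa [le_div_iff₀ hπ]
        _ = (c : ℝ) ^ 2 * (2 / Real.pi * φ / c) * (ε / 2) := by rw [hcs, hφ]; field_simp
        _ ≤ l * (D / c) * (ε / 2) := by gcongr
    have h2 : ε / 2 ≤ 2 / Real.pi * (1 - 2 * (c * Real.sin φ ^ 2)) - z - D := by
      have h3 : D ≤ ε := hDφ.trans hφε.le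
      have h4 : 2 / Real.pi * (2 * (c * Real.sin φ ^ 2)) ≤ 1 * (2 * ε ^ 2) := by gcongr
      rw [hz]
      linarith
    have h5 : Real.log (1 / ε₂) ≤ l * (D / c) *
        (2 / Real.pi * (1 - 2 * (c * Real.sin φ ^ 2)) - z - D) :=
      h1.trans (mul_le_mul_of_nonneg_left h2 (by positivity))
    rw [← Real.le_log_iff_exp_le hε₂]
    rw [one_div, Real.log_inv] at h5
    linarith

/-! ### The profile of the pirate strategy -/

/-- A smoothed version of `x ↦ (2/π) arcsin √x` with derivative `h`. The function is constant near
the end points of `[0, 1]`, its derivative is Lipschitz, and `2 √(x (1 - x)) h x` exceeds `2/π` by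
as little as desired. -/
structure Profile (σ : ℝ) where
  /-- The profile itself. -/
  f : ℝ → ℝ
  /-- The derivative of the profile. -/
  h : ℝ → ℝ
  /-- A Lipschitz constant for the derivative. -/
  M : ℝ
  /-- The derivative vanishes where `x (1 - x) ≤ a`. -/
  a : ℝ
  M_pos : 0 < M
  a_pos : 0 < a
  f_zero : f 0 = 0
  f_one : f 1 = 1
  hasDerivAt : ∀ x, HasDerivAt f (h x) x
  h_nonneg : ∀ x, 0 ≤ h x
  lipschitz : ∀ x ∈ Set.Icc (0 : ℝ) 1, ∀ y ∈ Set.Icc (0 : ℝ) 1, |h x - h y| ≤ M * |x - y|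
  h_le : ∀ x, 2 * √(x * (1 - x)) * h x ≤ σ
  h_eq_zero : ∀ x, x * (1 - x) ≤ a → h x = 0

/-- The derivative of a profile before normalization: `1 / √(x (1 - x))`, regularized and cut off
near the end points of the unit interval. -/
noncomputable def bump (a x : ℝ) : ℝ :=
  Real.smoothTransition (x * (1 - x) / a - 1) / √(max (x * (1 - x)) 0 + a)

section bump

variable {a : ℝ}

theorem continuous_bump (ha : 0 < a) : Continuous (bump a) := by
  refine Continuous.div (Real.smoothTransition.continuous.comp (by fun_prop)) (by fun_prop)
    fun x => ?_
  have : 0 < max (x * (1 - x)) 0 + a := add_pos_of_nonneg_of_pos (le_max_right _ _) ha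
  positivity

theorem bump_nonneg (a x : ℝ) : 0 ≤ bump a x :=
  div_nonneg (Real.smoothTransition.nonneg _) (Real.sqrt_nonneg _)

theorem bump_eq_zero (ha : 0 < a) {x : ℝ} (hx : x * (1 - x) ≤ a) : bump a x = 0 := by
  rw [bump, Real.smoothTransition.zero_of_nonpos, zero_div]
  rw [sub_nonpos, div_le_one ha]
  exact hx

theorem sqrt_mul_bump_le (ha : 0 < a) (x : ℝ) : √(x * (1 - x)) * bump a x ≤ 1 := by
  have h0 : 0 < max (x * (1 - x)) 0 + a := add_pos_of_nonneg_of_pos (le_max_right _ _) ha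
  rw [bump, mul_div_assoc', div_le_one (by positivity)]
  calc √(x * (1 - x)) * Real.smoothTransition (x * (1 - x) / a - 1) ≤ √(x * (1 - x)) * 1 :=
        mul_le_mul_of_nonneg_left (Real.smoothTransition.le_one _) (Real.sqrt_nonneg _)
    _ ≤ _ := by
        rw [mul_one]
        exact Real.sqrt_le_sqrt (by linarith [le_max_left (x * (1 - x)) 0])

theorem exists_bump_lipschitz (ha : 0 < a) : ∃ M : ℝ, 0 < M ∧
    ∀ x ∈ Set.Icc (0 : ℝ) 1, ∀ y ∈ Set.Icc (0 : ℝ) 1, |bump a x - bump a y| ≤ M * |x - y| := by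
  have h0 : ∀ x ∈ Set.Icc (0 : ℝ) 1, 0 ≤ x * (1 - x) := fun x hx =>
    mul_nonneg hx.1 (by linarith [hx.2])
  have h1 : ContDiffOn ℝ 1 (bump a) (Set.Icc 0 1) := by
    have h2 : ContDiffOn ℝ 1 (fun x => Real.smoothTransition (x * (1 - x) / a - 1) /
        √(x * (1 - x) + a)) (Set.Icc 0 1) := by
      refine ContDiffOn.div (Real.smoothTransition.contDiff.comp (by fun_prop)).contDiffOn
        (ContDiffOn.sqrt (by fun_prop) fun x hx => ?_) fun x hx => ?_
      · have := h0 x hx; positivity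
      · have := h0 x hx; positivity
    refine h2.congr fun x hx => ?_
    rw [bump, max_eq_left (h0 x hx)]
  obtain ⟨M, hM⟩ := h1.exists_lipschitzOnWith one_ne_zero (convex_Icc 0 1) isCompact_Icc
  refine ⟨M + 1, by positivity, fun x hx y hy => ?_⟩
  have h3 := hM.dist_le_mul x hx y hy
  rw [Real.dist_eq, Real.dist_eq] at h3
  refine h3.trans (mul_le_mul_of_nonneg_right (by linarith) (abs_nonneg _))

theorem integral_inv_sqrt {b : ℝ} (ha : 0 < a) (hb0 : 0 ≤ b) (hb : b ≤ 1 / 2) :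
    ∫ x in b..(1 - b), (√(x * (1 - x) + a))⁻¹ = 2 * Real.arcsin ((1 - 2 * b) / √(1 + 4 * a)) := by
  have hq : 0 < √(1 + 4 * a) := by positivity
  have hpos : ∀ x ∈ Set.Icc b (1 - b), 0 < x * (1 - x) + a := fun x hx => by
    have : 0 ≤ x * (1 - x) := mul_nonneg (hb0.trans hx.1) (by linarith [hx.2])
    linarith
  have h := intervalIntegral.integral_eq_sub_of_hasDerivAt (a := b) (b := 1 - b)
    (f := fun x => Real.arcsin ((2 * x - 1) / √(1 + 4 * a)))
    (f' := fun x => (√(x * (1 - x) + a))⁻¹) (fun x hx => ?_) ?_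
  · rw [h, show (2 * (1 - b) - 1) / √(1 + 4 * a) = (1 - 2 * b) / √(1 + 4 * a) by ring_nf,
      show (2 * b - 1) / √(1 + 4 * a) = -((1 - 2 * b) / √(1 + 4 * a)) by ring, Real.arcsin_neg]
    ring
  · rw [Set.uIcc_of_le (by linarith)] at hx
    have hp := hpos x hx
    set u := (2 * x - 1) / √(1 + 4 * a) with hu
    have h1 : 1 - u ^ 2 = 4 * (x * (1 - x) + a) / (1 + 4 * a) := by
      rw [hu, div_pow, Real.sq_sqrt (by linarith)]
      field_simp
      ring
    have h1' : 0 < 1 - u ^ 2 := by rw [h1]; positivity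
    have h2 : √(1 - u ^ 2) = 2 * √(x * (1 - x) + a) / √(1 + 4 * a) := by
      rw [h1, Real.sqrt_div (by positivity), Real.sqrt_mul (by norm_num),
        show (4 : ℝ) = 2 ^ 2 by norm_num, Real.sqrt_sq (by norm_num)]
    have h3 : HasDerivAt (fun x : ℝ => (2 * x - 1) / √(1 + 4 * a)) (2 / √(1 + 4 * a)) x := by
      have := (((hasDerivAt_id x).const_mul 2).sub_const 1).div_const √(1 + 4 * a)
      simpa using this
    have h4 := (Real.hasDerivAt_arcsin (x := u) (by nlinarith) (by nlinarith)).comp x h3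
    refine h4.congr_deriv ?_
    rw [h2]
    have : 0 < √(x * (1 - x) + a) := Real.sqrt_pos.2 hp
    field_simp
  · refine ContinuousOn.intervalIntegrable_of_Icc (by linarith) ?_
    refine ContinuousOn.inv₀ (by fun_prop) fun x hx => (Real.sqrt_pos.2 (hpos x hx)).ne'

theorem arcsin_le_integral_bump (ha : 0 < a) (ha8 : a ≤ 1 / 8) :
    2 * Real.arcsin ((1 - 2 * (4 * a)) / √(1 + 4 * a)) ≤ ∫ x in (0 : ℝ)..1, bump a x := by
  rw [← integral_inv_sqrt ha (b := 4 * a) (by linarith) (by linarith)]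
  have hint : ∀ c d, IntervalIntegrable (bump a) MeasureTheory.volume c d := fun c d =>
    (continuous_bump ha).intervalIntegrable c d
  have h1 : ∫ x in (4 * a)..(1 - 4 * a), (√(x * (1 - x) + a))⁻¹ =
      ∫ x in (4 * a)..(1 - 4 * a), bump a x := by
    refine intervalIntegral.integral_congr fun x hx => ?_
    rw [Set.uIcc_of_le (by linarith)] at hx
    have h2 : 2 * a ≤ x * (1 - x) := by nlinarith [hx.1, hx.2]
    rw [bump, max_eq_left (by linarith), Real.smoothTransition.one_of_one_le, one_div]
    rw [le_sub_iff_add_le, le_div_iff₀ ha]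
    linarith
  rw [h1, ← intervalIntegral.integral_add_adjacent_intervals (hint 0 (4 * a)) (hint _ 1),
    ← intervalIntegral.integral_add_adjacent_intervals (hint (4 * a) (1 - 4 * a)) (hint _ 1)]
  have h3 := intervalIntegral.integral_nonneg_of_forall (μ := MeasureTheory.volume) (a := 0)
    (b := 4 * a) (by linarith) (bump_nonneg a)
  have h4 := intervalIntegral.integral_nonneg_of_forall (μ := MeasureTheory.volume)
    (a := 1 - 4 * a) (b := 1) (by linarith) (bump_nonneg a)
  linarith

end bump

/-- The normalization of `bump a` tends to `π` as `a` tends to `0`, so that every slope beyond `2 / π`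
is attained. -/
theorem exists_profile {σ : ℝ} (hσ : 2 / Real.pi < σ) : Nonempty (Profile σ) := by
  have hπ := Real.pi_pos
  have hσ0 : 0 < σ := lt_trans (by positivity) hσ
  obtain ⟨a, ha0, ha8, ha⟩ : ∃ a : ℝ, 0 < a ∧ a < 1 / 8 ∧
      2 / σ < 2 * Real.arcsin ((1 - 2 * (4 * a)) / √(1 + 4 * a)) := by
    have hcont : Filter.Tendsto (fun a : ℝ => 2 * Real.arcsin ((1 - 2 * (4 * a)) / √(1 + 4 * a)))
        (nhdsWithin 0 (Set.Ioi 0))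
        (nhds (2 * Real.arcsin ((1 - 2 * (4 * 0)) / √(1 + 4 * 0)))) := by
      refine tendsto_nhdsWithin_of_tendsto_nhds (ContinuousAt.tendsto ?_)
      refine continuousAt_const.mul (Real.continuous_arcsin.continuousAt.comp ?_)
      exact ContinuousAt.div (by fun_prop) (by fun_prop) (by norm_num)
    have h1 : 2 / σ < 2 * Real.arcsin ((1 - 2 * (4 * 0)) / √(1 + 4 * 0)) := by
      norm_num
      rw [div_lt_iff₀ hπ] at hσ
      rw [div_lt_iff₀ hσ0]
      linarith
    have h2 := hcont.eventually (lt_mem_nhds h1)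
    have h3 : ∀ᶠ ε : ℝ in nhdsWithin 0 (Set.Ioi 0), ε < 1 / 8 :=
      nhdsWithin_le_nhds (Iio_mem_nhds (by norm_num))
    obtain ⟨ε, ⟨ha, hb⟩, hc⟩ := ((h2.and h3).and self_mem_nhdsWithin).exists
    exact ⟨ε, hc, hb, ha⟩
  set I := ∫ x in (0 : ℝ)..1, bump a x with hI
  have hIσ : 2 / σ < I := ha.trans_le (arcsin_le_integral_bump ha0 ha8.le)
  have hI0 : 0 < I := lt_trans (by positivity) hIσ
  obtain ⟨M, hM0, hM⟩ := exists_bump_lipschitz ha0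
  have hcb := continuous_bump ha0
  exact ⟨{
    f := fun x => (∫ t in (0 : ℝ)..x, bump a t) / I
    h := fun x => bump a x / I
    M := M / I
    a := a
    M_pos := by positivity
    a_pos := ha0
    f_zero := by simp
    f_one := div_self hI0.ne'
    hasDerivAt := fun x => (intervalIntegral.integral_hasDerivAt_right
      (hcb.intervalIntegrable 0 x) (hcb.stronglyMeasurableAtFilter _ _)
        hcb.continuousAt).div_const I
    h_nonneg := fun x => div_nonneg (bump_nonneg a x) hI0.le
    lipschitz := fun x hx y hy => by
      rw [← sub_div, abs_div, abs_of_pos hI0, div_mul_eq_mul_div]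
      exact div_le_div_of_nonneg_right (hM x hx y hy) hI0.le
    h_le := fun x => by
      have h1 := sqrt_mul_bump_le ha0 x
      rw [div_lt_iff₀ hσ0] at hIσ
      rw [mul_div_assoc', div_le_iff₀ hI0]
      nlinarith
    h_eq_zero := fun x hx => by rw [bump_eq_zero ha0 hx, zero_div] }⟩

namespace Profile

variable {σ : ℝ} (P : Profile σ)

theorem monotone : Monotone P.f :=
  monotone_of_hasDerivAt_nonneg P.hasDerivAt P.h_nonneg

theorem f_nonneg {x : ℝ} (hx : 0 ≤ x) : 0 ≤ P.f x := P.f_zero ▸ P.monotone hx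

theorem f_le_one {x : ℝ} (hx : x ≤ 1) : P.f x ≤ 1 := P.f_one ▸ P.monotone hx

theorem h_zero : P.h 0 = 0 := P.h_eq_zero 0 (by simpa using P.a_pos.le)

theorem h_one : P.h 1 = 0 := P.h_eq_zero 1 (by simpa using P.a_pos.le)

theorem exists_slope {x y : ℝ} (hxy : x < y) :
    ∃ ξ ∈ Set.Ioo x y, P.f y - P.f x = P.h ξ * (y - x) := by
  obtain ⟨ξ, hξ, h⟩ := exists_hasDerivAt_eq_slope P.f P.h hxy
    (fun z _ => (P.hasDerivAt z).continuousAt.continuousWithinAt) fun z _ => P.hasDerivAt z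
  refine ⟨ξ, hξ, ?_⟩
  rw [h, div_mul_cancel₀]
  linarith

/-- A nonnegative function with Lipschitz derivative dominates the square of its derivative. -/
theorem h_sq_le {x : ℝ} (hx : x ∈ Set.Icc (0 : ℝ) 1) : P.h x ^ 2 ≤ 4 * P.M * P.f x := by
  have hM := P.M_pos
  rcases (P.h_nonneg x).eq_or_lt with h0 | h0
  · rw [← h0]
    have := mul_nonneg (mul_nonneg zero_le_four hM.le) (P.f_nonneg hx.1)
    simpa using this
  set d := P.h x / (2 * P.M) with hd
  have hd0 : 0 < d := by positivity
  have hMd : P.M * d = P.h x / 2 := by rw [hd]; field_simp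
  have h1 := P.lipschitz x hx 0 ⟨le_rfl, zero_le_one⟩
  rw [P.h_zero, sub_zero, sub_zero, abs_of_nonneg hx.1, abs_of_pos h0] at h1
  have hdx : d ≤ x := by nlinarith
  obtain ⟨ξ, hξ, h2⟩ := P.exists_slope (sub_lt_self x hd0)
  have h3 := (abs_le.1 (P.lipschitz x hx ξ ⟨by linarith [hξ.1], by linarith [hξ.2, hx.2]⟩)).2
  rw [abs_of_pos (by linarith [hξ.2])] at h3
  have h4 : P.M * (x - ξ) ≤ P.M * d := mul_le_mul_of_nonneg_left (by linarith [hξ.1]) hM.le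
  have h5 : P.h x / 2 ≤ P.h ξ := by linarith
  have h6 := P.f_nonneg (sub_nonneg.2 hdx)
  have h7 : P.h x / 2 * d ≤ P.h ξ * d := mul_le_mul_of_nonneg_right h5 hd0.le
  rw [sub_sub_cancel] at h2
  have h8 : P.h x ^ 2 = 4 * P.M * (P.h x / 2 * d) := by rw [hd]; field_simp; norm_num
  rw [h8]
  exact mul_le_mul_of_nonneg_left (by linarith) (by linarith)

/-- The bound `h_sq_le` for the complementary profile `1 - f`. -/
theorem h_sq_le' {x : ℝ} (hx : x ∈ Set.Icc (0 : ℝ) 1) : P.h x ^ 2 ≤ 4 * P.M * (1 - P.f x) := by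
  have hM := P.M_pos
  rcases (P.h_nonneg x).eq_or_lt with h0 | h0
  · rw [← h0]
    have := mul_nonneg (mul_nonneg zero_le_four hM.le) (sub_nonneg.2 (P.f_le_one hx.2))
    simpa using this
  set d := P.h x / (2 * P.M) with hd
  have hd0 : 0 < d := by positivity
  have hMd : P.M * d = P.h x / 2 := by rw [hd]; field_simp
  have h1 := P.lipschitz x hx 1 ⟨zero_le_one, le_rfl⟩
  rw [P.h_one, sub_zero, abs_of_nonpos (sub_nonpos.2 hx.2), abs_of_pos h0] at h1
  have hdx : x + d ≤ 1 := by nlinarith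
  obtain ⟨ξ, hξ, h2⟩ := P.exists_slope (lt_add_of_pos_right x hd0)
  have h3 := (abs_le.1 (P.lipschitz x hx ξ ⟨by linarith [hξ.1, hx.1], by linarith [hξ.2]⟩)).2
  rw [abs_of_neg (by linarith [hξ.1])] at h3
  have h4 : P.M * -(x - ξ) ≤ P.M * d := mul_le_mul_of_nonneg_left (by linarith [hξ.2]) hM.le
  have h5 : P.h x / 2 ≤ P.h ξ := by linarith
  have h6 := P.f_le_one hdx
  have h7 : P.h x / 2 * d ≤ P.h ξ * d := mul_le_mul_of_nonneg_right h5 hd0.le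
  rw [add_sub_cancel_left] at h2
  have h8 : P.h x ^ 2 = 4 * P.M * (P.h x / 2 * d) := by rw [hd]; field_simp; norm_num
  rw [h8]
  exact mul_le_mul_of_nonneg_left (by linarith) (by linarith)

/-- The increment of the profile over one step of length `1/m`, divided by that length. -/
noncomputable def step (m k : ℕ) : ℝ := m * (P.f ((k + 1 : ℝ) / m) - P.f ((k : ℝ) / m))

theorem exists_step_eq {m k : ℕ} (hk : k < m) :
    ∃ ξ ∈ Set.Ioo ((k : ℝ) / m) ((k + 1 : ℝ) / m), P.step m k = P.h ξ := by
  have hm : (0 : ℝ) < m := Nat.cast_pos.2 (by omega)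
  obtain ⟨ξ, hξ, h⟩ := P.exists_slope
    (show (k : ℝ) / m < (k + 1 : ℝ) / m from div_lt_div_of_pos_right (by linarith) hm)
  refine ⟨ξ, hξ, ?_⟩
  rw [step, h]
  field_simp
  ring

theorem mem_Icc_of_mem_step {m k : ℕ} (hk : k < m) {ξ : ℝ}
    (hξ : ξ ∈ Set.Ioo ((k : ℝ) / m) ((k + 1 : ℝ) / m)) : ξ ∈ Set.Icc (0 : ℝ) 1 := by
  have hm : (0 : ℝ) < m := Nat.cast_pos.2 (by omega)
  have h1 : (k + 1 : ℝ) ≤ m := by exact_mod_cast hk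
  exact ⟨(by positivity : (0 : ℝ) ≤ k / m).trans hξ.1.le,
    hξ.2.le.trans (div_le_one_of_le₀ h1 hm.le)⟩

theorem step_sq_le {m k : ℕ} (hk : k < m) :
    P.step m k ^ 2 ≤ 4 * P.M * P.f ((k + 1 : ℝ) / m) := by
  obtain ⟨ξ, hξ, h⟩ := P.exists_step_eq hk
  rw [h]
  refine (P.h_sq_le (mem_Icc_of_mem_step hk hξ)).trans ?_
  exact mul_le_mul_of_nonneg_left (P.monotone hξ.2.le) (by linarith [P.M_pos])

theorem step_sq_le' {m k : ℕ} (hk : k < m) :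
    P.step m k ^ 2 ≤ 4 * P.M * (1 - P.f ((k : ℝ) / m)) := by
  obtain ⟨ξ, hξ, h⟩ := P.exists_step_eq hk
  rw [h]
  refine (P.h_sq_le' (mem_Icc_of_mem_step hk hξ)).trans ?_
  exact mul_le_mul_of_nonneg_left (by linarith [P.monotone hξ.1.le]) (by linarith [P.M_pos])

theorem step_eq_zero {m k : ℕ} (hk : k < m) (h : ((k + 1 : ℝ) * (m - k)) ≤ P.a * m ^ 2) :
    P.step m k = 0 := by
  have hm : (0 : ℝ) < m := Nat.cast_pos.2 (by omega)
  obtain ⟨ξ, hξ, h1⟩ := P.exists_step_eq hk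
  have h2 := mem_Icc_of_mem_step hk hξ
  rw [h1]
  refine P.h_eq_zero ξ ?_
  have h3 : (k + 1 : ℝ) / m * (1 - k / m) ≤ P.a := by
    have : (k + 1 : ℝ) / m * (1 - k / m) = (k + 1 : ℝ) * (m - k) / m ^ 2 := by field_simp
    rw [this, div_le_iff₀ (by positivity)]
    exact h
  refine le_trans (mul_le_mul hξ.2.le (by linarith [hξ.1]) (by linarith [h2.2]) ?_) h3
  positivity

theorem step_le {m k : ℕ} (hk : k < m) {p : ℝ} (hp : p ∈ Set.Icc (0 : ℝ) 1) :
    P.step m k ≤ P.h p + P.M * (|(k : ℝ) / m - p| + 1 / m) := by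
  have hm : (0 : ℝ) < m := Nat.cast_pos.2 (by omega)
  obtain ⟨ξ, hξ, h1⟩ := P.exists_step_eq hk
  have h2 := (abs_le.1 (P.lipschitz ξ (mem_Icc_of_mem_step hk hξ) p hp)).2
  have h3 : |ξ - p| ≤ |(k : ℝ) / m - p| + 1 / m := by
    have h4 : |ξ - k / m| ≤ 1 / m := by
      rw [abs_of_pos (by linarith [hξ.1])]
      have := hξ.2
      rw [add_div] at this
      linarith
    have h5 := abs_add_le ((k : ℝ) / m - p) (ξ - k / m)
    rw [show (k : ℝ) / m - p + (ξ - k / m) = ξ - p by ring] at h5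
    linarith
  have := mul_le_mul_of_nonneg_left h3 P.M_pos.le
  linarith

end Profile

/-! ### Binomial expectations -/

/-- The number of ones in a column. -/
def ones {ι : Type*} [Fintype ι] (v : ι → Bool) : ℕ := ∑ j, (v j).toNat

theorem ones_le {ι : Type*} [Fintype ι] (v : ι → Bool) : ones v ≤ Fintype.card ι := by
  refine (Finset.sum_le_card_nsmul _ _ 1 fun j _ => Bool.toNat_le (v j)).trans (le_of_eq ?_)
  simp

/-- The expectation of `G` at a binomial variable with parameters `k` and `p`. -/
noncomputable def bexp (k : ℕ) (p : ℝ) (G : ℕ → ℝ) : ℝ :=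
  pexp (fun (_ : Fin k) b => bern p b) fun v => G (ones v)

theorem pexp_ones_eq_bexp {ι : Type*} [Fintype ι] [DecidableEq ι] {k : ℕ}
    (hk : Fintype.card ι = k) (p : ℝ) (G : ℕ → ℝ) :
    pexp (fun (_ : ι) b => bern p b) (fun v => G (ones v)) = bexp k p G := by
  have e := Fintype.equivFinOfCardEq hk
  refine Fintype.sum_equiv (e.arrowCongr (Equiv.refl Bool)) _ _ fun v => ?_
  have h1 : ∏ i, bern p ((e.arrowCongr (Equiv.refl Bool)) v i) = ∏ j, bern p (v j) :=
    Fintype.prod_equiv e.symm _ _ fun i => rfl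
  have h2 : ones ((e.arrowCongr (Equiv.refl Bool)) v) = ones v :=
    Fintype.sum_equiv e.symm _ _ fun i => rfl
  beta_reduce
  rw [h1, h2]

section bexp

variable {k : ℕ} (p : unitInterval)

theorem bexp_mono {G H : ℕ → ℝ} (h : ∀ i ≤ k, G i ≤ H i) : bexp k p G ≤ bexp k p H :=
  pexp_mono (fun _ b => bern_nonneg' p b) fun v => h _ ((ones_le v).trans (by simp))

theorem bexp_const (a : ℝ) : bexp k p (fun _ => a) = a := pexp_const (fun _ => bern_sum _) a

theorem bexp_add (G H : ℕ → ℝ) : bexp k p (fun i => G i + H i) = bexp k p G + bexp k p H :=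
  pexp_add _ _

theorem bexp_sub (G H : ℕ → ℝ) : bexp k p (fun i => G i - H i) = bexp k p G - bexp k p H :=
  pexp_sub _ _

theorem bexp_mul_left (a : ℝ) (G : ℕ → ℝ) : bexp k p (fun i => a * G i) = a * bexp k p G :=
  pexp_mul_left _ _

theorem sum_bern_centred : ∑ b : Bool, bern p b * ((b.toNat : ℝ) - p) = 0 := by
  simp [bern]; ring

theorem ones_sub_mean (v : Fin k → Bool) :
    (ones v : ℝ) - k * p = ∑ j, (((v j).toNat : ℝ) - p) := by
  simp [ones]

theorem bexp_centred : bexp k p (fun i => (i : ℝ) - k * p) = 0 := by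
  simp only [bexp, ones_sub_mean]
  rw [pexp_sum]
  refine Finset.sum_eq_zero fun j _ => ?_
  rw [pexp_single (fun _ => bern_sum _) j fun b : Bool => ((b.toNat : ℝ) - p)]
  exact sum_bern_centred p

theorem bexp_variance : bexp k p (fun i => ((i : ℝ) - k * p) ^ 2) = k * (p * (1 - p)) := by
  simp only [bexp, ones_sub_mean]
  rw [pexp_sq_sum (fun _ => bern_sum _) (fun _ b => ((b.toNat : ℝ) - p))
    fun _ => sum_bern_centred p]
  have : ∑ b : Bool, bern p b * ((b.toNat : ℝ) - p) ^ 2 = p * (1 - p) := by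
    simp [bern]; ring
  simp only [this, Finset.sum_const, Finset.card_univ, Fintype.card_fin, nsmul_eq_mul]

/-- The Cauchy–Schwarz inequality. -/
theorem bexp_mul_sq_le (G H : ℕ → ℝ) :
    bexp k p (fun i => G i * H i) ^ 2 ≤
      bexp k p (fun i => G i ^ 2) * bexp k p (fun i => H i ^ 2) := by
  have h0 : ∀ v : Fin k → Bool, 0 ≤ ∏ j, bern p (v j) := fun v =>
    Finset.prod_nonneg fun _ _ => bern_nonneg' p _
  exact Finset.sum_sq_le_sum_mul_sum_of_sq_le_mul _ (fun v _ => mul_nonneg (h0 v) (sq_nonneg _))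
    (fun v _ => mul_nonneg (h0 v) (sq_nonneg _)) fun v _ => le_of_eq (by ring)

end bexp

/-! ### One segment of the pirate strategy -/

namespace Profile

variable {σ : ℝ} (P : Profile σ) (m : ℕ) (p : unitInterval)

/-- The probability of the output `true` in a segment of bias `p`, given that a fixed pirate, one of
`m`, holds the symbol `b`. -/
noncomputable def outGiven (p : ℝ) (b : Bool) : ℝ :=
  bexp (m - 1) p fun i => P.f (((i + b.toNat : ℕ) : ℝ) / m)

/-- The probability of the output `true` in a segment of bias `p`. -/
noncomputable def outProb (p : ℝ) : ℝ := ∑ b, bern p b * P.outGiven m p b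

/-- The mean of the score of a pirate in a segment of bias `p`, given the output `y`. Given `y`, the
symbol of a pirate has density `1 + shift * score` with respect to that of an innocent user. -/
noncomputable def shift (p : ℝ) (y : Bool) : ℝ :=
  √(p * (1 - p)) * (P.outGiven m p true - P.outGiven m p false) / bern (P.outProb m p) y

/-- A bound on the square of the correlation of a pirate's symbol and the output. It is small where
the bias is close to `0` or `1`. -/
noncomputable def chiBound (p : ℝ) : ℝ :=
  8 * P.M / m ^ 2 * min 1 ((p * (1 - p) + 1 / m) / P.a)

variable {m}

theorem outGiven_nonneg (b : Bool) : 0 ≤ P.outGiven m p b :=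
  pexp_nonneg (fun _ b => bern_nonneg' p b) fun _ => P.f_nonneg (by positivity)

theorem outGiven_le_one (hm : 1 ≤ m) (b : Bool) : P.outGiven m p b ≤ 1 := by
  rw [← bexp_const (k := m - 1) p 1]
  refine bexp_mono p fun i hi => P.f_le_one (div_le_one_of_le₀ ?_ (Nat.cast_nonneg m))
  have := Bool.toNat_le b
  exact_mod_cast (by omega : i + b.toNat ≤ m)

theorem outGiven_sub :
    m * (P.outGiven m p true - P.outGiven m p false) = bexp (m - 1) p (P.step m) := by
  rw [outGiven, outGiven, ← bexp_sub, ← bexp_mul_left]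
  simp
  rfl

theorem outGiven_mono (hm : 1 ≤ m) : P.outGiven m p false ≤ P.outGiven m p true :=
  bexp_mono p fun i _ => P.monotone (by gcongr; simp)

theorem outProb_eq : P.outProb m p = p * P.outGiven m p true + (1 - p) * P.outGiven m p false := by
  simp [outProb, bern]

theorem outProb_mem (hm : 1 ≤ m) : P.outProb m p ∈ Set.Icc (0 : ℝ) 1 := by
  have h0 := p.2.1
  have h1 := p.2.2
  have := P.outGiven_nonneg p (m := m) true
  have := P.outGiven_nonneg p (m := m) false
  have := P.outGiven_le_one p hm true
  have := P.outGiven_le_one p hm false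
  rw [outProb_eq]
  constructor <;> nlinarith

/-- The increments of the profile at a binomial variable average to about `h p`, since its deviation
from the mean is of order `1 / √m` and `h` is Lipschitz. -/
theorem sqrt_mul_step_le (hm : 1 ≤ m) :
    2 * √((p : ℝ) * (1 - p)) * bexp (m - 1) p (P.step m) ≤ σ + 3 * P.M / √m := by
  have hm0 : (0 : ℝ) < m := Nat.cast_pos.2 hm
  have hm1 : (1 : ℝ) ≤ m := Nat.one_le_cast.2 hm
  set s := √(m : ℝ) with hs
  have hs1 : 1 ≤ s := by rw [hs, Real.one_le_sqrt]; exact hm1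
  have hms : (m : ℝ) = s ^ 2 := (Real.sq_sqrt hm0.le).symm
  have hk : ((m - 1 : ℕ) : ℝ) = m - 1 := by push_cast [hm]; ring
  have h0 := p.2.1
  have h1 := p.2.2
  have hpq := mul_one_sub_nonneg p
  -- `|t| ≤ (1/s + s t²) / 2`, applied to the deviation `t` of the empirical frequency
  have h2 : bexp (m - 1) p (P.step m) ≤ bexp (m - 1) p (fun i =>
      (P.h p + P.M * (1 / (2 * s) + 1 / m + s / (2 * m ^ 2) * p ^ 2)) +
      (P.M * s / (2 * m ^ 2) * ((i : ℝ) - (m - 1 : ℕ) * p) ^ 2 -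
        P.M * s / (2 * m ^ 2) * (2 * p) * ((i : ℝ) - (m - 1 : ℕ) * p))) := by
    refine bexp_mono p fun i hi => (P.step_le (by omega) ⟨h0, h1⟩).trans ?_
    have h3 : |(i : ℝ) / m - p| ≤ 1 / (2 * s) + s / 2 * ((i : ℝ) / m - p) ^ 2 := by
      have h4 : 1 / (2 * s) + s / 2 * ((i : ℝ) / m - p) ^ 2 - |(i : ℝ) / m - p| =
          s / 2 * (|(i : ℝ) / m - p| - 1 / s) ^ 2 := by
        rw [← sq_abs ((i : ℝ) / m - p)]
        field_simp
        ring
      have : 0 ≤ s / 2 * (|(i : ℝ) / m - p| - 1 / s) ^ 2 := by positivity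
      linarith
    have h5 : s / 2 * ((i : ℝ) / m - p) ^ 2 = s / (2 * m ^ 2) * p ^ 2 +
        (s / (2 * m ^ 2) * ((i : ℝ) - (m - 1 : ℕ) * p) ^ 2 -
          s / (2 * m ^ 2) * (2 * p) * ((i : ℝ) - (m - 1 : ℕ) * p)) := by
      rw [hk]; field_simp; ring
    rw [h5] at h3
    have := mul_le_mul_of_nonneg_left h3 P.M_pos.le
    refine le_trans (add_le_add_right (mul_le_mul_of_nonneg_left
      (add_le_add_left h3 _) P.M_pos.le) _) (le_of_eq ?_)
    ring
  rw [bexp_add, bexp_sub, bexp_mul_left, bexp_mul_left, bexp_const, bexp_variance, bexp_centred,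
    hk] at h2
  have h6 : P.h p + P.M * (1 / (2 * s) + 1 / m + s / (2 * m ^ 2) * p ^ 2) +
      (P.M * s / (2 * m ^ 2) * ((m - 1) * (p * (1 - p))) - P.M * s / (2 * m ^ 2) * (2 * p) * 0) ≤
      P.h p + 3 * P.M / s := by
    have h7 : (p : ℝ) ^ 2 + (m - 1) * (p * (1 - p)) ≤ m := by nlinarith
    have h8 : s / (2 * m ^ 2) * ((p : ℝ) ^ 2 + (m - 1) * (p * (1 - p))) ≤ s / (2 * m ^ 2) * m :=
      mul_le_mul_of_nonneg_left h7 (by positivity)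
    have h9 : s / (2 * m ^ 2) * m = 1 / (2 * s) := by rw [hms]; field_simp
    have h10 : (1 : ℝ) / m ≤ 1 / s := by
      refine one_div_le_one_div_of_le (by linarith) ?_
      rw [hms]; nlinarith
    have h11 : 1 / (2 * s) = 1 / s / 2 := by field_simp
    have h12 : 0 < 1 / s := by positivity
    have h13 : 3 * P.M / s = P.M * (3 * (1 / s)) := by ring
    have h14 := mul_le_mul_of_nonneg_left (by linarith : 1 / (2 * s) + 1 / m +
      s / (2 * m ^ 2) * ((p : ℝ) ^ 2 + (m - 1) * (p * (1 - p))) ≤ 3 * (1 / s)) P.M_pos.le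
    rw [h13]
    refine le_trans (le_of_eq ?_) (add_le_add_right h14 (P.h p))
    ring
  have h15 := h2.trans h6
  have hsq : 2 * √((p : ℝ) * (1 - p)) ≤ 1 := by
    have : √((p : ℝ) * (1 - p)) ≤ √((1 / 2) ^ 2) :=
      Real.sqrt_le_sqrt (by nlinarith [sq_nonneg ((p : ℝ) - 1 / 2)])
    rw [Real.sqrt_sq (by norm_num)] at this
    linarith
  have hsq0 : 0 ≤ 2 * √((p : ℝ) * (1 - p)) := by positivity
  have h16 : 0 ≤ 3 * P.M / s := by have := P.M_pos; positivity
  have := P.h_le p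
  nlinarith [mul_le_mul_of_nonneg_left h15 hsq0]

/-- The number of ones must lie in a middle range for one further symbol to influence the output;
Cauchy–Schwarz then bounds that influence. -/
theorem step_sq_le_chi (hm : 1 ≤ m) :
    bexp (m - 1) p (P.step m) ^ 2 ≤ 8 * P.M * min 1 (((p : ℝ) * (1 - p) + 1 / m) / P.a) *
      (P.outGiven m p true * (1 - P.outGiven m p false)) := by
  classical
  have hM := P.M_pos
  have ha := P.a_pos
  have hm0 : (0 : ℝ) < m := Nat.cast_pos.2 hm
  have hk : ((m - 1 : ℕ) : ℝ) = m - 1 := by push_cast [hm]; ring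
  set ψ := min 1 (((p : ℝ) * (1 - p) + 1 / m) / P.a) with hψ
  have h0 := p.2.1
  have h1 := p.2.2
  have hpq := mul_one_sub_nonneg p
  set I : ℕ → ℝ := fun i => if P.step m i = 0 then 0 else 1 with hI
  have e1 : P.step m = fun i => P.step m i * I i := by
    funext i
    by_cases h : P.step m i = 0 <;> simp [hI, h]
  have h2 := bexp_mul_sq_le (k := m - 1) p (P.step m) I
  rw [← e1] at h2
  have hI1 : bexp (m - 1) p (fun i => I i ^ 2) ≤ 1 := by
    conv_rhs => rw [← bexp_const (k := m - 1) p 1]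
    refine bexp_mono p fun i _ => ?_
    by_cases h : P.step m i = 0 <;> simp [hI, h]
  have hI2 : bexp (m - 1) p (fun i => I i ^ 2) ≤ ((p : ℝ) * (1 - p) + 1 / m) / P.a := by
    have h3 : bexp (m - 1) p (fun i => I i ^ 2) ≤ bexp (m - 1) p (fun i =>
        (((m - 1) * p + 1) * ((m - 1) * (1 - p) + 1)) / (P.a * m ^ 2) +
        ((m - 1) * (1 - p) - (m - 1) * p) / (P.a * m ^ 2) * ((i : ℝ) - (m - 1 : ℕ) * p)) := by
      refine bexp_mono p fun i hi => ?_
      have him : (i : ℝ) + 1 ≤ m := by exact_mod_cast (by omega : i + 1 ≤ m)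
      have h6 : ((i : ℝ) + 1) * (m - i) / (P.a * m ^ 2) ≤
          (((m - 1) * p + 1) * ((m - 1) * (1 - p) + 1)) / (P.a * m ^ 2) +
          ((m - 1) * (1 - p) - (m - 1) * p) / (P.a * m ^ 2) * ((i : ℝ) - (m - 1 : ℕ) * p) := by
        rw [div_mul_eq_mul_div, ← add_div, hk]
        refine div_le_div_of_nonneg_right ?_ (by positivity)
        nlinarith [sq_nonneg ((i : ℝ) - (m - 1) * p)]
      refine le_trans ?_ h6
      by_cases h : P.step m i = 0
      · have : 0 ≤ ((i : ℝ) + 1) * (m - i) / (P.a * m ^ 2) :=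
          div_nonneg (mul_nonneg (by positivity) (by linarith)) (by positivity)
        simpa [hI, h] using this
      · have : P.a * m ^ 2 < ((i : ℝ) + 1) * (m - i) :=
          not_le.1 fun h7 => h (P.step_eq_zero (by omega) h7)
        simp only [hI, h, if_false, one_pow]
        rw [one_le_div (by positivity)]
        exact this.le
    rw [bexp_add, bexp_mul_left, bexp_const, bexp_centred, mul_zero, add_zero] at h3
    refine h3.trans ?_
    rw [div_le_div_iff₀ (by positivity) ha, show ((p : ℝ) * (1 - p) + 1 / m) * (P.a * m ^ 2) =
      (m ^ 2 * (p * (1 - p)) + m) * P.a by field_simp]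
    refine mul_le_mul_of_nonneg_right ?_ ha.le
    have : (1 : ℝ) ≤ m := Nat.one_le_cast.2 hm
    nlinarith
  have h4 : bexp (m - 1) p (fun i => P.step m i ^ 2) ≤ 4 * P.M * P.outGiven m p true := by
    rw [outGiven, ← bexp_mul_left]
    refine bexp_mono p fun i hi => ?_
    simpa using P.step_sq_le (m := m) (k := i) (by omega)
  have h5 : bexp (m - 1) p (fun i => P.step m i ^ 2) ≤ 4 * P.M * (1 - P.outGiven m p false) := by
    rw [outGiven, ← bexp_const (k := m - 1) p 1, ← bexp_sub, ← bexp_mul_left]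
    refine bexp_mono p fun i hi => ?_
    simpa using P.step_sq_le' (m := m) (k := i) (by omega)
  have hψI : bexp (m - 1) p (fun i => I i ^ 2) ≤ ψ := le_min hI1 hI2
  have hψ0 : 0 ≤ ψ := le_min zero_le_one (by positivity)
  set A := P.outGiven m p true
  set E := P.outGiven m p false
  have hAE : E ≤ A := P.outGiven_mono p hm
  have hE0 : 0 ≤ E := P.outGiven_nonneg p false
  have hA1 : A ≤ 1 := P.outGiven_le_one p hm true
  -- one of `A` and `1 - E` is at least `1/2`, because their sum is at least `1`
  have h6 : bexp (m - 1) p (fun i => P.step m i ^ 2) ≤ 8 * P.M * (A * (1 - E)) := by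
    rcases le_total (1 / 2) A with h | h
    · have : 0 ≤ (1 - E) * (2 * A - 1) := mul_nonneg (by linarith) (by linarith)
      nlinarith
    · have : 0 ≤ A * (2 * (1 - E) - 1) := mul_nonneg (by linarith) (by linarith)
      nlinarith
  calc _ ≤ _ := h2
    _ ≤ 8 * P.M * (A * (1 - E)) * ψ := by
      refine mul_le_mul h6 hψI (pexp_nonneg (fun _ b => bern_nonneg' p b) fun _ => sq_nonneg _) ?_
      exact mul_nonneg (by linarith) (mul_nonneg (by linarith) (by linarith))
    _ = _ := by ring

end Profile

namespace Profile

variable {σ : ℝ} (P : Profile σ) {m : ℕ} (p : unitInterval)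

theorem bern_mul_bern_outGiven (b y : Bool) :
    bern p b * bern (P.outGiven m p b) y = bern p b * (bern (P.outProb m p) y +
      √((p : ℝ) * (1 - p)) * (P.outGiven m p true - P.outGiven m p false) * score b y p) := by
  have h1 := bern_mul_score_true p.2.1
  have h2 := bern_mul_score_false p.2.2
  have h3 := Real.mul_self_sqrt (mul_one_sub_nonneg p)
  have h4 : ∀ b, bern p b * score b true p = (if b then 1 else -1) * √((p : ℝ) * (1 - p)) := by
    intro b; cases b
    · simpa using h2
    · simpa using h1
  rw [mul_add, mul_left_comm (bern p b), outProb_eq]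
  set A := P.outGiven m p true with hA
  set E := P.outGiven m p false with hE
  set S := √((p : ℝ) * (1 - p))
  cases y
  · rw [score_false_right, mul_neg, h4]
    cases b <;> simp only [bern, if_true, Bool.false_eq_true, if_false, ← hA, ← hE]
    · linear_combination (-(A - E)) * h3
    · linear_combination (A - E) * h3
  · rw [h4]
    cases b <;> simp only [bern, if_true, Bool.false_eq_true, if_false, ← hA, ← hE]
    · linear_combination (A - E) * h3
    · linear_combination (-(A - E)) * h3

theorem sum_bern_mul_bern_outGiven (y : Bool) :
    ∑ b, bern p b * bern (P.outGiven m p b) y = bern (P.outProb m p) y := by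
  rw [outProb]
  cases y <;> simp [bern]
  ring

theorem bern_outGiven_nonneg (hm : 1 ≤ m) (b y : Bool) : 0 ≤ bern (P.outGiven m p b) y :=
  bern_nonneg (P.outGiven_nonneg p b) (P.outGiven_le_one p hm b) y

theorem bern_outProb_nonneg (hm : 1 ≤ m) (y : Bool) : 0 ≤ bern (P.outProb m p) y :=
  bern_nonneg (P.outProb_mem p hm).1 (P.outProb_mem p hm).2 y

/-- The joint law of a pirate's symbol and the output. -/
theorem bern_mul_bern_outGiven_eq_shift (hm : 1 ≤ m) (b y : Bool) :
    bern p b * bern (P.outGiven m p b) y =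
      bern (P.outProb m p) y * (bern p b * (1 + P.shift m p y * score b y p)) := by
  by_cases h : bern (P.outProb m p) y = 0
  · rw [h, zero_mul]
    refine (Finset.sum_eq_zero_iff_of_nonneg fun b _ =>
      mul_nonneg (bern_nonneg' p b) (P.bern_outGiven_nonneg p hm b y)).1 ?_ b (Finset.mem_univ b)
    rw [sum_bern_mul_bern_outGiven, h]
  · rw [bern_mul_bern_outGiven, shift]
    field_simp

/-- The density of a pirate's symbol is nonnegative, also where the output has probability `0`, since
there the shift is `0` by convention. -/
theorem one_add_shift_mul_score_nonneg (hm : 1 ≤ m) (b y : Bool) :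
    0 ≤ 1 + P.shift m p y * score b y p := by
  rcases (P.bern_outProb_nonneg p hm y).eq_or_lt with h | h
  · simp [shift, ← h]
  · rcases (mul_one_sub_nonneg p).eq_or_lt with h1 | h1
    · simp [score_eq_zero h1.symm]
    · obtain ⟨h2, h3⟩ := (mul_one_sub_pos_iff p).1 h1
      have h4 : 0 < bern p b := by
        cases b <;> simp only [bern, if_true, Bool.false_eq_true, if_false] <;> linarith
      have h5 := mul_nonneg h4.le (P.bern_outGiven_nonneg p hm b y)
      rw [P.bern_mul_bern_outGiven_eq_shift p hm] at h5
      by_contra h6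
      have := mul_neg_of_pos_of_neg h (mul_neg_of_pos_of_neg h4 (not_le.1 h6))
      linarith

/-- The mean score of a pirate. -/
theorem sum_shift_le (hm : 1 ≤ m) :
    ∑ y, bern (P.outProb m p) y * P.shift m p y ≤ (σ + 3 * P.M / √m) / m := by
  have hm0 : (0 : ℝ) < m := Nat.cast_pos.2 hm
  have h0 : 0 ≤ √((p : ℝ) * (1 - p)) * (P.outGiven m p true - P.outGiven m p false) :=
    mul_nonneg (Real.sqrt_nonneg _) (sub_nonneg.2 (P.outGiven_mono p hm))
  have h1 : ∀ y, bern (P.outProb m p) y * P.shift m p y ≤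
      √((p : ℝ) * (1 - p)) * (P.outGiven m p true - P.outGiven m p false) := by
    intro y
    by_cases h : bern (P.outProb m p) y = 0
    · rw [h, zero_mul]; exact h0
    · rw [shift, mul_div_cancel₀ _ h]
  have h2 := P.sqrt_mul_step_le p hm
  rw [← P.outGiven_sub p] at h2
  rw [Fintype.sum_bool, le_div_iff₀ hm0]
  nlinarith [h1 true, h1 false]

theorem chiBound_nonneg : 0 ≤ P.chiBound m p := by
  have := P.M_pos
  have := P.a_pos
  have := mul_one_sub_nonneg p
  rw [chiBound]
  positivity

theorem sum_shift_sq_le (hm : 1 ≤ m) :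
    ∑ y, bern (P.outProb m p) y * P.shift m p y ^ 2 ≤ P.chiBound m p := by
  have hm0 : (0 : ℝ) < m := Nat.cast_pos.2 hm
  have hχ := P.chiBound_nonneg (m := m) p
  set A := P.outGiven m p true with hA
  set E := P.outGiven m p false with hE
  have hA0 : 0 ≤ A := P.outGiven_nonneg p true
  have hA1 : A ≤ 1 := P.outGiven_le_one p hm true
  have hE0 : 0 ≤ E := P.outGiven_nonneg p false
  have hE1 : E ≤ 1 := P.outGiven_le_one p hm false
  have hp0 := p.2.1
  have hp1 := p.2.2
  set φ := P.outProb m p with hφ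
  have hφe : φ = p * A + (1 - p) * E := P.outProb_eq p
  set S := √((p : ℝ) * (1 - p)) * (A - E) with hS
  have h1 : S ^ 2 ≤ P.chiBound m p * (φ * (1 - φ)) := by
    have h2 := P.step_sq_le_chi p hm
    rw [← P.outGiven_sub p, mul_pow] at h2
    have h3 : (A - E) ^ 2 ≤ P.chiBound m p * (A * (1 - E)) := by
      rw [chiBound, div_mul_eq_mul_div, div_mul_eq_mul_div, le_div_iff₀ (by positivity)]
      linarith
    have h4 : p * (1 - p) * (A * (1 - E)) ≤ φ * (1 - φ) := by
      have h5 : p * A ≤ φ := by rw [hφe]; nlinarith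
      have h6 : (1 - p) * (1 - E) ≤ 1 - φ := by rw [hφe]; nlinarith
      have := mul_le_mul h5 h6 (mul_nonneg (by linarith) (by linarith)) (by nlinarith)
      linarith
    rw [hS, mul_pow, Real.sq_sqrt (mul_one_sub_nonneg p)]
    calc (p : ℝ) * (1 - p) * (A - E) ^ 2 ≤ p * (1 - p) * (P.chiBound m p * (A * (1 - E))) :=
          mul_le_mul_of_nonneg_left h3 (mul_one_sub_nonneg p)
      _ = P.chiBound m p * (p * (1 - p) * (A * (1 - E))) := by ring
      _ ≤ _ := mul_le_mul_of_nonneg_left h4 hχ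
  have h7 : ∀ y, bern φ y * P.shift m p y ^ 2 ≤ P.chiBound m p * bern φ (!y) := by
    intro y
    have h8 : bern φ y * bern φ (!y) = φ * (1 - φ) := by
      cases y <;> simp [bern]
      ring
    rcases (P.bern_outProb_nonneg p hm y).eq_or_lt with h | h
    · rw [← hφ] at h
      rw [← h, zero_mul]
      exact mul_nonneg hχ (P.bern_outProb_nonneg p hm _)
    · rw [← hφ] at h
      have h9 : bern φ y * P.shift m p y ^ 2 = S ^ 2 / bern φ y := by
        rw [show P.shift m p y = S / bern φ y from rfl]
        field_simp
      rw [h9, div_le_iff₀ h]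
      calc S ^ 2 ≤ _ := h1
        _ = _ := by rw [← h8]; ring
  refine (Finset.sum_le_sum fun y _ => h7 y).trans (le_of_eq ?_)
  simp [bern]
  ring

end Profile

/-! ### Change of measure for the score of one user -/

theorem rpow_one_add_le {u κ : ℝ} (hu : 0 ≤ 1 + u) (hκ : 0 < κ) (hκ1 : κ ≤ 1) :
    (1 + u) ^ (1 + κ) ≤ 1 + (1 + κ) * u + κ * u ^ 2 := by
  rw [Real.rpow_one_add' hu (by linarith)]
  have h := rpow_one_add_le_one_add_mul_self (s := u) (by linarith) hκ.le hκ1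
  refine (mul_le_mul_of_nonneg_left h hu).trans (le_of_eq ?_)
  ring

theorem rpow_one_add_le_of_small {u κ : ℝ} (hu : |u| ≤ 1 / 2) (hκ : 0 < κ) (hκ1 : κ ≤ 1 / 2) :
    (1 + u) ^ (1 + κ) ≤ 1 + (1 + κ) * u + κ * (1 / 2 + 4 * |u| + 8 * κ) * u ^ 2 := by
  have hu' := abs_le.1 hu
  have hpos : 0 < 1 + u := by linarith
  rw [Real.rpow_one_add' hpos.le (by linarith), Real.rpow_def_of_pos hpos]
  set t := Real.log (1 + u) with ht
  set r := |u| with hr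
  have hr0 : 0 ≤ r := abs_nonneg u
  have hru : u ^ 2 = r ^ 2 := (sq_abs u).symm
  have h1 : |t - (u - u ^ 2 / 2)| ≤ 2 * r ^ 3 := by
    have h := Real.abs_log_sub_add_sum_range_le (x := -u) (by rw [abs_neg]; linarith) 2
    simp only [Finset.sum_range_succ, Finset.sum_range_zero] at h
    norm_num at h
    rw [← ht, ← hr] at h
    rw [show t - (u - u ^ 2 / 2) = -u + u ^ 2 / 2 + t by ring]
    refine h.trans ?_
    rw [div_le_iff₀ (by linarith)]
    nlinarith [pow_nonneg hr0 3]
  have h2 := abs_le.1 h1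
  have h3 : |t| ≤ 2 * r := by
    have h4 : |t| ≤ |t - (u - u ^ 2 / 2)| + |u - u ^ 2 / 2| := by
      have := abs_add_le (t - (u - u ^ 2 / 2)) (u - u ^ 2 / 2)
      simpa using this
    have h5 : |u - u ^ 2 / 2| ≤ r + r ^ 2 / 2 := by
      have := abs_sub u (u ^ 2 / 2)
      rw [abs_of_nonneg (by positivity : 0 ≤ u ^ 2 / 2), hru] at this
      rw [hru]
      exact this
    nlinarith [mul_nonneg hr0 hr0, mul_nonneg hr0 (sub_nonneg.2 hu), pow_nonneg hr0 3]
  have h6 : |t * κ| ≤ 1 := by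
    rw [abs_mul, abs_of_pos hκ]
    nlinarith [abs_nonneg t]
  have h7 := exp_le_one_add_add_sq h6
  have h8 : (t * κ) ^ 2 ≤ 4 * κ ^ 2 * r ^ 2 := by
    rw [mul_pow, ← sq_abs t]
    nlinarith [pow_le_pow_left₀ (abs_nonneg t) h3 2, sq_nonneg κ]
  have h9 : Real.exp (t * κ) ≤ 1 + κ * (u - u ^ 2 / 2 + 2 * r ^ 3) + 4 * κ ^ 2 * r ^ 2 := by
    nlinarith
  refine (mul_le_mul_of_nonneg_left h9 hpos.le).trans ?_
  rw [hru]
  have h10 : -(u * r ^ 2) ≤ r ^ 3 := by nlinarith [neg_abs_le u, sq_nonneg r]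
  have h11 : u * r ^ 3 ≤ r ^ 3 / 2 := by nlinarith [pow_nonneg hr0 3]
  have h12 : u * r ^ 2 ≤ r ^ 2 / 2 := by nlinarith [sq_nonneg r]
  have h13 : (1 + u) * (1 + κ * (u - r ^ 2 / 2 + 2 * r ^ 3) + 4 * κ ^ 2 * r ^ 2) =
      1 + (1 + κ) * u + κ * (u ^ 2 - r ^ 2 / 2 + -(u * r ^ 2) / 2 + 2 * r ^ 3 + 2 * (u * r ^ 3)) +
        κ ^ 2 * (4 * r ^ 2 + 4 * (u * r ^ 2)) := by ring
  rw [h13, hru]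
  have h14 : r ^ 2 - r ^ 2 / 2 + -(u * r ^ 2) / 2 + 2 * r ^ 3 + 2 * (u * r ^ 3) ≤
      (1 / 2 + 4 * r) * r ^ 2 := by nlinarith [pow_nonneg hr0 3]
  have h15 : 4 * r ^ 2 + 4 * (u * r ^ 2) ≤ 8 * r ^ 2 := by nlinarith [sq_nonneg r]
  have := mul_le_mul_of_nonneg_left h14 hκ.le
  have := mul_le_mul_of_nonneg_left h15 (sq_nonneg κ)
  nlinarith

section

variable {l : ℕ} (p : Fin l → unitInterval) (y : Fin l → Bool)

/-- The law of a symbol in segment `i` tilted by the score with strength `ν i`. -/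
noncomputable def tiltW (ν : Fin l → ℝ) (i : Fin l) (b : Bool) : ℝ :=
  bern (p i) b * (1 + ν i * score b (y i) (p i))

open Classical in
/-- The probability that a user whose symbols follow the tilted law is accused. -/
noncomputable def tiltAcc (Z : ℝ) (ν : Fin l → ℝ) : ℝ :=
  pexp (tiltW p y ν) fun z => if Z < ∑ i, score (z i) (y i) (p i) then 1 else 0

theorem tiltW_sum (ν : Fin l → ℝ) (i : Fin l) : ∑ b, tiltW p y ν i b = 1 := by
  have h : ∀ b, tiltW p y ν i b =
      bern (p i) b + ν i * (bern (p i) b * score b (y i) (p i)) := fun b => by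
    rw [tiltW]; ring
  simp_rw [h, Finset.sum_add_distrib, ← Finset.mul_sum, score_mean, bern_sum]
  ring

theorem tiltW_mean {ν : Fin l → ℝ} {i : Fin l} (hp : 0 < (p i : ℝ) * (1 - p i)) :
    ∑ b, tiltW p y ν i b * score b (y i) (p i) = ν i := by
  obtain ⟨h0, h1⟩ := (mul_one_sub_pos_iff _).1 hp
  have h : ∀ b, tiltW p y ν i b * score b (y i) (p i) =
      bern (p i) b * score b (y i) (p i) + ν i * (bern (p i) b * score b (y i) (p i) ^ 2) :=
    fun b => by rw [tiltW]; ring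
  simp_rw [h, Finset.sum_add_distrib, ← Finset.mul_sum, score_mean, score_second_moment h0 h1]
  ring

/-- A pointwise quadratic bound for the density controls its moment of order `1 + κ`, as the score has
mean `0` and variance at most `1`. -/
theorem tiltW_moment_le {ν : ℝ} {i : Fin l} {κ A : ℝ} (hκ : 0 < κ) (hA : 0 ≤ A)
    (h : ∀ b, (1 + ν * score b (y i) (p i)) ^ (1 + κ) ≤ 1 + (1 + κ) * (ν * score b (y i) (p i)) +
      κ * A * (ν * score b (y i) (p i)) ^ 2) :
    ∑ b, bern (p i) b * (1 + ν * score b (y i) (p i)) ^ (1 + κ) ≤ Real.exp (κ * (A * ν ^ 2)) := by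
  have h1 : ∑ b, bern (p i) b * (1 + ν * score b (y i) (p i)) ^ (1 + κ) ≤
      ∑ b, (bern (p i) b + (1 + κ) * ν * (bern (p i) b * score b (y i) (p i)) +
        κ * A * ν ^ 2 * (bern (p i) b * score b (y i) (p i) ^ 2)) := by
    refine Finset.sum_le_sum fun b _ => ?_
    refine (mul_le_mul_of_nonneg_left (h b) (bern_nonneg' _ _)).trans (le_of_eq ?_)
    ring
  simp_rw [Finset.sum_add_distrib, ← Finset.mul_sum, score_mean, bern_sum] at h1
  have h2 : 0 ≤ κ * A * ν ^ 2 := by positivity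
  have h3 := mul_le_mul_of_nonneg_left (score_second_moment_le (p i) (y i)) h2
  have := Real.add_one_le_exp (κ * (A * ν ^ 2))
  linarith

/-- Innocent users imitate a pirate in every segment. This is too wasteful in general, but good
enough for short codes and for codes with few segments of moderate bias. -/
theorem rowAcc_ge_of_shift {Z a V : ℝ} {μ : Fin l → ℝ}
    (hμ : ∀ i b, 0 ≤ 1 + μ i * score b (y i) (p i)) (ha : 0 < a) (h : a ≤ tiltAcc p y Z μ)
    (hV : ∑ i, μ i ^ 2 ≤ V) :
    (a / 2) ^ 2 * Real.exp (-V) ≤ rowAcc p Z y := by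
  classical
  have h1 := pexp_tilt (w := fun i b => bern (p i) b) (fun i b => bern_nonneg' _ _)
    (fun i b => 1 + μ i * score b (y i) (p i)) hμ one_pos ha (fun i => 1 * μ i ^ 2)
    (fun i => tiltW_moment_le p y one_pos zero_le_one fun b => by
      simpa using rpow_one_add_le (hμ i b) one_pos le_rfl)
    (fun z => Z < ∑ i, score (z i) (y i) (p i)) h
  have h2 : (a / 2) ^ (1 + 1 / (1 : ℝ)) = (a / 2) ^ 2 := by
    rw [show (1 + 1 / (1 : ℝ)) = (2 : ℕ) by norm_num, Real.rpow_natCast]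
  rw [h2] at h1
  simp only [one_mul] at h1
  refine le_trans (mul_le_mul_of_nonneg_left (Real.exp_le_exp.2 (neg_le_neg hV)) (by positivity))
    (h1.trans (le_of_eq ?_))
  rw [rowAcc]

/-- On a set `s` of segments of moderate bias innocent users follow a law tilted by `θ`, so that
their score there exceeds that of a pirate; elsewhere they imitate a pirate. -/
theorem rowAcc_ge_of_tilt {Z a B θ lam κ : ℝ} {μ : Fin l → ℝ} (s : Finset (Fin l))
    (hμ : ∀ i b, 0 ≤ 1 + μ i * score b (y i) (p i)) (ha : 0 < a) (h : a ≤ tiltAcc p y Z μ)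
    (hB : 0 < B) (hs : ∀ i ∈ s, (B ^ 2)⁻¹ ≤ (p i : ℝ) * (1 - p i)) (hθ : 0 ≤ θ)
    (hθB : θ * B ≤ 1 / 2) (hlam : 0 < lam) (hlB : lam * B ≤ 1) (hκ : 0 < κ) (hκ1 : κ ≤ 1 / 2)
    (hgap : ∑ i ∈ s, μ i + 2 * (s.card * lam * B ^ 2 + Real.log (4 / a) / lam) ≤ s.card * θ) :
    (a / 4) ^ (1 + 1 / κ) *
      Real.exp (-(s.card * ((1 / 2 + 4 * (θ * B) + 8 * κ) * θ ^ 2) + ∑ i ∈ sᶜ, μ i ^ 2)) ≤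
      rowAcc p Z y := by
  classical
  set ν : Fin l → ℝ := fun i => if i ∈ s then θ else μ i with hν
  have hpos : ∀ i ∈ s, 0 < (p i : ℝ) * (1 - p i) := fun i hi =>
    lt_of_lt_of_le (by positivity) (hs i hi)
  have habs : ∀ i ∈ s, ∀ b, |θ * score b (y i) (p i)| ≤ θ * B := fun i hi b => by
    rw [abs_mul, abs_of_nonneg hθ]
    exact mul_le_mul_of_nonneg_left (abs_score_le hB _ (hs i hi) _ _) hθ
  have hν0 : ∀ i b, 0 ≤ 1 + ν i * score b (y i) (p i) := by
    intro i b
    by_cases hi : i ∈ s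
    · simp only [hν, hi, if_true]
      linarith [(abs_le.1 ((habs i hi b).trans hθB)).1]
    · simpa only [hν, hi, if_false] using hμ i b
  have hwμ : ∀ i b, 0 ≤ tiltW p y μ i b := fun i b => mul_nonneg (bern_nonneg' _ _) (hμ i b)
  have hwν : ∀ i b, 0 ≤ tiltW p y ν i b := fun i b => mul_nonneg (bern_nonneg' _ _) (hν0 i b)
  set x := Real.log (4 / a) with hx
  have hexp : Real.exp (-x) = a / 4 := by
    rw [hx, Real.exp_neg, Real.exp_log (by positivity), inv_div]
  -- the score on `s` is at most `g` for a pirate and at least `g` under the tilted law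
  set g := ∑ i ∈ s, μ i + (s.card * lam * B ^ 2 + x / lam) with hg
  have c1 : pexp (tiltW p y μ)
      (fun z => if g ≤ ∑ i ∈ s, score (z i) (y i) (p i) then 1 else 0) ≤ a / 4 := by
    rw [← hexp]
    refine pexp_chernoff hwμ (tiltW_sum p y μ) (fun i b => score b (y i) (p i)) s hlam hlB
      (fun i hi b => abs_score_le hB _ (hs i hi) _ _) (M := g) ?_ _ fun z hz => hz
    rw [Finset.sum_congr rfl fun i hi => tiltW_mean p y (hpos i hi), hg]
    linarith
  have c2 : pexp (tiltW p y ν)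
      (fun z => if ∑ i ∈ s, score (z i) (y i) (p i) ≤ g then 1 else 0) ≤ a / 4 := by
    rw [← hexp]
    refine pexp_chernoff hwν (tiltW_sum p y ν) (fun i b => -score b (y i) (p i)) s hlam hlB
      (fun i hi b => by rw [abs_neg]; exact abs_score_le hB _ (hs i hi) _ _) (M := -g) ?_ _
      fun z hz => by rw [Finset.sum_neg_distrib]; linarith
    have : ∀ i ∈ s, ∑ b, tiltW p y ν i b * -score b (y i) (p i) = -θ := fun i hi => by
      simp_rw [mul_neg, Finset.sum_neg_distrib, tiltW_mean p y (hpos i hi)]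
      simp [hν, hi]
    rw [Finset.sum_congr rfl this, Finset.sum_const, nsmul_eq_mul, hg]
    linarith
  -- the score off `s` has the same law in both cases
  set R : (Fin l → Bool) → ℝ := fun z => ∑ i : {i // i ∉ s}, score (z i) (y i) (p i) with hR
  have hsplit : ∀ z : Fin l → Bool, ∑ i, score (z i) (y i) (p i) =
      ∑ i ∈ s, score (z i) (y i) (p i) + R z := fun z => by
    rw [← Fintype.sum_subtype_add_sum_subtype (· ∈ s),
      ← Finset.sum_subtype s (fun _ => Iff.rfl) fun i => score (z i) (y i) (p i)]
  have hsame : pexp (tiltW p y μ) (fun z => if Z - g < R z then 1 else 0) =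
      pexp (tiltW p y ν) (fun z => if Z - g < R z then 1 else 0) := by
    have hw : ∀ ν' : Fin l → ℝ, pexp (tiltW p y ν') (fun z => if Z - g < R z then 1 else 0) =
        pexp (fun i : {i // i ∉ s} => tiltW p y ν' i) fun z =>
          if Z - g < ∑ i : {i // i ∉ s}, score (z i) (y i) (p i) then 1 else 0 := by
      intro ν'
      exact pexp_restrict (tiltW_sum p y ν') (· ∈ s) fun z =>
        if Z - g < ∑ i : {i // i ∉ s}, score (z i) (y i) (p i) then 1 else 0
    rw [hw, hw]
    congr 1
    funext i b
    simp [tiltW, hν, i.2]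
  have c3 : tiltAcc p y Z μ ≤ pexp (tiltW p y μ)
      (fun z => if g ≤ ∑ i ∈ s, score (z i) (y i) (p i) then 1 else 0) +
      pexp (tiltW p y μ) (fun z => if Z - g < R z then 1 else 0) := by
    rw [tiltAcc, ← pexp_add]
    refine pexp_mono hwμ fun z => ?_
    rw [hsplit]
    split_ifs <;> norm_num
    linarith
  have c4 : pexp (tiltW p y ν) (fun z => if Z - g < R z then 1 else 0) ≤ tiltAcc p y Z ν +
      pexp (tiltW p y ν) (fun z => if ∑ i ∈ s, score (z i) (y i) (p i) ≤ g then 1 else 0) := by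
    rw [tiltAcc, ← pexp_add]
    refine pexp_mono hwν fun z => ?_
    rw [hsplit]
    split_ifs <;> norm_num
    linarith
  have c5 : a / 2 ≤ tiltAcc p y Z ν := by linarith
  have h1 := pexp_tilt (w := fun i b => bern (p i) b) (fun i b => bern_nonneg' _ _)
    (fun i b => 1 + ν i * score b (y i) (p i)) hν0 hκ (a := a / 2) (by positivity)
    (fun i => if i ∈ s then (1 / 2 + 4 * (θ * B) + 8 * κ) * θ ^ 2 else 1 * μ i ^ 2)
    (fun i => by
      by_cases hi : i ∈ s
      · simp only [hν, hi, if_true]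
        refine tiltW_moment_le p y hκ (by positivity) fun b => ?_
        refine (rpow_one_add_le_of_small ((habs i hi b).trans hθB) hκ hκ1).trans ?_
        gcongr
        exact habs i hi b
      · simp only [hν, hi, if_false]
        refine tiltW_moment_le p y hκ zero_le_one fun b => ?_
        rw [mul_one]
        exact rpow_one_add_le (hμ i b) hκ (by linarith))
    (fun z => Z < ∑ i, score (z i) (y i) (p i)) c5
  have h2 : ∑ i, (if i ∈ s then (1 / 2 + 4 * (θ * B) + 8 * κ) * θ ^ 2 else 1 * μ i ^ 2) =
      s.card * ((1 / 2 + 4 * (θ * B) + 8 * κ) * θ ^ 2) + ∑ i ∈ sᶜ, μ i ^ 2 := by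
    rw [← Finset.sum_add_sum_compl s, Finset.sum_congr rfl fun i hi => if_pos hi,
      Finset.sum_congr (s₁ := sᶜ) rfl fun i hi => if_neg (Finset.mem_compl.1 hi)]
    simp
  rw [h2, div_div] at h1
  norm_num at h1
  norm_num
  refine h1.trans (le_of_eq ?_)
  rw [rowAcc]

end

/-! ### Typical forgeries -/

namespace Profile

variable {σ : ℝ} (P : Profile σ) {m l : ℕ} (p : Fin l → unitInterval)

/-- The law of the symbol output in segment `i`. -/
noncomputable def outW (m : ℕ) (i : Fin l) (b : Bool) : ℝ := bern (P.outProb m (p i)) b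

theorem outW_nonneg (hm : 1 ≤ m) (i : Fin l) (b : Bool) : 0 ≤ P.outW p m i b :=
  P.bern_outProb_nonneg (p i) hm b

theorem outW_sum (i : Fin l) : ∑ b, P.outW p m i b = 1 := bern_sum _

open Classical in
/-- Markov's inequality for the sum of the squares of the shifts. -/
theorem prob_shift_sq_ge (hm : 1 ≤ m) (I : Finset (Fin l)) {V s : ℝ} (hV : 0 < V)
    (h : ∑ i ∈ I, P.chiBound m (p i) ≤ s * V) :
    pexp (P.outW p m) (fun y => if V ≤ ∑ i ∈ I, P.shift m (p i) (y i) ^ 2 then 1 else 0) ≤ s := by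
  refine pexp_markov (P.outW_nonneg p hm) (F := fun y => ∑ i ∈ I, P.shift m (p i) (y i) ^ 2)
    (fun y => Finset.sum_nonneg fun _ _ => sq_nonneg _) hV ?_ _ fun y hy => hy
  rw [pexp_sum]
  refine (Finset.sum_le_sum fun i _ => ?_).trans h
  rw [pexp_single (P.outW_sum p) i fun b => P.shift m (p i) b ^ 2]
  exact P.sum_shift_sq_le (p i) hm

open Classical in
/-- Chebyshev's inequality for the sum of the shifts. -/
theorem prob_sum_shift_ge (hm : 1 ≤ m) (I : Finset (Fin l)) {t s M : ℝ} (ht : 0 < t)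
    (h : ∑ i ∈ I, P.chiBound m (p i) ≤ s * t ^ 2)
    (hM : I.card * ((σ + 3 * P.M / √m) / m) + t ≤ M) :
    pexp (P.outW p m) (fun y => if M ≤ ∑ i ∈ I, P.shift m (p i) (y i) then 1 else 0) ≤ s := by
  set e : Fin l → ℝ := fun i => ∑ b, P.outW p m i b * P.shift m (p i) b with he
  have hcen : ∀ i, ∑ b, P.outW p m i b * (P.shift m (p i) b - e i) = 0 := fun i => by
    simp_rw [mul_sub, Finset.sum_sub_distrib, ← Finset.sum_mul, outW_sum]
    simp [he]
  refine pexp_markov (P.outW_nonneg p hm)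
    (F := fun y => (∑ i ∈ I, (P.shift m (p i) (y i) - e i)) ^ 2) (fun y => sq_nonneg _)
    (V := t ^ 2) (by positivity) ?_ _ fun y hy => ?_
  · rw [pexp_sq_sum (P.outW_sum p) (fun i b => P.shift m (p i) b - e i) hcen I]
    refine (Finset.sum_le_sum fun i _ => ?_).trans h
    refine le_trans ?_ (P.sum_shift_sq_le (p i) hm)
    have h1 : ∑ b, P.outW p m i b * (P.shift m (p i) b - e i) ^ 2 =
        ∑ b, P.outW p m i b * P.shift m (p i) b ^ 2 - e i ^ 2 := by
      have h2 : ∀ b, P.outW p m i b * (P.shift m (p i) b - e i) ^ 2 =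
          P.outW p m i b * P.shift m (p i) b ^ 2 -
            2 * e i * (P.outW p m i b * P.shift m (p i) b) + P.outW p m i b * e i ^ 2 :=
        fun b => by ring
      simp_rw [h2, Finset.sum_add_distrib, Finset.sum_sub_distrib, ← Finset.mul_sum,
        ← Finset.sum_mul, outW_sum]
      have : ∑ b, P.outW p m i b * P.shift m (p i) b = e i := rfl
      rw [this]; ring
    rw [h1]
    exact sub_le_self _ (sq_nonneg _)
  · have h1 : ∑ i ∈ I, e i ≤ I.card * ((σ + 3 * P.M / √m) / m) := by
      rw [← nsmul_eq_mul]
      exact Finset.sum_le_card_nsmul _ _ _ fun i _ => P.sum_shift_le (p i) hm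
    refine pow_le_pow_left₀ ht.le ?_ 2
    rw [Finset.sum_sub_distrib]
    linarith

theorem chiBound_le (x : ℝ) : P.chiBound m x ≤ 8 * P.M / m ^ 2 := by
  have := P.M_pos
  exact mul_le_of_le_one_right (by positivity) (min_le_left _ _)

theorem chiBound_le' {x τ : ℝ} (hx : x * (1 - x) ≤ τ) :
    P.chiBound m x ≤ 8 * P.M / m ^ 2 * ((τ + 1 / m) / P.a) := by
  have := P.M_pos
  have := P.a_pos
  refine mul_le_mul_of_nonneg_left ((min_le_right _ _).trans ?_) (by positivity)
  gcongr

/-- The segments of moderate bias, those in which the score is bounded by `1 / √τ`. -/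
noncomputable def moderate (τ : ℝ) : Finset (Fin l) :=
  open Classical in Finset.univ.filter fun i => τ ≤ (p i : ℝ) * (1 - p i)

theorem sum_chiBound_compl_le {τ : ℝ} (hτ : 0 ≤ τ) :
    ∑ i ∈ (moderate p τ)ᶜ, P.chiBound m (p i) ≤ l * (8 * P.M / m ^ 2 * ((τ + 1 / m) / P.a)) := by
  have hM := P.M_pos
  have ha := P.a_pos
  have h1 : ∀ i ∈ (moderate p τ)ᶜ, P.chiBound m (p i) ≤
      8 * P.M / m ^ 2 * ((τ + 1 / m) / P.a) := fun i hi => by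
    refine P.chiBound_le' ?_
    simp only [moderate, Finset.mem_compl, Finset.mem_filter, Finset.mem_univ, true_and,
      not_le] at hi
    exact hi.le
  refine (Finset.sum_le_card_nsmul _ _ _ h1).trans ?_
  rw [nsmul_eq_mul]
  refine mul_le_mul_of_nonneg_right ?_ (by positivity)
  exact_mod_cast (Finset.card_le_univ _).trans (by simp)

theorem sum_chiBound_moderate_le {τ : ℝ} :
    ∑ i ∈ moderate p τ, P.chiBound m (p i) ≤ (moderate p τ).card * (8 * P.M / m ^ 2) := by
  rw [← nsmul_eq_mul]
  exact Finset.sum_le_card_nsmul _ _ _ fun i _ => P.chiBound_le _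

open Classical in
/-- If the squared shifts are small on average, then for most forgeries an innocent user can imitate
a pirate in every segment. -/
theorem prob_rowAcc_lt_le_of_shift (hm : 1 ≤ m) {V s β Z : ℝ} (hV : 0 < V) (hs : 0 < s)
    (h : ∑ i, P.chiBound m (p i) ≤ s * V) (hβ : β ≤ (s / m / 2) ^ 2 * Real.exp (-V)) :
    pexp (P.outW p m) (fun y => if s / m ≤ tiltAcc p y Z (fun i => P.shift m (p i) (y i)) ∧
      rowAcc p Z y < β then 1 else 0) ≤ s := by
  have hm0 : (0 : ℝ) < m := Nat.cast_pos.2 hm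
  refine le_trans (pexp_mono (P.outW_nonneg p hm) fun y => ?_)
    (P.prob_shift_sq_ge p hm Finset.univ hV h)
  by_cases h1 : V ≤ ∑ i, P.shift m (p i) (y i) ^ 2
  · rw [if_pos h1]; split_ifs <;> norm_num
  · rw [if_neg h1, if_neg]
    rintro ⟨h2, h3⟩
    exact absurd (hβ.trans (rowAcc_ge_of_shift p y
      (fun i b => P.one_add_shift_mul_score_nonneg (p i) hm b (y i)) (by positivity) h2
      (not_le.1 h1).le)) (not_le.2 h3)

open Classical in
/-- For most forgeries an innocent user reaches the score of a pirate by a uniform tilt `θ` in the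
segments of moderate bias, provided that `θ` exceeds the mean shift there by a margin that covers
the fluctuations of the shifts (`t`) and of the two scores (the terms with `lam`). -/
theorem prob_rowAcc_lt_le_of_tilt (hm : 1 ≤ m) {V s β Z τ t θ B lam κ : ℝ} (hV : 0 < V)
    (hs : 0 < s) (ht : 0 < t) (hB : 0 < B) (hBτ : (B ^ 2)⁻¹ ≤ τ)
    (h : ∑ i ∈ (moderate p τ)ᶜ, P.chiBound m (p i) ≤ s * V)
    (h' : ∑ i ∈ moderate p τ, P.chiBound m (p i) ≤ s * t ^ 2)
    (hθ : 0 ≤ θ) (hθB : θ * B ≤ 1 / 2) (hlam : 0 < lam) (hlB : lam * B ≤ 1) (hκ : 0 < κ)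
    (hκ1 : κ ≤ 1 / 2)
    (hgap : ((moderate p τ).card * ((σ + 3 * P.M / √m) / m) + t) +
      2 * ((moderate p τ).card * lam * B ^ 2 + Real.log (4 / (s / m)) / lam) ≤
        (moderate p τ).card * θ)
    (hβ : β ≤ (s / m / 4) ^ (1 + 1 / κ) *
      Real.exp (-((moderate p τ).card * ((1 / 2 + 4 * (θ * B) + 8 * κ) * θ ^ 2) + V))) :
    pexp (P.outW p m) (fun y => if s / m ≤ tiltAcc p y Z (fun i => P.shift m (p i) (y i)) ∧
      rowAcc p Z y < β then 1 else 0) ≤ 2 * s := by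
  have hm0 : (0 : ℝ) < m := Nat.cast_pos.2 hm
  have e1 := P.prob_shift_sq_ge p hm _ hV h
  have e2 := P.prob_sum_shift_ge p hm _ ht h' le_rfl
  refine le_trans ?_ ((add_le_add e1 e2).trans (two_mul s).symm.le)
  rw [← pexp_add]
  refine pexp_mono (P.outW_nonneg p hm) fun y => ?_
  by_cases h1 : V ≤ ∑ i ∈ (moderate p τ)ᶜ, P.shift m (p i) (y i) ^ 2
  · rw [if_pos h1]; split_ifs <;> norm_num
  by_cases h2 : (moderate p τ).card * ((σ + 3 * P.M / √m) / m) + t ≤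
      ∑ i ∈ moderate p τ, P.shift m (p i) (y i)
  · rw [if_pos h2]; split_ifs <;> norm_num
  rw [if_neg h1, if_neg h2, if_neg, add_zero]
  rintro ⟨h3, h4⟩
  have h5 := rowAcc_ge_of_tilt p y (moderate p τ) (μ := fun i => P.shift m (p i) (y i))
    (fun i b => P.one_add_shift_mul_score_nonneg (p i) hm b (y i)) (by positivity) h3 hB
    (fun i hi => hBτ.trans (by simpa [moderate] using hi)) hθ hθB hlam hlB hκ hκ1
    (le_trans (by gcongr; exact (not_le.1 h2).le) hgap)
  refine absurd (hβ.trans (le_trans ?_ h5)) (not_le.2 h4)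
  have := (not_le.1 h1).le
  gcongr

end Profile

/-- Probabilities of order `s / m` are at least `m⁻²`, written in exponential form. -/
theorem inv_sq_le_div_div {s m k : ℝ} (hk : 0 < k) (hm : 0 < m) (h : k / s ≤ m) (hs : 0 < s) :
    Real.exp (-(2 * Real.log m)) ≤ s / m / k := by
  rw [Real.exp_neg, two_mul, Real.exp_add, Real.exp_log hm, div_div, inv_eq_one_div,
    div_le_div_iff₀ (by positivity) (by positivity)]
  rw [div_le_iff₀ hs] at h
  nlinarith

/-- The slopes used in the lower bound and the loss `ι` that they leave room for. The slope `2 / π`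
of the extremal profile is admissible as long as `A < π ^ 2 / 2`. -/
theorem exists_slopes {A : ℝ} (hA0 : 0 < A) (hA : A < Real.pi ^ 2 / 2) :
    ∃ σ σ' σ'' ι : ℝ, 2 / Real.pi < σ ∧ σ < σ' ∧ σ' < σ'' ∧ 0 < ι ∧ ι < 1 ∧ ι * A ≤ 1 / 4 ∧
      A * (σ'' ^ 2 * (1 / 2 + 2 * ι) + ι) < 1 := by
  have hπ := Real.pi_pos
  have h1 : 2 / Real.pi < √(2 / A) := by
    rw [Real.lt_sqrt (by positivity), div_pow, div_lt_div_iff₀ (by positivity) hA0]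
    linarith
  obtain ⟨σ'', h2, h3⟩ := exists_between h1
  obtain ⟨σ', h4, h5⟩ := exists_between h2
  obtain ⟨σ, h6, h7⟩ := exists_between h4
  have h8 : 0 < σ'' := lt_trans (by positivity) h2
  have h9 : A * σ'' ^ 2 < 2 := by
    rw [Real.lt_sqrt h8.le, lt_div_iff₀ hA0] at h3
    linarith
  obtain ⟨ι, h10, h11⟩ := exists_between (show (0 : ℝ) < min (1 / 2) (min (1 / (4 * A))
    ((1 - A * σ'' ^ 2 / 2) / (A * (2 * σ'' ^ 2 + 1)))) from
      lt_min (by norm_num) (lt_min (by positivity) (div_pos (by linarith) (by positivity))))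
  obtain ⟨h12, h13⟩ := lt_min_iff.1 h11
  obtain ⟨h14, h15⟩ := lt_min_iff.1 h13
  rw [lt_div_iff₀ (by positivity)] at h14 h15
  exact ⟨σ, σ', σ'', ι, h6, h7, h5, h10, by linarith, by linarith, by linarith⟩

namespace Profile

variable {σ : ℝ} (P : Profile σ) {m l : ℕ} (p : Fin l → unitInterval)

open Classical in
/-- The case of few informative segments. -/
theorem prob_rowAcc_lt_le_of_short {s L η' Z : ℝ} (hm : 3 ≤ m) (hs : 0 < s) (hms : 4 / s ≤ m)
    (hL : 16 * Real.log m ≤ L) (hη : η' ≤ 1 / 2)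
    (h : ∑ i, P.chiBound m (p i) ≤ s * (L / 4)) :
    pexp (P.outW p m) (fun y => if s / m ≤ tiltAcc p y Z (fun i => P.shift m (p i) (y i)) ∧
      rowAcc p Z y < Real.exp (-((1 - η') * L)) then 1 else 0) ≤ s := by
  have hm0 : (0 : ℝ) < m := Nat.cast_pos.2 (by omega)
  have hlog : 0 < Real.log m := Real.log_pos (by exact_mod_cast (by omega : 1 < m))
  have hL0 : 0 < L := by linarith
  refine P.prob_rowAcc_lt_le_of_shift p (by omega) (by positivity) hs h ?_
  have h1 : Real.exp (-(2 * Real.log m)) ≤ s / m / 2 :=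
    inv_sq_le_div_div two_pos hm0 (le_trans (by gcongr; norm_num) hms) hs
  refine le_trans ?_ (mul_le_mul_of_nonneg_right
    (pow_le_pow_left₀ (Real.exp_pos _).le h1 2) (Real.exp_pos _).le)
  rw [← Real.exp_nat_mul, ← Real.exp_add, Real.exp_le_exp]
  push_cast
  nlinarith

open Classical in
/-- The case of many segments of moderate bias. The margin between the slopes `σ'` and `σ''` is
split between Chebyshev's bound for the shifts and Chernoff's bounds for the two scores. -/
theorem prob_rowAcc_lt_le_of_long {s L η' Z τ B ω ι A σ' σ'' : ℝ} (hm : 3 ≤ m) (hs : 0 < s)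
    (hms : 4 / s ≤ m) (hη : 0 < η') (hL : 2 * (1 + 1 / (ι / 8)) / η' * Real.log m ≤ L)
    (hι : 0 < ι) (hι1 : ι < 1) (hA : 0 < A) (hσ' : 3 * P.M / √m ≤ σ' - σ) (hσσ : σ' < σ'')
    (hσ0 : 0 < σ'') (hq : A * (σ'' ^ 2 * (1 / 2 + 2 * ι) + ι) ≤ 1 - 2 * η')
    (hτ : 0 < τ) (hB : 0 < B) (hBτ : τ * B ^ 2 = 1) (hω : ω = τ * (σ'' - σ') / 6)
    (hωB : ω * B ≤ m) (hσB : 4 * (σ'' * B) ≤ ι * m) (hl : l ≤ A * m ^ 2 * L)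
    (h : ∑ i ∈ (moderate p τ)ᶜ, P.chiBound m (p i) ≤ s * (ι * A * L))
    (hN : 12 / (ω * (σ'' - σ')) * (m ^ 2 * Real.log m) ≤ (moderate p τ).card)
    (hN' : 72 * P.M / (s * (σ'' - σ') ^ 2) ≤ (moderate p τ).card) :
    pexp (P.outW p m) (fun y => if s / m ≤ tiltAcc p y Z (fun i => P.shift m (p i) (y i)) ∧
      rowAcc p Z y < Real.exp (-((1 - η') * L)) then 1 else 0) ≤ 2 * s := by
  have hM := P.M_pos
  have hm0 : (0 : ℝ) < m := Nat.cast_pos.2 (by omega)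
  have hlog : 0 < Real.log m := Real.log_pos (by exact_mod_cast (by omega : 1 < m))
  have hL0 : 0 < L := lt_of_lt_of_le (by positivity) hL
  set Δ := σ'' - σ' with hΔ
  have hΔ0 : 0 < Δ := sub_pos.2 hσσ
  have hω0 : 0 < ω := by rw [hω]; positivity
  set N : ℝ := ((moderate p τ).card : ℝ) with hNdef
  have hN0 : 0 < N := lt_of_lt_of_le (by positivity) hN'
  have hNl : N ≤ l := by
    rw [hNdef]; exact_mod_cast (Finset.card_le_univ _).trans (by simp)
  have h4 : Real.exp (-(2 * Real.log m)) ≤ s / m / 4 := inv_sq_le_div_div four_pos hm0 hms hs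
  refine P.prob_rowAcc_lt_le_of_tilt p (by omega) (V := ι * A * L) (t := N * Δ / (3 * m))
    (θ := σ'' / m) (B := B) (lam := ω / m) (κ := ι / 8) (by positivity) hs (by positivity) hB
    (by rw [eq_inv_of_mul_eq_one_left hBτ]) h ?_ (by positivity) ?_
    (by positivity) ?_ (by positivity) (by linarith) ?_ ?_
  · refine P.sum_chiBound_moderate_le p |>.trans ?_
    rw [div_le_iff₀ (by positivity)] at hN'
    rw [← hNdef, div_pow, mul_pow, mul_pow, ← mul_div_assoc, ← mul_div_assoc,
      div_le_div_iff₀ (by positivity) (by positivity)]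
    calc N * (8 * P.M) * (3 ^ 2 * (m : ℝ) ^ 2) = N * (72 * P.M) * m ^ 2 := by ring
      _ ≤ N * (N * (s * Δ ^ 2)) * m ^ 2 := by gcongr
      _ = s * (N ^ 2 * Δ ^ 2) * m ^ 2 := by ring
  · rw [div_mul_eq_mul_div, div_le_iff₀ hm0]
    nlinarith
  · rw [div_mul_eq_mul_div, div_le_one hm0]
    exact hωB
  · have e1 : Real.log (4 / (s / m)) ≤ 2 * Real.log m := by
      rw [Real.log_le_iff_le_exp (by positivity), ← neg_neg (2 * Real.log m), Real.exp_neg]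
      rw [← inv_div (s / m) 4]
      exact inv_anti₀ (Real.exp_pos _) h4
    have e2 : N * (ω / m) * B ^ 2 = N * Δ / (6 * m) := by
      have : ω * B ^ 2 = Δ / 6 := by rw [hω]; linear_combination Δ / 6 * hBτ
      rw [show N * (ω / m) * B ^ 2 = N * (ω * B ^ 2) / m by ring, this]
      field_simp
    have e3 : Real.log (4 / (s / m)) / (ω / m) ≤ N * Δ / (6 * m) := by
      rw [div_le_iff₀ (by positivity)]
      refine e1.trans ?_
      rw [div_mul_eq_mul_div, div_le_iff₀ (by positivity)] at hN
      rw [div_mul_div_comm, le_div_iff₀ (by positivity)]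
      linarith
    have e4 : (σ + 3 * P.M / √m) / m ≤ σ' / m := by gcongr; linarith
    rw [e2]
    calc N * ((σ + 3 * P.M / √m) / m) + N * Δ / (3 * m) +
          2 * (N * Δ / (6 * m) + Real.log (4 / (s / m)) / (ω / m))
        ≤ N * (σ' / m) + N * Δ / (3 * m) + 2 * (N * Δ / (6 * m) + N * Δ / (6 * m)) := by gcongr
      _ = N * ((σ' + Δ) / m) := by field_simp; ring
      _ = N * (σ'' / m) := by rw [hΔ]; ring
  · have e1 : Real.exp (-(η' * L)) ≤ (s / m / 4) ^ (1 + 1 / (ι / 8)) := by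
      refine le_trans ?_ (Real.rpow_le_rpow (Real.exp_pos _).le h4 (by positivity))
      rw [← Real.exp_mul, Real.exp_le_exp]
      rw [div_mul_eq_mul_div, div_le_iff₀ hη] at hL
      linarith
    have e2 : N * ((1 / 2 + 4 * (σ'' / m * B) + 8 * (ι / 8)) * (σ'' / m) ^ 2) ≤
        A * L * (σ'' ^ 2 * (1 / 2 + 2 * ι)) := by
      have e3 : 4 * (σ'' / m * B) ≤ ι := by
        rw [div_mul_eq_mul_div, ← mul_div_assoc, div_le_iff₀ hm0]; exact hσB
      calc N * ((1 / 2 + 4 * (σ'' / m * B) + 8 * (ι / 8)) * (σ'' / m) ^ 2)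
          ≤ (A * m ^ 2 * L) * ((1 / 2 + ι + 8 * (ι / 8)) * (σ'' / m) ^ 2) := by
            gcongr; exact hNl.trans hl
        _ = _ := by field_simp; ring
    calc Real.exp (-((1 - η') * L)) ≤ Real.exp (-(η' * L)) *
          Real.exp (-(A * L * (σ'' ^ 2 * (1 / 2 + 2 * ι)) + ι * A * L)) := by
          rw [← Real.exp_add, Real.exp_le_exp]
          have := mul_le_mul_of_nonneg_right hq hL0.le
          linarith
      _ ≤ _ := by gcongr

end Profile

open Classical in
/-- Whatever the biases, a typical forgery of the memoryless strategy cannot incriminate a pirate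
with probability `s / m` without incriminating an innocent user with probability
`exp (-(1 - η') L)`. -/
theorem exists_prob_rowAcc_lt_le {A s : ℝ} (hA0 : 0 < A) (hA : A < Real.pi ^ 2 / 2) (hs : 0 < s) :
    ∃ (σ : ℝ) (P : Profile σ) (η' K : ℝ) (m₀ : ℕ), 0 < η' ∧ η' ≤ 1 ∧
    1 ≤ m₀ ∧ ∀ (m l : ℕ) (L : ℝ),
      m₀ ≤ m → K * Real.log m ≤ L → (l : ℝ) ≤ A * m ^ 2 * L →
      ∀ (p : Fin l → unitInterval) (Z : ℝ),
        pexp (P.outW p m) (fun y => if s / m ≤ tiltAcc p y Z (fun i => P.shift m (p i) (y i)) ∧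
          rowAcc p Z y < Real.exp (-((1 - η') * L)) then 1 else 0) ≤ 2 * s := by
  obtain ⟨σ, σ', σ'', ι, h1, h2, h3, hι, hι1, hιA, hq⟩ := exists_slopes hA0 hA
  obtain ⟨P⟩ := exists_profile h1
  have hM := P.M_pos
  have ha := P.a_pos
  have hσ0 : 0 < σ'' := lt_trans (by positivity) ((h1.trans h2).trans h3)
  set Δ := σ'' - σ' with hΔ
  have hΔ0 : 0 < Δ := sub_pos.2 h3
  set q := A * (σ'' ^ 2 * (1 / 2 + 2 * ι) + ι) with hqdef
  set τ := P.a * (s * ι / 3) / (8 * P.M) with hτ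
  have hτ0 : 0 < τ := by positivity
  set δ := s * ι / 3 / (8 * P.M) with hδ
  have hδ0 : 0 < δ := by positivity
  set B := (√τ)⁻¹ with hB
  have hB0 : 0 < B := by positivity
  set ω := τ * Δ / 6 with hω
  have hω0 : 0 < ω := by positivity
  set η' := min (1 / 2) ((1 - q) / 2) with hη'
  have hη0 : 0 < η' := lt_min (by norm_num) (by linarith)
  set K₁ := max (12 / (ω * Δ) / δ) (72 * P.M / (s * Δ ^ 2) / δ) with hK₁
  have hK₁0 : 0 < K₁ := lt_max_of_lt_left (by positivity)
  set K := max 16 (max (32 * P.M * K₁ / s) (2 * (1 + 1 / (ι / 8)) / η')) with hK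
  have hev : ∀ᶠ m : ℕ in Filter.atTop, 3 ≤ m ∧ 4 / s ≤ m ∧ 24 * P.M / (P.a * s * ι) ≤ m ∧
      (3 * P.M / (σ' - σ)) ^ 2 ≤ m ∧ ω * B ≤ m ∧ 4 * (σ'' * B) / ι ≤ m := by
    have h := fun x : ℝ => (tendsto_natCast_atTop_atTop (R := ℝ)).eventually_ge_atTop x
    filter_upwards [Filter.eventually_ge_atTop 3, h _, h _, h _, h _, h _] with m a1 a2 a3 a4 a5 a6
    exact ⟨a1, a2, a3, a4, a5, a6⟩
  obtain ⟨m₀, hm₀⟩ := Filter.eventually_atTop.1 hev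
  refine ⟨σ, P, η', K, max m₀ 1, hη0,
    (min_le_left _ _).trans (by norm_num), le_max_right _ _, fun m l L hm hL hl p Z => ?_⟩
  obtain ⟨a1, a2, a3, a4, a5, a6⟩ := hm₀ m ((le_max_left _ _).trans hm)
  have hm0 : (0 : ℝ) < m := Nat.cast_pos.2 (by omega)
  have hlog1 : 1 ≤ Real.log m := by
    rw [Real.le_log_iff_exp_le hm0]
    have : (3 : ℝ) ≤ m := by exact_mod_cast a1
    linarith [Real.exp_one_lt_d9]
  have hlog : 0 < Real.log m := by linarith
  have hKL : ∀ x, x ≤ K → x * Real.log m ≤ L := fun x hx =>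
    (mul_le_mul_of_nonneg_right hx hlog.le).trans hL
  have hL16 := hKL 16 (le_max_left _ _)
  have hL0 : 0 < L := by linarith
  have hlm : (l : ℝ) / m ^ 2 ≤ A * L := by
    rw [div_le_iff₀ (by positivity)]; linarith
  have hcompl :
      ∑ i ∈ (Profile.moderate p τ)ᶜ, P.chiBound m (p i) ≤ 2 / 3 * (s * ι) * (l / m ^ 2) := by
    refine (P.sum_chiBound_compl_le p hτ0.le).trans ?_
    have b1 : 8 * P.M * (τ / P.a) = s * ι / 3 := by rw [hτ]; field_simp
    have b2 : 8 * P.M * (1 / m / P.a) ≤ s * ι / 3 := by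
      rw [div_le_iff₀ (by positivity)] at a3
      rw [div_div, ← mul_div_assoc, div_le_div_iff₀ (by positivity) (by norm_num)]
      linarith
    calc (l : ℝ) * (8 * P.M / m ^ 2 * ((τ + 1 / m) / P.a))
        = l / m ^ 2 * (8 * P.M * (τ / P.a) + 8 * P.M * (1 / m / P.a)) := by ring
      _ ≤ l / m ^ 2 * (s * ι / 3 + s * ι / 3) := by rw [b1]; gcongr
      _ = _ := by ring
  have hsum : ∑ i, P.chiBound m (p i) = ∑ i ∈ Profile.moderate p τ, P.chiBound m (p i) +
      ∑ i ∈ (Profile.moderate p τ)ᶜ, P.chiBound m (p i) := (Finset.sum_add_sum_compl _ _).symm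
  have hshort : ∑ i, P.chiBound m (p i) ≤ s * (L / 4) →
      pexp (P.outW p m) (fun y => if s / m ≤ tiltAcc p y Z (fun i => P.shift m (p i) (y i)) ∧
          rowAcc p Z y < Real.exp (-((1 - η') * L)) then 1 else 0) ≤ 2 * s := fun h =>
    (P.prob_rowAcc_lt_le_of_short p a1 hs a2 hL16 (min_le_left _ _) h).trans (by linarith)
  -- `τ` and `δ` are so small that few segments of moderate bias mean a small sum of squared shifts
  by_cases hN : ((Profile.moderate p τ).card : ℝ) ≤ δ * l
  · refine hshort ?_
    have b1 : ((Profile.moderate p τ).card : ℝ) * (8 * P.M / m ^ 2) ≤ s * ι / 3 * (l / m ^ 2) := by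
      calc ((Profile.moderate p τ).card : ℝ) * (8 * P.M / m ^ 2)
          ≤ δ * l * (8 * P.M / m ^ 2) := by gcongr
        _ = s * ι / 3 * (l / m ^ 2) := by rw [hδ]; field_simp
    have b2 := P.sum_chiBound_moderate_le p (m := m) (τ := τ)
    calc ∑ i, P.chiBound m (p i) ≤ s * ι * (l / m ^ 2) := by rw [hsum]; linarith
      _ ≤ s * ι * (A * L) := by gcongr
      _ = s * (ι * A * L) := by ring
      _ ≤ s * (1 / 4 * L) := by gcongr
      _ = s * (L / 4) := by ring
  -- a short code gives the pirates away too little, since `L` dominates `log m`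
  by_cases hl1 : (l : ℝ) ≤ K₁ * (m ^ 2 * Real.log m)
  · refine hshort ?_
    have b1 := hKL _ ((le_max_left _ _).trans (le_max_right 16 _))
    calc ∑ i, P.chiBound m (p i) ≤ ∑ i : Fin l, 8 * P.M / m ^ 2 :=
          Finset.sum_le_sum fun i _ => P.chiBound_le _
      _ = l * (8 * P.M / m ^ 2) := by simp
      _ ≤ K₁ * (m ^ 2 * Real.log m) * (8 * P.M / m ^ 2) := by gcongr
      _ = s / 4 * (32 * P.M * K₁ / s * Real.log m) := by field_simp; ring
      _ ≤ s / 4 * L := by gcongr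
      _ = s * (L / 4) := by ring
  have hN2 : δ * (K₁ * (m ^ 2 * Real.log m)) ≤ (Profile.moderate p τ).card :=
    (mul_le_mul_of_nonneg_left (not_le.1 hl1).le hδ0.le).trans (not_le.1 hN).le
  refine P.prob_rowAcc_lt_le_of_long p a1 hs a2 hη0
    (hKL _ ((le_max_right _ _).trans (le_max_right 16 _))) hι hι1 hA0 ?_ h3 hσ0 ?_ hτ0 hB0 ?_ hω a5
    ?_ hl ?_ ?_ ?_
  · have b1 : 0 < σ' - σ := sub_pos.2 h2
    have b2 : 3 * P.M / (σ' - σ) ≤ √m := Real.le_sqrt_of_sq_le a4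
    rw [div_le_iff₀ b1] at b2
    rw [div_le_iff₀ (by positivity)]
    linarith
  · linarith [min_le_right (1 / 2) ((1 - q) / 2)]
  · rw [hB, inv_pow, Real.sq_sqrt hτ0.le, mul_inv_cancel₀ hτ0.ne']
  · rwa [div_le_iff₀ hι, mul_comm (m : ℝ)] at a6
  · calc _ ≤ _ := hcompl
      _ ≤ 1 * (s * ι) * (A * L) := by gcongr; norm_num
      _ = _ := by ring
  · refine le_trans ?_ hN2
    have b1 : 12 / (ω * Δ) / δ ≤ K₁ := le_max_left _ _
    rw [div_le_iff₀ hδ0] at b1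
    calc 12 / (ω * Δ) * (m ^ 2 * Real.log m) ≤ K₁ * δ * (m ^ 2 * Real.log m) := by gcongr
      _ = _ := by ring
  · refine le_trans ?_ hN2
    have b1 : 72 * P.M / (s * Δ ^ 2) / δ ≤ K₁ := le_max_right _ _
    rw [div_le_iff₀ hδ0] at b1
    have b2 : (1 : ℝ) ≤ m := by exact_mod_cast (by omega : 1 ≤ m)
    have b3 : (1 : ℝ) ≤ m ^ 2 * Real.log m := one_le_mul_of_one_le_of_one_le (one_le_pow₀ b2) hlog1
    calc 72 * P.M / (s * Δ ^ 2) ≤ K₁ * δ * 1 := by linarith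
      _ ≤ K₁ * δ * (m ^ 2 * Real.log m) := by gcongr
      _ = _ := by ring

/-! ### The memoryless pirate strategy -/

namespace Profile

variable {σ : ℝ} (P : Profile σ) {n l : ℕ} {C : Finset (Fin n)}

theorem bern_f_nonneg {ι : Type*} [Fintype ι] (v : ι → Bool) (b : Bool) :
    0 ≤ bern (P.f (ones v / Fintype.card ι)) b :=
  bern_nonneg (P.f_nonneg (by positivity)) (P.f_le_one
    (div_le_one_of_le₀ (by exact_mod_cast ones_le v) (by positivity))) b

/-- The strategy that outputs `1` in a segment with probability `f (k / m)` when `k` of the `m`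
pirates hold the symbol `1`, independently in the different segments. -/
noncomputable def strategy (C : Finset (Fin n)) (l : ℕ) : Strategy C l := fun x =>
  PMF.ofFintype (fun y => ENNReal.ofReal
    (∏ i, bern (P.f (ones (fun j => x j i) / Fintype.card C)) (y i))) <| by
    rw [← ENNReal.ofReal_sum_of_nonneg fun y _ =>
      Finset.prod_nonneg fun _ _ => P.bern_f_nonneg _ _]
    have := pexp_const (w := fun i b => bern (P.f (ones (fun j => x j i) / Fintype.card C)) b)
      (fun i => bern_sum _) 1
    simp only [pexp, mul_one] at this
    rw [this, ENNReal.ofReal_one]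

theorem strategy_toReal (x : C → Fin l → Bool) (y : Fin l → Bool) :
    (P.strategy C l x y).toReal =
      ∏ i, bern (P.f (ones (fun j => x j i) / Fintype.card C)) (y i) :=
  ENNReal.toReal_ofReal (Finset.prod_nonneg fun _ _ => P.bern_f_nonneg _ _)

theorem strategy_marking (hC : C.Nonempty) : (P.strategy C l).Marking := by
  have hne : Nonempty C := hC.to_subtype
  intro x y hy i
  by_contra! h
  have h1 : bern (P.f (ones (fun j => x j i) / Fintype.card C)) (y i) = 0 := by
    cases hyi : y i
    · have h2 : ones (fun j => x j i) = Fintype.card C := by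
        have : ∀ j, x j i = true := fun j => by simpa [hyi] using (h j).symm
        simp [ones, this]
      rw [h2, div_self (Nat.cast_ne_zero.2 Fintype.card_ne_zero), P.f_one]
      simp [bern]
    · have h2 : ones (fun j => x j i) = 0 := by
        have : ∀ j, x j i = false := fun j => by simpa [hyi] using (h j).symm
        simp [ones, this]
      rw [h2, Nat.cast_zero, zero_div, P.f_zero]
      simp [bern]
  refine (PMF.mem_support_iff _ _).1 hy ?_
  rw [strategy, PMF.ofFintype_apply, Finset.prod_eq_zero (Finset.mem_univ i) h1,
    ENNReal.ofReal_zero]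

theorem bexp_bern (k : ℕ) (p : unitInterval) (G : ℕ → ℝ) (y : Bool) :
    bexp k p (fun i => bern (G i) y) = bern (bexp k p G) y := by
  cases y
  · simpa [bern, bexp_const] using bexp_sub p (fun _ => 1) G
  · rfl

/-- The joint law of the symbol of the pirate `j` and the output in one segment. -/
theorem pexp_column {ι : Type*} [Fintype ι] [DecidableEq ι] {m : ℕ} (hm : Fintype.card ι = m)
    (j : ι) (p : unitInterval) (y : Bool) (g : Bool → ℝ) :
    pexp (fun (_ : ι) b => bern p b) (fun v => bern (P.f (ones v / m)) y * g (v j)) =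
      ∑ b, bern p b * bern (P.outGiven m p b) y * g b := by
  have hones : ∀ v : ι → Bool, ones v = ones (fun i : {i // ¬ i = j} => v i) + (v j).toNat := by
    intro v
    rw [ones, ones, ← Finset.sum_erase_add _ _ (Finset.mem_univ j)]
    congr 1
    exact Finset.sum_subtype _ (by simp) fun i => (v i).toNat
  have h1 : ∀ v : ι → Bool, bern (P.f (ones v / m)) y * g (v j) =
      ∑ b, (fun u : {i // i = j} → Bool => if u ⟨j, rfl⟩ = b then g b else 0) (fun i => v i) *
        (fun u : {i // ¬ i = j} → Bool =>
          bern (P.f (((ones u + b.toNat : ℕ) : ℝ) / m)) y) (fun i => v i) := by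
    intro v
    simp only [ite_mul, zero_mul, Finset.sum_ite_eq, Finset.mem_univ, if_true]
    rw [hones v, mul_comm]
  simp_rw [h1]
  rw [pexp_sum]
  refine Finset.sum_congr rfl fun b _ => ?_
  refine (pexp_split (fun (_ : ι) b => bern p b) (· = j)
    (fun u => if u ⟨j, rfl⟩ = b then g b else 0)
    fun u => bern (P.f (((ones u + b.toNat : ℕ) : ℝ) / m)) y).trans ?_
  have h2 : Fintype.card {i // ¬ i = j} = m - 1 := by
    rw [Fintype.card_subtype_compl, Fintype.card_subtype_eq, hm]
  have h3 := pexp_single (w := fun (_ : {i // i = j}) b => bern p b) (fun _ => bern_sum _) ⟨j, rfl⟩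
    fun b' => if b' = b then g b else 0
  simp only [mul_ite, mul_zero, Finset.sum_ite_eq', Finset.mem_univ, if_true] at h3
  refine (congrArg₂ (· * ·) (x' := bern p b * g b) (y' := bern (P.outGiven m p b) y)
    ?_ ?_).trans (by ring)
  · convert h3
  · rw [pexp_ones_eq_bexp h2 p fun i => bern (P.f (((i + b.toNat : ℕ) : ℝ) / m)) y, bexp_bern]
    rfl

variable (p : Fin l → unitInterval)

/-- The output of the strategy has independent symbols, and given the output the rows of each pirate
follow a tilted law. -/
theorem pexp_strategy {m : ℕ} (hC : Fintype.card C = m) (hm : 1 ≤ m) (j : C) (y : Fin l → Bool)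
    (G : (Fin l → Bool) → ℝ) :
    pexp (fun _ : C => rowProb p) (fun x => (P.strategy C l x y).toReal * G (x j)) =
      (∏ i, P.outW p m i (y i)) *
        pexp (tiltW p y fun i => P.shift m (p i) (y i)) G := by
  classical
  have hG : ∀ x : Fin l → Bool, G x = ∑ z, (∏ i, if x i = z i then (1 : ℝ) else 0) * G z := by
    intro x
    rw [Finset.sum_eq_single x]
    · simp
    · intro z _ hz
      obtain ⟨i, hi⟩ := Function.ne_iff.1 hz
      rw [Finset.prod_eq_zero (Finset.mem_univ i) (if_neg (Ne.symm hi)), zero_mul]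
    · simp
  have h1 : ∀ z : Fin l → Bool, ∑ x : C → Fin l → Bool, ∏ i, ((∏ k, bern (p i) (x k i)) *
      (bern (P.f (ones (fun k => x k i) / m)) (y i) * if x j i = z i then (1 : ℝ) else 0)) =
        (∏ i, P.outW p m i (y i)) *
          ∏ i, tiltW p y (fun i => P.shift m (p i) (y i)) i (z i) := by
    intro z
    rw [sum_prod_columns (fun i (v : C → Bool) => (∏ k, bern (p i) (v k)) *
      (bern (P.f (ones v / m)) (y i) * if v j = z i then (1 : ℝ) else 0)),
      ← Finset.prod_mul_distrib]
    refine Finset.prod_congr rfl fun i _ => ?_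
    refine (P.pexp_column hC j (p i) (y i) fun b => if b = z i then 1 else 0).trans ?_
    simp only [mul_ite, mul_one, mul_zero, Finset.sum_ite_eq', Finset.mem_univ, if_true]
    exact P.bern_mul_bern_outGiven_eq_shift (p i) hm _ _
  rw [pexp, pexp, Finset.mul_sum]
  simp_rw [← mul_assoc, ← h1]
  simp_rw [Finset.sum_mul]
  rw [Finset.sum_comm]
  refine Finset.sum_congr rfl fun x _ => ?_
  rw [hG (x j), strategy_toReal, hC, Finset.mul_sum]
  refine Finset.sum_congr rfl fun z _ => ?_
  simp only [Finset.prod_mul_distrib, rowProb]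
  rw [Finset.prod_comm]
  ring

theorem pexp_strategy_one {m : ℕ} (hC : Fintype.card C = m) (hm : 1 ≤ m) (y : Fin l → Bool) :
    pexp (fun _ : C => rowProb p) (fun x => (P.strategy C l x y).toReal) =
      ∏ i, P.outW p m i (y i) := by
  obtain ⟨j⟩ : Nonempty C := Fintype.card_pos_iff.1 (by omega)
  have h := P.pexp_strategy p hC hm j y fun _ => 1
  rw [pexp_const (tiltW_sum p y _)] at h
  simpa using h

theorem coalExp_strategy {m : ℕ} (hC : Fintype.card C = m) (hm : 1 ≤ m)
    (H : (Fin l → Bool) → ℝ) :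
    coalExp p (P.strategy C l) (fun _ y => H y) = pexp (P.outW p m) H := by
  refine Finset.sum_congr rfl fun y _ => ?_
  simp_rw [mul_comm _ (H y)]
  rw [pexp_mul_left, P.pexp_strategy_one p hC hm]

open Classical in
/-- The union bound over the pirates. -/
theorem one_sub_coalExp_le {m : ℕ} (hC : Fintype.card C = m) (hm : 1 ≤ m) (Z : ℝ) :
    1 - coalExp p (P.strategy C l) (fun x y =>
        if ∀ j : C, ¬ Z < ∑ i, score (x j i) (y i) (p i) then 1 else 0) ≤
      pexp (P.outW p m) fun y =>
        min 1 (m * tiltAcc p y Z fun i => P.shift m (p i) (y i)) := by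
  have h1 : (1 : ℝ) = coalExp p (P.strategy C l) fun _ _ => 1 := (coalExp_const p _ 1).symm
  nth_rewrite 1 [h1]
  rw [coalExp, coalExp, ← Finset.sum_sub_distrib]
  refine Finset.sum_le_sum fun y _ => ?_
  rw [← pexp_sub, mul_min_of_nonneg _ _ (Finset.prod_nonneg fun i _ => P.outW_nonneg p hm i _),
    mul_one]
  refine le_min ?_ ?_
  · rw [← P.pexp_strategy_one p hC hm]
    refine pexp_mono (fun _ => rowProb_nonneg p) fun x => ?_
    have h0 := ENNReal.toReal_nonneg (a := P.strategy C l x y)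
    split_ifs <;> linarith
  · have h2 : (∏ i, P.outW p m i (y i)) *
        (m * tiltAcc p y Z fun i => P.shift m (p i) (y i)) =
        pexp (fun _ : C => rowProb p) (fun x => ∑ j : C, (P.strategy C l x y).toReal *
          if Z < ∑ i, score (x j i) (y i) (p i) then 1 else 0) := by
      rw [pexp_sum, Finset.sum_congr rfl fun j _ => P.pexp_strategy p hC hm j y fun x =>
        if Z < ∑ i, score (x i) (y i) (p i) then 1 else 0]
      rw [Finset.sum_const, Finset.card_univ, hC, nsmul_eq_mul, tiltAcc]
      ring
    rw [h2]
    refine pexp_mono (fun _ => rowProb_nonneg p) fun x => ?_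
    have h0 := ENNReal.toReal_nonneg (a := P.strategy C l x y)
    have h3 : ∀ j ∈ Finset.univ, 0 ≤ (P.strategy C l x y).toReal *
        if Z < ∑ i, score (x j i) (y i) (p i) then (1 : ℝ) else 0 := fun j _ => by positivity
    split_ifs with h
    · rw [sub_self]
      exact Finset.sum_nonneg h3
    · push Not at h
      obtain ⟨j, hj⟩ := h
      refine le_trans ?_ (Finset.single_le_sum h3 (Finset.mem_univ j))
      rw [if_pos hj]
      simp

open Classical in
/-- Given the biases, if the pirates are rarely safe then the innocent users are in danger. -/
theorem mul_le_condProb_innocent {m : ℕ} (hC : C.card = m) (hm : 1 ≤ m) {s β Z : ℝ} (hβ0 : 0 ≤ β)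
    (hβ1 : β ≤ 1) (hs : 0 < s)
    (h : pexp (P.outW p m) (fun y =>
      if s / m ≤ tiltAcc p y Z (fun i => P.shift m (p i) (y i)) ∧ rowAcc p Z y < β
        then 1 else 0) ≤ 2 * s) :
    (1 - condProb p (P.strategy C l) (fun X y => ∀ j ∈ C, ¬ Accused Z p X y j) - 3 * s) *
        (1 - (1 - β) ^ (n - m)) ≤
      condProb p (P.strategy C l) (fun X y => ∃ j, j ∉ C ∧ Accused Z p X y j) := by
  have hC' : Fintype.card C = m := by simpa using hC
  have hm0 : (0 : ℝ) < m := Nat.cast_pos.2 hm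
  rw [condProb_innocent, condProb_pirates, hC, P.coalExp_strategy p hC' hm]
  have h1 := P.one_sub_coalExp_le p hC' hm Z
  have h2 : pexp (P.outW p m) (fun y =>
        min 1 (m * tiltAcc p y Z fun i => P.shift m (p i) (y i))) ≤
      s + pexp (P.outW p m) (fun y =>
        if s / m ≤ tiltAcc p y Z (fun i => P.shift m (p i) (y i)) ∧ rowAcc p Z y < β
          then 1 else 0) +
      pexp (P.outW p m) fun y => if β ≤ rowAcc p Z y then 1 else 0 := by
    refine le_of_le_of_eq ?_ (congrArg (· + _ + _) (pexp_const (P.outW_sum p (m := m)) s))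
    rw [← pexp_add, ← pexp_add]
    refine pexp_mono (P.outW_nonneg p hm) fun y => ?_
    by_cases h3 : s / m ≤ tiltAcc p y Z (fun i => P.shift m (p i) (y i))
    · by_cases h4 : β ≤ rowAcc p Z y
      · rw [if_neg fun h5 => absurd h4 (not_le.2 h5.2), if_pos h4]
        exact (min_le_left _ _).trans (by linarith)
      · rw [if_pos ⟨h3, not_le.1 h4⟩, if_neg h4]
        exact (min_le_left _ _).trans (by linarith)
    · rw [div_le_iff₀ hm0] at h3
      refine (min_le_right _ _).trans ?_
      have : (0 : ℝ) ≤ if β ≤ rowAcc p Z y then 1 else 0 := by positivity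
      rw [if_neg fun h5 => h3 (by rw [div_le_iff₀ hm0] at h5; exact h5.1)]
      linarith
  have ht : 0 ≤ 1 - (1 - β) ^ (n - m) :=
    sub_nonneg.2 (pow_le_one₀ (by linarith) (by linarith))
  refine (mul_le_mul_of_nonneg_right (b := _) (c := pexp (P.outW p m)
    fun y => if β ≤ rowAcc p Z y then 1 else 0) (by linarith) ht).trans ?_
  rw [mul_comm, ← pexp_mul_left]
  refine pexp_mono (P.outW_nonneg p hm) fun y => ?_
  have h5 := rowAcc_le_one p Z y
  have h6 := rowAcc_nonneg p Z y
  split_ifs with h4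
  · rw [mul_one]
    gcongr
  · rw [mul_zero]
    exact sub_nonneg.2 (pow_le_one₀ (by linarith) (by linarith))

end Profile

/-! ### The lower bound for the code length -/

open Classical in
theorem measurable_condProb {n l : ℕ} {C : Finset (Fin n)} (ρ : Strategy C l)
    (E : (Fin l → unitInterval) → (Fin n → Fin l → Bool) → (Fin l → Bool) → Prop)
    (hE : ∀ X y, MeasurableSet {p | E p X y}) : Measurable fun p => condProb p ρ (E p) := by
  refine Finset.measurable_fun_sum _ fun y _ => Finset.measurable_fun_sum _ fun X _ => ?_
  refine Measurable.mul ?_ (measurable_const.mul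
    (Measurable.ite (hE X y) measurable_const measurable_const))
  refine Finset.measurable_fun_prod _ fun j _ => Finset.measurable_fun_prod _ fun i _ => ?_
  exact (measurable_bern _).comp (measurable_subtype_coe.comp (measurable_pi_apply i))

theorem measurableSet_accused {n l : ℕ} (Z : ℝ) (X : Fin n → Fin l → Bool) (y : Fin l → Bool)
    (j : Fin n) : MeasurableSet {p | Accused Z p X y j} :=
  measurableSet_lt measurable_const (Finset.measurable_fun_sum _ fun i _ =>
    (measurable_score _ _).comp (measurable_subtype_coe.comp (measurable_pi_apply i)))

open Classical in
/-- Averaging over the biases turns the bound for fixed biases into one for the error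
probabilities. -/
theorem Secure.mul_le {n c l : ℕ} {F : MeasureTheory.ProbabilityMeasure unitInterval}
    {Z ε₁ ε₂ : ℝ} (h : Secure n c l F Z ε₁ ε₂) (hε₁ : 0 ≤ ε₁) (hε₂ : 0 ≤ ε₂) {σ : ℝ} (P : Profile σ)
    {m : ℕ} (hm : 1 ≤ m) (hmc : m ≤ c) (hmn : m ≤ n) {s β : ℝ} (hβ0 : 0 ≤ β) (hβ1 : β ≤ 1)
    (hs : 0 < s)
    (hT : ∀ p : Fin l → unitInterval, pexp (P.outW p m) (fun y =>
      if s / m ≤ tiltAcc p y Z (fun i => P.shift m (p i) (y i)) ∧ rowAcc p Z y < β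
        then 1 else 0) ≤ 2 * s) :
    (1 - ε₂ - 3 * s) * (1 - (1 - β) ^ (n - m)) ≤ ε₁ := by
  obtain ⟨C, -, hC⟩ := Finset.exists_subset_card_eq (s := (Finset.univ : Finset (Fin n)))
    (n := m) (by simpa using hmn)
  have hne : C.Nonempty := Finset.card_pos.1 (by omega)
  obtain ⟨h1, h2⟩ := h C hne (hC.trans_le hmc) (P.strategy C l) (P.strategy_marking hne)
  rw [prob_eq_lintegral] at h1 h2
  set t := 1 - (1 - β) ^ (n - m) with ht
  have ht0 : 0 ≤ t := sub_nonneg.2 (pow_le_one₀ (by linarith) (by linarith))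
  set μ := MeasureTheory.Measure.pi fun _ : Fin l => (F : MeasureTheory.Measure unitInterval)
  have hmeas : Measurable fun p : Fin l → unitInterval => ENNReal.ofReal (condProb p
      (P.strategy C l) (fun X y => ∀ j ∈ C, ¬ Accused Z p X y j)) := by
    refine (measurable_condProb (P.strategy C l) (fun p X y => ∀ j ∈ C, ¬ Accused Z p X y j)
      fun X y => ?_).ennreal_ofReal
    have : {p : Fin l → unitInterval | ∀ j ∈ C, ¬ Accused Z p X y j} =
        ⋂ j ∈ C, {p | Accused Z p X y j}ᶜ := by ext; simp
    rw [this]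
    exact Finset.measurableSet_biInter _ fun j _ => (measurableSet_accused Z X y j).compl
  have h3 : ENNReal.ofReal (t * (1 - 3 * s)) ≤ ENNReal.ofReal (ε₁ + t * ε₂) := by
    calc ENNReal.ofReal (t * (1 - 3 * s)) = ∫⁻ _, ENNReal.ofReal (t * (1 - 3 * s)) ∂μ := by simp
      _ ≤ ∫⁻ p, (ENNReal.ofReal (condProb p (P.strategy C l)
              (fun X y => ∃ j, j ∉ C ∧ Accused Z p X y j)) + ENNReal.ofReal t *
            ENNReal.ofReal (condProb p (P.strategy C l)
              (fun X y => ∀ j ∈ C, ¬ Accused Z p X y j))) ∂μ := by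
          refine MeasureTheory.lintegral_mono fun p => ?_
          rw [← ENNReal.ofReal_mul ht0]
          refine le_trans (ENNReal.ofReal_le_ofReal ?_) ENNReal.ofReal_add_le
          linarith [P.mul_le_condProb_innocent p hC hm hβ0 hβ1 hs (hT p)]
      _ ≤ ENNReal.ofReal ε₁ + ENNReal.ofReal t * ENNReal.ofReal ε₂ := by
          rw [MeasureTheory.lintegral_add_right _ (hmeas.const_mul _),
            MeasureTheory.lintegral_const_mul _ hmeas]
          gcongr
      _ = _ := by rw [← ENNReal.ofReal_mul ht0, ← ENNReal.ofReal_add hε₁ (by positivity)]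
  have h4 := (ENNReal.ofReal_le_ofReal_iff (by positivity)).1 h3
  linarith

theorem div_one_add_le_one_sub_pow {β : ℝ} (hβ0 : 0 ≤ β) (hβ1 : β ≤ 1) (k : ℕ) :
    k * β / (1 + k * β) ≤ 1 - (1 - β) ^ k := by
  have h1 : (1 - β) ^ k ≤ Real.exp (-(k * β)) := by
    rw [← mul_neg, Real.exp_nat_mul]
    exact pow_le_pow_left₀ (by linarith) (by linarith [Real.add_one_le_exp (-β)]) k
  have h2 : (0 : ℝ) ≤ k * β := by positivity
  have h3 : Real.exp (-(k * β)) ≤ 1 / (1 + k * β) := by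
    rw [Real.exp_neg, inv_eq_one_div]
    gcongr
    linarith [Real.add_one_le_exp (k * β)]
  have h4 : k * β / (1 + k * β) = 1 - 1 / (1 + k * β) := by field_simp; ring
  rw [h4]
  linarith

/-- The innocent users number at least `δ n`, and each is accused with probability
`β = (ε / n) exp x`. Their joint risk is then far above `ε` when `x` is large. -/
theorem mul_exp_le_one {b s ε n x β δ : ℝ} {k : ℕ} (hs : 0 < s) (hε : 0 < ε) (hεb : ε ≤ b)
    (hn : 0 < n) (hδ : 0 < δ) (hk : δ * n ≤ k) (hβ : β = ε / n * Real.exp x) (hβ1 : β ≤ 1)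
    (h : (b + 3 * s) * (1 - (1 - β) ^ k) ≤ ε) : 3 * s * δ * Real.exp x ≤ 1 := by
  have hb : 0 < b := hε.trans_le hεb
  have hβ0 : 0 ≤ β := by rw [hβ]; positivity
  set Y := δ * Real.exp x with hY
  have hY0 : 0 < Y := by positivity
  have hYβ : Y * ε ≤ k * β := by
    calc Y * ε = δ * n * β := by rw [hβ, hY]; field_simp
      _ ≤ _ := by gcongr
  have h3 : Y * ε / (1 + Y * ε) ≤ 1 - (1 - β) ^ k := by
    refine le_trans ?_ (div_one_add_le_one_sub_pow hβ0 hβ1 k)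
    rw [div_le_div_iff₀ (by positivity) (by positivity)]
    linarith
  have h4 : (b + 3 * s) * (Y * ε / (1 + Y * ε)) ≤ ε :=
    (mul_le_mul_of_nonneg_left h3 (by positivity)).trans h
  rw [← mul_div_assoc, div_le_iff₀ (by positivity)] at h4
  have h5 : (b + 3 * s) * Y ≤ 1 + Y * ε := by
    refine le_of_mul_le_mul_right ?_ hε
    linarith
  have h6 := mul_le_mul_of_nonneg_left hεb hY0.le
  calc 3 * s * δ * Real.exp x = 3 * s * Y := by rw [hY]; ring
    _ ≤ 1 := by linarith

/-- A coalition of slightly fewer than `c` pirates leaves a positive proportion of innocent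
users. -/
theorem exists_coalition_size {A D : ℝ} (hD : 0 < D) (hDA : D < A) :
    ∃ δ : ℝ, 0 < δ ∧ δ < 1 ∧ ∀ c : ℕ, 1 / δ ≤ c → ∃ m : ℕ, (c : ℝ) / 2 ≤ m ∧
      (m : ℝ) ≤ (1 - δ) * c ∧ D * c ^ 2 ≤ A * m ^ 2 := by
  have hA : 0 < A := hD.trans hDA
  set δ := (1 - D / A) / 4 with hδ
  have hr0 : 0 < D / A := by positivity
  have hr1 : D / A < 1 := (div_lt_one hA).2 hDA
  have hδ0 : 0 < δ := by rw [hδ]; linarith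
  have hδ1 : δ < 1 / 4 := by rw [hδ]; linarith
  refine ⟨δ, hδ0, by linarith, fun c hc => ⟨⌊(1 - δ) * c⌋₊, ?_⟩⟩
  have h0 : (1 - 2 * δ) * c ≤ (⌊(1 - δ) * (c : ℝ)⌋₊ : ℝ) := by
    rw [div_le_iff₀ hδ0] at hc
    linarith [Nat.lt_floor_add_one ((1 - δ) * (c : ℝ))]
  refine ⟨?_, Nat.floor_le (mul_nonneg (by linarith) (by positivity)), ?_⟩
  · have := mul_le_mul_of_nonneg_right (show 1 / 2 ≤ 1 - 2 * δ by linarith) (Nat.cast_nonneg' c)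
    linarith
  · have h1 : D ≤ A * (1 - 2 * δ) ^ 2 := by
      have h2 : D / A ≤ (1 - 2 * δ) ^ 2 := by
        have : (1 - 2 * δ) ^ 2 = D / A + 4 * δ ^ 2 := by rw [hδ]; ring
        linarith [sq_nonneg δ]
      rw [div_le_iff₀ hA] at h2
      linarith
    calc D * (c : ℝ) ^ 2 ≤ A * (1 - 2 * δ) ^ 2 * c ^ 2 := by gcongr
      _ = A * ((1 - 2 * δ) * c) ^ 2 := by ring
      _ ≤ _ := by
        have : 0 ≤ (1 - 2 * δ) * c := mul_nonneg (by linarith) (by positivity)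
        gcongr

/-- No scheme beats the constant `π ^ 2 / 2`, whatever the bias distribution and the threshold. -/
theorem exists_le_of_mem_secureLengths {ε₂ b₁ η : ℝ} (hε₂ : 0 < ε₂) (hsum : b₁ + ε₂ < 1)
    (hη : 0 < η) :
    ∃ K : ℝ, ∀ (c n : ℕ) (ε₁ : ℝ), K ≤ c → c ≤ n → 0 < ε₁ → ε₁ ≤ b₁ →
      K * Real.log c ≤ Real.log (n / ε₁) → ∀ l ∈ secureLengths n c ε₁ ε₂,
        (Real.pi ^ 2 / 2 - η) * (c : ℝ) ^ 2 * Real.log (n / ε₁) ≤ l := by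
  rcases le_or_gt (Real.pi ^ 2 / 2) η with hbig | hsmall
  · -- the claimed bound is not positive
    refine ⟨1, fun c n ε₁ hc hn hε hb hL l _ => ?_⟩
    have hL0 : 0 ≤ Real.log (n / ε₁) := by
      rw [one_mul] at hL
      exact (Real.log_nonneg hc).trans hL
    refine le_trans ?_ (Nat.cast_nonneg l)
    rw [mul_assoc]
    exact mul_nonpos_of_nonpos_of_nonneg (by linarith) (by positivity)
  set D := Real.pi ^ 2 / 2 - η with hD
  have hD0 : 0 < D := by linarith
  -- the margin between `D` and `A` pays for a coalition smaller than `c`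
  set A := Real.pi ^ 2 / 2 - η / 2 with hA
  have hDA : D < A := by linarith
  have hA0 : 0 < A := by linarith
  -- with this `s`, the pirates may be safe with probability `ε₂ + 3 s` and `1 - ε₂ - 3 s > b₁`
  set s := (1 - ε₂ - b₁) / 6 with hs
  have hs0 : 0 < s := by rw [hs]; linarith
  obtain ⟨σ, P, η', K₀, m₀, hη0, hη1, hm₀, hT⟩ := exists_prob_rowAcc_lt_le hA0 (by linarith) hs0
  obtain ⟨δ, hδ0, hδ1, hsize⟩ := exists_coalition_size hD0 hDA
  refine ⟨max (max 3 (1 / δ)) (max (2 * m₀) (max K₀ (1 / (3 * s * δ) / η'))),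
    fun c n ε₁ hc hn hε hεb hL l hl => ?_⟩
  obtain ⟨hc12, hc34⟩ := max_le_iff.1 hc
  obtain ⟨hc1, hc2⟩ := max_le_iff.1 hc12
  obtain ⟨hc3, -⟩ := max_le_iff.1 hc34
  set K := max (max 3 (1 / δ)) (max (2 * m₀) (max K₀ (1 / (3 * s * δ) / η'))) with hK
  have hK0 : K₀ ≤ K := le_max_of_le_right (le_max_of_le_right (le_max_left _ _))
  have hK1 : 1 / (3 * s * δ) / η' ≤ K := le_max_of_le_right (le_max_of_le_right (le_max_right _ _))
  have hK3 : 3 ≤ K := le_max_of_le_left (le_max_left _ _)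
  have hc0 : (0 : ℝ) < c := by linarith
  have hn0 : (0 : ℝ) < n := hc0.trans_le (Nat.cast_le.2 hn)
  have hlogc : 1 ≤ Real.log c := by
    rw [Real.le_log_iff_exp_le hc0]
    linarith [Real.exp_one_lt_d9]
  set L := Real.log (n / ε₁) with hLdef
  have hKL : K ≤ L := (le_mul_of_one_le_right (by linarith) hlogc).trans hL
  have hL0 : 0 < L := by linarith
  obtain ⟨m, hcm, hm2, hm1⟩ := hsize c hc2
  have hm0m : m₀ ≤ m := by
    have : (m₀ : ℝ) ≤ m := by linarith
    exact_mod_cast this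
  have hmc' : (m : ℝ) ≤ c := by linarith [mul_nonneg hδ0.le hc0.le]
  have hmc : m ≤ c := by exact_mod_cast hmc'
  have hmpos : (0 : ℝ) < m := by linarith
  by_contra! hlt
  have hlA : (l : ℝ) ≤ A * m ^ 2 * L := hlt.le.trans (mul_le_mul_of_nonneg_right hm1 hL0.le)
  have hKm : K₀ * Real.log m ≤ L := by
    have e1 : 0 ≤ Real.log m := Real.log_nonneg (by
      have : 1 ≤ m := hm₀.trans hm0m
      exact_mod_cast this)
    calc K₀ * Real.log m ≤ K * Real.log m := by gcongr
      _ ≤ K * Real.log c := by gcongr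
      _ ≤ L := hL
  obtain ⟨F, Z, hsec⟩ := hl
  have hβ1 : Real.exp (-((1 - η') * L)) ≤ 1 := by
    rw [Real.exp_le_one_iff, neg_nonpos]
    exact mul_nonneg (sub_nonneg.2 hη1) hL0.le
  have h1 := hsec.mul_le hε.le hε₂.le P (hm₀.trans hm0m) hmc (hmc.trans hn) (Real.exp_pos _).le hβ1
    hs0 fun p => hT m l L hm0m hKm hlA p Z
  clear hT
  have hb : 1 - ε₂ - 3 * s = b₁ + 3 * s := by rw [hs]; ring
  rw [hb] at h1
  have hk : δ * n ≤ ((n - m : ℕ) : ℝ) := by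
    rw [Nat.cast_sub (hmc.trans hn)]
    have h2 : (1 - δ) * c ≤ (1 - δ) * n :=
      mul_le_mul_of_nonneg_left (Nat.cast_le.2 hn) (by linarith only [hδ1])
    linarith only [h2, hm2]
  have h3 : Real.exp (-((1 - η') * L)) = ε₁ / n * Real.exp (η' * L) := by
    rw [show -((1 - η') * L) = -L + η' * L by ring, Real.exp_add, Real.exp_neg, hLdef,
      Real.exp_log (by positivity), inv_div]
  have h4 := mul_exp_le_one hs0 hε hεb hn0 hδ0 hk h3 hβ1 h1
  have h5 := hK1.trans hKL
  rw [div_le_iff₀ hη0, div_le_iff₀ (by positivity)] at h5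
  have h6 : 3 * s * δ * (η' * L) < 3 * s * δ * Real.exp (η' * L) :=
    mul_lt_mul_of_pos_left ((lt_add_one _).trans_le (Real.add_one_le_exp _)) (by positivity)
  linarith only [h4, h5, h6]

end SymTardos

theorem mainTheorem3 (ε₂ b₁ : ℝ) (hε₂ : 0 < ε₂) (hb₁ : 0 < b₁) (hsum : b₁ + ε₂ < 1)
    (η : ℝ) (hη : 0 < η) :
    ∃ K : ℝ, ∀ (c n : ℕ) (ε₁ : ℝ), K ≤ c → c ≤ n → 0 < ε₁ → ε₁ ≤ b₁ →
      ∃ l : ℕ, IsLeast (SymTardos.secureLengths n c ε₁ ε₂) l ∧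
        (l : ℝ) ≤ (Real.pi ^ 2 / 2 + η) * (c : ℝ) ^ 2 * Real.log (n / ε₁) ∧
        (K * Real.log c ≤ Real.log (n / ε₁) →
          (Real.pi ^ 2 / 2 - η) * (c : ℝ) ^ 2 * Real.log (n / ε₁) ≤ (l : ℝ)) := by
  obtain ⟨K₁, h₁⟩ := SymTardos.exists_secureLengths_le hε₂ (b₁ := b₁) (by linarith) hη
  obtain ⟨K₂, h₂⟩ := SymTardos.exists_le_of_mem_secureLengths hε₂ hsum hη
  refine ⟨max 1 (max K₁ K₂), fun c n ε₁ hc hn hε hb => ?_⟩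
  obtain ⟨hc₁, hc'⟩ := max_le_iff.1 hc
  obtain ⟨hc₂, hc₃⟩ := max_le_iff.1 hc'
  obtain ⟨l, hl, hle⟩ := h₁ c n ε₁ hc₂ hn hε hb
  have hmin : sInf (SymTardos.secureLengths n c ε₁ ε₂) ∈ SymTardos.secureLengths n c ε₁ ε₂ :=
    Nat.sInf_mem ⟨l, hl⟩
  refine ⟨_, ⟨hmin, fun _ h => Nat.sInf_le h⟩,
    (Nat.cast_le.2 (Nat.sInf_le hl)).trans hle, fun hL => h₂ c n ε₁ hc₃ hn hε hb ?_ _ hmin⟩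
  exact (mul_le_mul_of_nonneg_right ((le_max_right _ _).trans (le_max_right _ _))
    (Real.log_nonneg hc₁)).trans hL
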